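/- \textbf{Setting.} Let $n\ge 3$, and let $w_1,\dots,w_n$ be rational numbers with $0<w_1\le\dots\le w_n=1$. For coordinates $x=(x_1,\dots,x_n)$ on $\mathbb C^n$ put $$F_0=\tfrac12x_1x_n^2+\tfrac12x_n\sum_{j=2}^{n-1}x_jx_{n+1-j},\qquad E=\frac1{w_n}\sum_{j=1}^n w_jx_j\partial_{x_j}.$$ For a holomorphic function $F$ on an open set $U\subset\mathbb C^n$ put $P=(\partial_{x_n}F,\dots,\partial_{x_1}F)$, let $C$ be the $n\times n$ matrix with rows $\partial_{x_1}P,\dots,\partial_{x_n}P$, and let $\tilde B_j=\partial_{x_j}C$ and $T=EC$ (entrywise). $F$ is called a potential (a solution of the WDVV equation in the flat coordinates $x$ of weights $w_j$) if $F-F_0$ does not depend on $x_n$, $EF=(w_1+2)F$, and $[\tilde B_j,\tilde B_k]=0$ for all $j,k$. Consider data $(v,u_0,\dots,u_p)$ of polynomials in $x_1,\dots,x_{n-2}$ with complex coefficients, let $z$ be the algebraic function defined by $$z^2+v(x_1,\dots,x_{n-2})-x_{n-1}=0,$$ and let $F=F_0+u_0+u_1z+\dots+u_pz^p$. Call $F$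 an \emph{admissible algebraic potential with weights $w$} if (a) $v$ is weighted homogeneous of weight $w_{n-1}$ and $u_j$ is weighted homogeneous of weight $w_1+2-\tfrac12jw_{n-1}$ for all $j$ (so $z$ has weight $w_{n-1}/2$ and $F$ has weight $w_1+2$); (b) $u_1=u_3=0$; (c) every point $x$ with $x_{n-1}\ne v(x_1,\dots,x_{n-2})$ lies in the domain of a holomorphic branch of $z$, and $F$ is a potential on every open set on which a holomorphic branch of $z$ is given; (d) $\det T$ is a polynomial in $x_1,\dots,x_{n-2},z,x_n$ which is not zero and has no multiple factor. \textbf{Theorem.} For each of the types $X=H_3,D_4,F_4,H_4,E_6,E_7,E_8$ there is an admissible algebraic potential $F$ with the weights given below. In each case the concrete form of $F$ (as an identity modulo the defining equation of $z$) is as follows. (i) Type $H_3$: $(w_1,w_2,w_3)=(\frac13,\frac23,1)$, $z^2-x_1^2-x_2=0$, and $$F=\frac{x_1x_3^2+x_2^2x_3}{2}+\tfrac{4063}{1701}x_1^7+\tfrac{19}{135}x_1^5z^2-\tfrac{73}{27}x_1^3z^4+\tfrac{11}{9}x_1z^6-\tfrac{16}{35}z^7.$$ (ii) Type $D_4$: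 $(w_1,\dots,w_4)=(\frac12,\frac12,1,1)$, $z^2+x_1^2-x_2^2-x_3=0$, and, with $\zeta=\sqrt{-1}\,z$, so that $-x_1^2+x_2^2+x_3+\zeta^2=0$, $$F=\tfrac12x_1x_4^2+x_2x_3x_4-\tfrac{19}{15}x_1^5+\tfrac{14}3x_1^3x_2^2-x_1x_2^4-\tfrac43x_1^3x_3-4x_1x_2^2x_3-\tfrac12x_1x_3^2+\tfrac8{15}\zeta^5.$$ (iii) Type $F_4$: $(w_1,\dots,w_4)=(\frac14,\frac12,\frac34,1)$, and $F$ is the polynomial potential $$F=\tfrac12x_1x_4^2+x_2x_3x_4+\tfrac16x_3^3+\tfrac12x_1x_2x_3^2+\tfrac16x_1^3x_3^2+\tfrac13x_2^3x_3+\tfrac12x_1^2x_2^2x_3+\tfrac14x_1x_2^4+\tfrac16x_1^3x_2^3+\tfrac1{10}x_1^5x_2^2+\tfrac1{504}x_1^9$$ of the reflection group $W(B_4)$ of signed permutations of $\mathbb C^4$. That is, this $F$ is a potential on $\mathbb C^4$, and there are basic invariants $P_1,\dots,P_4$ of $W(B_4)$ (algebraically independent homogeneous generators, of degrees $2,4,6,8$,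 of the ring of invariant polynomials in $y_1,\dots,y_4$) and nonzero constants $c,c'$ such that under the substitution $x_i=P_i(y)$ $$\sum_{k}\frac{\partial P_i}{\partial y_k}\frac{\partial P_j}{\partial y_k}=c\,T_{5-i,j}(P(y)),\qquad \det T(P(y))=c'\prod_iy_i^2\prod_{i<j}(y_i^2-y_j^2)^2 .$$ (iv) Type $H_4$: $(w_1,\dots,w_4)=(\frac1{10},\frac12,\frac35,1)$, $z^2-4x_1(x_1^5-3x_2)-x_3=0$, and $$\begin{aligned}F={}&x_2x_3x_4+\tfrac12x_1x_4^2\\&+\tfrac4{13167}x_1\left(51139x_1^{20}-175560x_1^{15}x_2-95760x_1^{10}x_2^2+1790712x_1^5x_2^3-13167x_2^4\right)\\&-\tfrac4{45}\left(17x_1^{15}+75x_1^{10}x_2-900x_1^5x_2^2+30x_2^3\right)z^2-\tfrac1{18}x_1^4(17x_1^5-90x_2)z^4+\tfrac16x_1^3z^6+\tfrac1{105}z^7.\end{aligned}$$ (v) Type $E_6$: $(w_1,\dots,w_6)=(\frac29,\frac13,\frac59,\frac23,\frac89,1)$, $z^2+v-x_5=0$ with $$v=\begin{aligned} &-9x_1^4-12x_1x_2^2+2x_2x_3+2x_1x_4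 \end{aligned}$$ and $$F=\begin{aligned} &x_3x_4x_6+x_2x_5x_6+\tfrac{1}{2}x_1x_6^2+\tfrac{2106}{5}x_1^{10}+\tfrac{8100}{7}x_1^7x_2^2+348x_1^4x_2^4+\tfrac{104}{3}x_1x_2^6+54x_1^6x_2x_3-84x_1^3x_2^3x_3-\tfrac{44}{5}x_2^5x_3\\ &+\tfrac{648}{5}x_1^5x_3^2+27x_1^2x_2^2x_3^2+6x_1x_2x_3^3+\tfrac{3}{8}x_3^4+54x_1^7x_4-180x_1^4x_2^2x_4-20x_1x_2^4x_4+126x_1^3x_2x_3x_4+4x_2^3x_3x_4+18x_1^2x_3^2x_4\\ &+27x_1^4x_4^2+10x_1x_2^2x_4^2+x_2x_3x_4^2+\tfrac{5}{3}x_1x_4^3-27x_1^6x_5+90x_1^3x_2^2x_5+6x_2^4x_5-27x_1^2x_2x_3x_5+\tfrac{9}{2}x_1x_3^2x_5+9x_1^3x_4x_5\\ &-4x_2^2x_4x_5+\tfrac{1}{2}x_4^2x_5+\tfrac{9}{4}x_1^2x_5^2+\tfrac{2}{5}z^5 \end{aligned}$$ (vi) Type $E_7$: $(w_1,\dots,w_7)=(\frac17,\frac27,\frac37,\frac47,\frac57,\frac67,1)$,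 $z^2+v-x_6=0$ with $$v=\begin{aligned} &-36x_1^6-36x_1^4x_2+12x_1^3x_3-231x_1^2x_2^2-6x_1^2x_4-84x_1x_2x_3-x_1x_5-49x_2^3-7x_2x_4-7x_3^2 \end{aligned}$$ and $$F=\begin{aligned} &\tfrac{1}{2}x_1x_7^2+\tfrac{1}{2}x_4^2x_7+x_3x_5x_7+x_2x_6x_7+\tfrac{3939238656}{1092455}x_1^{15}-\tfrac{10368}{7}x_1^{13}x_2+\tfrac{3456}{7}x_1^{12}x_3+\tfrac{18166464}{539}x_1^{11}x_2^2-\tfrac{1728}{7}x_1^{11}x_4-\tfrac{19008}{7}x_1^{10}x_2x_3\\ &-\tfrac{288}{7}x_1^{10}x_5+\tfrac{216576}{7}x_1^9x_2^3+\tfrac{643392}{49}x_1^9x_3^2-\tfrac{4608}{7}x_1^9x_2x_4-\tfrac{288}{7}x_1^9x_6-\tfrac{1728}{7}x_1^8x_2^2x_3+\tfrac{864}{7}x_1^8x_3x_4-\tfrac{432}{7}x_1^8x_2x_5+60264x_1^7x_2^4-\tfrac{115776}{7}x_1^7x_2x_3^2\\ &+\tfrac{72360}{343}x_1^7x_4^2+3024x_1^7x_2^2x_4+\tfrac{144}{7}x_1^7x_3x_5-\tfrac{432}{7}x_1^7x_2x_6+\tfrac{42528}{7}x_1^6x_3^3+19152x_1^6x_2^3x_3+\tfrac{36864}{7}x_1^6x_2x_3x_4+576x_1^6x_2^2x_5-\tfrac{72}{7}x_1^6x_4x_5+\tfrac{144}{7}x_1^6x_3x_6\\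 &+\tfrac{252252}{5}x_1^5x_2^5+18216x_1^5x_2^2x_3^2+\tfrac{2844}{7}x_1^5x_2x_4^2+\tfrac{942}{245}x_1^5x_5^2+4824x_1^5x_2^3x_4-\tfrac{10944}{7}x_1^5x_3^2x_4+360x_1^5x_2x_3x_5+576x_1^5x_2^2x_6-\tfrac{72}{7}x_1^5x_4x_6-7008x_1^4x_2x_3^3\\ &+\tfrac{36}{7}x_1^4x_3x_4^2+23940x_1^4x_2^4x_3+1728x_1^4x_2^2x_3x_4+420x_1^4x_2^3x_5+\tfrac{1632}{7}x_1^4x_3^2x_5+\tfrac{456}{7}x_1^4x_2x_4x_5+360x_1^4x_2x_3x_6-\tfrac{12}{7}x_1^4x_5x_6+38220x_1^3x_2^6+3032x_1^3x_3^4\\ &-\tfrac{102}{7}x_1^3x_4^3+4116x_1^3x_2^3x_3^2+444x_1^3x_2^2x_4^2-\tfrac{27}{7}x_1^3x_2x_5^2+\tfrac{54}{49}x_1^3x_6^2+5082x_1^3x_2^4x_4+264x_1^3x_2x_3^2x_4+156x_1^3x_2^2x_3x_5-\tfrac{276}{7}x_1^3x_3x_4x_5+420x_1^3x_2^3x_6\\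 &+48x_1^3x_3^2x_6+24x_1^3x_2x_4x_6+1988x_1^2x_2^2x_3^3-150x_1^2x_2x_3x_4^2+\tfrac{25}{7}x_1^2x_3x_5^2+24402x_1^2x_2^5x_3-544x_1^2x_3^3x_4+2436x_1^2x_2^3x_3x_4+357x_1^2x_2^4x_5-156x_1^2x_2x_3^2x_5\\ &-\tfrac{3}{7}x_1^2x_4^2x_5+48x_1^2x_2^2x_4x_5+84x_1^2x_2^2x_3x_6+\tfrac{156}{7}x_1^2x_3x_4x_6-\tfrac{6}{7}x_1^2x_2x_5x_6+5439x_1x_2^7-812x_1x_2x_3^4-6x_1x_2x_4^3+6468x_1x_2^4x_3^2+147x_1x_2^3x_4^2\\ &+54x_1x_3^2x_4^2+\tfrac{5}{2}x_1x_2^2x_5^2-\tfrac{5}{14}x_1x_4x_5^2+\tfrac{9}{7}x_1x_2x_6^2+1764x_1x_2^5x_4+42x_1x_2^2x_3^2x_4+\tfrac{160}{3}x_1x_3^3x_5+140x_1x_2^3x_3x_5+20x_1x_2x_3x_4x_5+294x_1x_2^4x_6\\ &-12x_1x_2x_3^2x_6+\tfrac{9}{7}x_1x_4^2x_6+36x_1x_2^2x_4x_6-\tfrac{10}{7}x_1x_3x_5x_6+\tfrac{1484}{15}x_3^5+\tfrac{1666}{3}x_2^3x_3^3+x_3x_4^3+\tfrac{1}{84}x_5^3+7x_2^2x_3x_4^2-\tfrac{1}{2}x_2x_3x_5^2\\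 &+\tfrac{1}{7}x_3x_6^2+1029x_2^6x_3+\tfrac{364}{3}x_2x_3^3x_4+392x_2^4x_3x_4+\tfrac{49}{5}x_2^5x_5+21x_2^2x_3^2x_5-\tfrac{1}{2}x_2x_4^2x_5+7x_2^3x_4x_5-6x_3^2x_4x_5-\tfrac{20}{3}x_3^3x_6\\ &+84x_2^3x_3x_6+8x_2x_3x_4x_6+2x_2^2x_5x_6+\tfrac{1}{7}x_4x_5x_6+\tfrac{8}{105}z^5 \end{aligned}$$ (vii) Type $E_8$: $(w_1,\dots,w_8)=(\frac1{12},\frac14,\frac13,\frac12,\frac7{12},\frac34,\frac56,1)$, $z^2+v-x_7=0$ with $$v=\begin{aligned} &-x_1^{10}+5x_1^7x_2+\tfrac{1}{2}x_1^6x_3-78x_1^4x_2^2+2x_1^4x_4+20x_1^3x_2x_3-x_1^3x_5-\tfrac{3}{2}x_1^2x_3^2+88x_1x_2^3-24x_1x_2x_4\\ &+2x_1x_6-12x_2^2x_3+2x_2x_5+2x_3x_4 \end{aligned}$$ and $$F=\begin{aligned} &\tfrac{1}{2}x_1x_8^2+x_4x_5x_8+x_3x_6x_8+x_2x_7x_8+\tfrac{472561}{883200}x_1^{25}+\tfrac{5}{6}x_1^{22}x_2+\tfrac{1}{12}x_1^{21}x_3+\tfrac{14781}{304}x_1^{19}x_2^2+\tfrac{1}{3}x_1^{19}x_4+\tfrac{65}{24}x_1^{18}x_2x_3\\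 &-\tfrac{1}{6}x_1^{18}x_5+\tfrac{6255}{1088}x_1^{17}x_3^2-\tfrac{1225}{6}x_1^{16}x_2^3-\tfrac{13}{2}x_1^{16}x_2x_4+\tfrac{1}{3}x_1^{16}x_6+\tfrac{415}{8}x_1^{15}x_2^2x_3+\tfrac{1}{12}x_1^{15}x_3x_4+\tfrac{19}{12}x_1^{15}x_2x_5-\tfrac{1}{6}x_1^{15}x_7+\tfrac{269}{8}x_1^{14}x_2x_3^2\\ &+\tfrac{1}{8}x_1^{14}x_3x_5+\tfrac{14879}{12}x_1^{13}x_2^4+\tfrac{565}{96}x_1^{13}x_3^3+\tfrac{2135}{104}x_1^{13}x_4^2-19x_1^{13}x_2^2x_4-\tfrac{5}{2}x_1^{13}x_2x_6-\tfrac{766}{3}x_1^{12}x_2^3x_3+\tfrac{329}{4}x_1^{12}x_2x_3x_4+22x_1^{12}x_2^2x_5+\tfrac{1}{2}x_1^{12}x_4x_5\\ &-\tfrac{1}{4}x_1^{12}x_3x_6+\tfrac{5}{4}x_1^{12}x_2x_7+150x_1^{11}x_2^2x_3^2+\tfrac{199}{352}x_1^{11}x_5^2+\tfrac{373}{16}x_1^{11}x_3^2x_4-\tfrac{43}{4}x_1^{11}x_2x_3x_5+\tfrac{1}{8}x_1^{11}x_3x_7-\tfrac{21216}{5}x_1^{10}x_2^5+\tfrac{1583}{48}x_1^{10}x_2x_3^3-\tfrac{95}{2}x_1^{10}x_2x_4^2\\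 &+\tfrac{1727}{3}x_1^{10}x_2^3x_4+\tfrac{109}{32}x_1^{10}x_3^2x_5-49x_1^{10}x_2^2x_6-x_1^{10}x_4x_6+\tfrac{1559}{192}x_1^9x_3^4+\tfrac{59}{2}x_1^9x_3x_4^2+\tfrac{10795}{6}x_1^9x_2^4x_3-\tfrac{239}{2}x_1^9x_2^2x_3x_4-\tfrac{743}{6}x_1^9x_2^3x_5+\tfrac{105}{2}x_1^9x_2x_4x_5\\ &+21x_1^9x_2x_3x_6+\tfrac{1}{2}x_1^9x_5x_6+\tfrac{49}{2}x_1^9x_2^2x_7+\tfrac{1}{2}x_1^9x_4x_7-233x_1^8x_2^3x_3^2-\tfrac{7}{8}x_1^8x_2x_5^2+\tfrac{429}{4}x_1^8x_2x_3^2x_4+\tfrac{207}{4}x_1^8x_2^2x_3x_5+\tfrac{21}{2}x_1^8x_3x_4x_5-\tfrac{7}{4}x_1^8x_3^2x_6\\ &-\tfrac{21}{2}x_1^8x_2x_3x_7-\tfrac{1}{4}x_1^8x_5x_7+\tfrac{32150}{3}x_1^7x_2^6+\tfrac{189}{2}x_1^7x_2^2x_3^3+\tfrac{163}{6}x_1^7x_4^3+442x_1^7x_2^2x_4^2+\tfrac{7}{8}x_1^7x_3x_5^2+\tfrac{67}{28}x_1^7x_6^2-2491x_1^7x_2^4x_4+\tfrac{637}{24}x_1^7x_3^3x_4\\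 &+\tfrac{103}{8}x_1^7x_2x_3^2x_5+\tfrac{584}{3}x_1^7x_2^3x_6-26x_1^7x_2x_4x_6+\tfrac{7}{8}x_1^7x_3^2x_7+\tfrac{475}{24}x_1^6x_2x_3^4+\tfrac{307}{2}x_1^6x_2x_3x_4^2-5607x_1^6x_2^5x_3+\tfrac{3446}{3}x_1^6x_2^3x_3x_4+\tfrac{2659}{6}x_1^6x_2^4x_5+\tfrac{131}{48}x_1^6x_3^3x_5\\ &-\tfrac{1}{4}x_1^6x_4^2x_5-96x_1^6x_2^2x_4x_5-48x_1^6x_2^2x_3x_6+\tfrac{39}{2}x_1^6x_3x_4x_6+\tfrac{9}{2}x_1^6x_2x_5x_6-\tfrac{292}{3}x_1^6x_2^3x_7+13x_1^6x_2x_4x_7+\tfrac{1}{2}x_1^6x_6x_7+\tfrac{419}{160}x_1^5x_3^5+\tfrac{2737}{2}x_1^5x_2^4x_3^2\\ &+\tfrac{195}{4}x_1^5x_3^2x_4^2+\tfrac{51}{4}x_1^5x_2^2x_5^2+\tfrac{19}{8}x_1^5x_4x_5^2+\tfrac{17}{80}x_1^5x_7^2+9x_1^5x_2^2x_3^2x_4-147x_1^5x_2^3x_3x_5+33x_1^5x_2x_3x_4x_5+\tfrac{9}{2}x_1^5x_2x_3^2x_6+\tfrac{13}{4}x_1^5x_3x_5x_6+24x_1^5x_2^2x_3x_7\\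 &-3x_1^5x_3x_4x_7-\tfrac{26144}{3}x_1^4x_2^7-\tfrac{400}{3}x_1^4x_2^3x_3^3-\tfrac{64}{3}x_1^4x_2x_4^3-\tfrac{1}{48}x_1^4x_5^3-640x_1^4x_2^3x_4^2+\tfrac{13}{8}x_1^4x_2x_3x_5^2+8x_1^4x_2x_6^2+4956x_1^4x_2^5x_4+65x_1^4x_2x_3^3x_4\\ &+30x_1^4x_2^2x_3^2x_5+\tfrac{51}{4}x_1^4x_3^2x_4x_5-470x_1^4x_2^4x_6+\tfrac{29}{12}x_1^4x_3^3x_6+14x_1^4x_4^2x_6+122x_1^4x_2^2x_4x_6+\tfrac{5}{8}x_1^4x_3x_5x_7+\tfrac{185}{8}x_1^3x_2^2x_3^4+\tfrac{86}{3}x_1^3x_3x_4^3+190x_1^3x_2^2x_3x_4^2\\ &+x_1^3x_3^2x_5^2+\tfrac{7}{2}x_1^3x_3x_6^2+\tfrac{10672}{3}x_1^3x_2^6x_3+\tfrac{383}{48}x_1^3x_3^4x_4-1900x_1^3x_2^4x_3x_4-452x_1^3x_2^5x_5+\tfrac{41}{12}x_1^3x_2x_3^3x_5+34x_1^3x_2x_4^2x_5+198x_1^3x_2^3x_4x_5+162x_1^3x_2^3x_3x_6\\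 &+18x_1^3x_2x_3x_4x_6-15x_1^3x_2^2x_5x_6+4x_1^3x_4x_5x_6+220x_1^3x_2^4x_7-\tfrac{1}{12}x_1^3x_3^3x_7+\tfrac{13}{2}x_1^3x_4^2x_7-43x_1^3x_2^2x_4x_7+x_1^3x_2x_6x_7+\tfrac{25}{16}x_1^2x_2x_3^5-492x_1^2x_2^5x_3^2\\ &+36x_1^2x_2x_3^2x_4^2-9x_1^2x_2^3x_5^2-x_1^2x_2x_7^2+302x_1^2x_2^3x_3^2x_4+\tfrac{25}{32}x_1^2x_3^4x_5+\tfrac{27}{2}x_1^2x_3x_4^2x_5+124x_1^2x_2^4x_3x_5-3x_1^2x_2^2x_3x_4x_5-15x_1^2x_2^2x_3^2x_6+\tfrac{1}{2}x_1^2x_5^2x_6\\ &+\tfrac{21}{2}x_1^2x_3^2x_4x_6+9x_1^2x_2x_3x_5x_6-69x_1^2x_2^3x_3x_7+9x_1^2x_2x_3x_4x_7+\tfrac{15}{2}x_1^2x_2^2x_5x_7-\tfrac{1}{2}x_1^2x_4x_5x_7+x_1^2x_3x_6x_7+1240x_1x_2^8+\tfrac{11}{96}x_1x_3^6+\tfrac{35}{3}x_1x_4^4\\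 &+\tfrac{76}{3}x_1x_2^4x_3^3+20x_1x_2^2x_4^3+\tfrac{1}{6}x_1x_2x_5^3+360x_1x_2^4x_4^2+8x_1x_3^3x_4^2+\tfrac{3}{2}x_1x_2^2x_3x_5^2+x_1x_3x_4x_5^2+10x_1x_2^2x_6^2+5x_1x_4x_6^2+\tfrac{1}{8}x_1x_3x_7^2\\ &-\tfrac{3200}{3}x_1x_2^6x_4-5x_1x_2^2x_3^3x_4-7x_1x_2^3x_3^2x_5+\tfrac{21}{2}x_1x_2x_3^2x_4x_5+96x_1x_2^5x_6+\tfrac{5}{2}x_1x_2x_3^3x_6+20x_1x_2x_4^2x_6-80x_1x_2^3x_4x_6+\tfrac{5}{4}x_1x_3^2x_5x_6+\tfrac{15}{2}x_1x_2^2x_3^2x_7\\ &+\tfrac{1}{8}x_1x_5^2x_7+\tfrac{3}{4}x_1x_3^2x_4x_7-\tfrac{3}{2}x_1x_2x_3x_5x_7+\tfrac{1}{3}x_2^3x_3^4+\tfrac{44}{3}x_2x_3x_4^3+\tfrac{1}{24}x_3x_5^3-44x_2^3x_3x_4^2+\tfrac{1}{4}x_2x_3^2x_5^2+x_2x_3x_6^2+\tfrac{1}{2}x_5x_6^2\\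 &-\tfrac{704}{3}x_2^7x_3+\tfrac{7}{4}x_2x_3^4x_4+176x_2^5x_3x_4+\tfrac{160}{3}x_2^6x_5+\tfrac{1}{2}x_2^2x_3^3x_5+\tfrac{2}{3}x_4^3x_5+2x_2^2x_4^2x_5-32x_2^4x_4x_5+\tfrac{3}{4}x_3^3x_4x_5+\tfrac{1}{8}x_3^4x_6\\ &+6x_3x_4^2x_6-8x_2^4x_3x_6+12x_2^2x_3x_4x_6+4x_2^3x_5x_6+2x_2x_4x_5x_6-\tfrac{168}{5}x_2^5x_7-\tfrac{1}{4}x_2x_3^3x_7-4x_2x_4^2x_7+24x_2^3x_4x_7+\tfrac{1}{8}x_3^2x_5x_7\\ &-4x_2^2x_6x_7+x_4x_6x_7+\tfrac{1}{15}z^5 \end{aligned}$$ -/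

import Mathlib

namespace WDVV

open scoped BigOperators

/-!  Flat coordinates on `ℂⁿ` with `n = m + 2` are indexed by `Fin (m + 2)`, so that the coordinate
`x_j` of the text is `x (j - 1)` here. -/

/-- The index of the coordinate `x_n`. -/
abbrev idxLast (m : ℕ) : Fin (m + 2) := Fin.last (m + 1)

/-- The index of the coordinate `x_{n-1}`. -/
abbrev idxPen (m : ℕ) : Fin (m + 2) := (Fin.last m).castSucc

/-- The coordinates `x_1, …, x_{n-2}`. -/
def initial {m : ℕ} (x : Fin (m + 2) → ℂ) : Fin m → ℂ := fun i => x (i.castAdd 2)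

/-- The partial derivative `∂f/∂x_j` at `x`. -/
noncomputable def pd {n : ℕ} (j : Fin n) (f : (Fin n → ℂ) → ℂ) (x : Fin n → ℂ) : ℂ :=
  fderiv ℂ f x (Pi.single j 1)

/-- The Euler field `E = (1 / w_n) ∑ w_j x_j ∂_{x_j}` applied to `f`. -/
noncomputable def euler {m : ℕ} (w : Fin (m + 2) → ℚ) (f : (Fin (m + 2) → ℂ) → ℂ)
    (x : Fin (m + 2) → ℂ) : ℂ :=
  1 / (w (idxLast m) : ℂ) * ∑ j, (w j : ℂ) * x j * pd j f x

/-- `F₀ = (1/2) x_1 x_n² + x_n · (sum of x_j x_{n+1-j} over the pairs {j, n+1-j} with 1 < j < n)`,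
where the middle index of an odd `n` contributes `(1/2) x_j²`. -/
noncomputable def F0 {m : ℕ} (x : Fin (m + 2) → ℂ) : ℂ :=
  1 / 2 * x 0 * x (idxLast m) ^ 2
    + 1 / 2 * x (idxLast m) * ∑ j ∈ ({0, idxLast m} : Finset (Fin (m + 2)))ᶜ, x j * x j.rev

/-- The vector `P = (∂_{x_n} F, …, ∂_{x_1} F)`. -/
noncomputable def gradP {n : ℕ} (F : (Fin n → ℂ) → ℂ) (x : Fin n → ℂ) : Fin n → ℂ :=
  fun j => pd j.rev F x

/-- The matrix `C` with rows `∂_{x_1} P, …, ∂_{x_n} P`. -/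
noncomputable def matC {n : ℕ} (F : (Fin n → ℂ) → ℂ) (x : Fin n → ℂ) : Matrix (Fin n) (Fin n) ℂ :=
  Matrix.of fun i j => pd i (fun y => gradP F y j) x

/-- The matrix `∂_{x_k} C`. -/
noncomputable def matB {n : ℕ} (F : (Fin n → ℂ) → ℂ) (k : Fin n) (x : Fin n → ℂ) :
    Matrix (Fin n) (Fin n) ℂ :=
  Matrix.of fun i j => pd k (fun y => matC F y i j) x

/-- The matrix `T = E C`. -/
noncomputable def matT {m : ℕ} (w : Fin (m + 2) → ℚ) (F : (Fin (m + 2) → ℂ) → ℂ)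
    (x : Fin (m + 2) → ℂ) : Matrix (Fin (m + 2)) (Fin (m + 2)) ℂ :=
  Matrix.of fun i j => euler w (fun y => matC F y i j) x

/-- `F` is a potential on `U`, i.e. a holomorphic solution of the WDVV equation with weights `w` in
the flat coordinates: `F - F₀` does not depend on `x_n`, the weights satisfy
`0 < w_1 ≤ … ≤ w_n = 1`, `E F = (w_1 + 2) F` (the weight of `F` is that of `F₀`), and the matrices
`∂_{x_j} C` commute. -/
structure IsPotential {m : ℕ} (w : Fin (m + 2) → ℚ) (U : Set (Fin (m + 2) → ℂ))
    (F : (Fin (m + 2) → ℂ) → ℂ) : Prop where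
  weight_pos : 0 < w 0
  weight_mono : Monotone w
  weight_last : w (idxLast m) = 1
  analytic : AnalyticOnNhd ℂ F U
  normal_form : ∀ x ∈ U, pd (idxLast m) (fun y => F y - F0 y) x = 0
  homogeneous : ∀ x ∈ U, euler w F x = ((w 0 : ℂ) + 2) * F x
  wdvv : ∀ x ∈ U, ∀ j k, ⁅matB F j x, matB F k x⁆ = 0

/-- `z` is a holomorphic branch on the open set `U` of the algebraic function of `x_1, …, x_{n-1}`
defined by `z² + v(x_1, …, x_{n-2}) - x_{n-1} = 0`. -/
structure IsBranch {m : ℕ} (v : MvPolynomial (Fin m) ℂ) (U : Set (Fin (m + 2) → ℂ))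
    (z : (Fin (m + 2) → ℂ) → ℂ) : Prop where
  isOpen : IsOpen U
  analytic : AnalyticOnNhd ℂ z U
  equation : ∀ x ∈ U, z x ^ 2 + MvPolynomial.eval (initial x) v - x (idxPen m) = 0

/-- `F₀(x) + u_0 + u_1 Z + ⋯ + u_p Z^p`, where the polynomial `u` in `Z` has the coefficients
`u_j = u_j(x_1, …, x_{n-2})`. -/
noncomputable def candidate {m : ℕ} (u : Polynomial (MvPolynomial (Fin m) ℂ))
    (x : Fin (m + 2) → ℂ) (Z : ℂ) : ℂ :=
  F0 x + u.eval₂ (MvPolynomial.eval (initial x)) Z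

/-- The function `F = F₀ + ∑ u_j z^j`, with `z² + v - x_{n-1} = 0`, is an algebraic potential with
weights `w` of the required kind: `v` and the `u_j` are weighted homogeneous polynomials such that
`z` has weight `w_{n-1} / 2` and `F` has weight `w_1 + 2`; `u_1 = u_3 = 0`; branches of `z` exist
near every point off the branch locus; on every branch `F` solves the WDVV equation; and `det T` is
a nonzero polynomial in `x_1, …, x_{n-2}, z, x_n` without multiple factors. -/
structure IsAlgebraicPotential {m : ℕ} (w : Fin (m + 2) → ℚ) (v : MvPolynomial (Fin m) ℂ)
    (u : Polynomial (MvPolynomial (Fin m) ℂ)) : Prop where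
  v_weight : MvPolynomial.IsWeightedHomogeneous (fun i : Fin m => w (i.castAdd 2)) v (w (idxPen m))
  u_weight : ∀ j : ℕ, MvPolynomial.IsWeightedHomogeneous (fun i : Fin m => w (i.castAdd 2))
    (u.coeff j) (w 0 + 2 - j * (w (idxPen m) / 2))
  u_one : u.coeff 1 = 0
  u_three : u.coeff 3 = 0
  exists_branch : ∀ p : Fin (m + 2) → ℂ, p (idxPen m) ≠ MvPolynomial.eval (initial p) v →
    ∃ U z, IsBranch v U z ∧ p ∈ U
  potential : ∀ U z, IsBranch v U z → IsPotential w U (fun x => candidate u x (z x))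
  /- In `δ` the variable with the index of `x_{n-1}` stands for `z`. -/
  det_squarefree : ∃ δ : MvPolynomial (Fin (m + 2)) ℂ, δ ≠ 0 ∧ Squarefree δ ∧
    ∀ U z, IsBranch v U z → ∀ x ∈ U,
      (matT w (fun y => candidate u y (z y)) x).det
        = MvPolynomial.eval (Function.update x (idxPen m) (z x)) δ

/-- The elements of the reflection group of type `B_n`, the signed permutations, acting on
polynomials. -/
noncomputable def signedPerm {n : ℕ} (σ : Equiv.Perm (Fin n)) (ε : Fin n → ℤˣ) :
    MvPolynomial (Fin n) ℂ →ₐ[ℂ] MvPolynomial (Fin n) ℂ :=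
  MvPolynomial.aeval fun i => MvPolynomial.C ((ε i : ℤ) : ℂ) * MvPolynomial.X (σ i)

/-- `P` is a system of basic invariants of the reflection group of type `B_n`: homogeneous,
algebraically independent generators, of degrees `2, 4, …, 2n`, of the ring of invariants. -/
structure IsBasicInvariantsB {n : ℕ} (P : Fin n → MvPolynomial (Fin n) ℂ) : Prop where
  homogeneous : ∀ i, (P i).IsHomogeneous (2 * (i + 1))
  independent : AlgebraicIndependent ℂ P
  generate : ∀ q : MvPolynomial (Fin n) ℂ,
    q ∈ Algebra.adjoin ℂ (Set.range P) ↔ ∀ σ ε, signedPerm σ ε q = q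

/-- The discriminant of the reflection group of type `B_n`, the product of the squares of the linear
forms `y_i` and `y_i ± y_j`, `i < j`, which define the reflecting hyperplanes. -/
noncomputable def discB {n : ℕ} (y : Fin n → ℂ) : ℂ :=
  (∏ i, y i ^ 2) * ∏ i, ∏ j ∈ Finset.Ioi i, ((y i - y j) * (y i + y j)) ^ 2

/-- `F` is a polynomial potential of the reflection group of type `B_n`: it is a polynomial which
solves the WDVV equation, and for suitable basic invariants `P` of the group, the flat coordinates,
the matrix `T` (with its rows in the reverse order) is up to a constant the matrix of the scalar
products of the gradients of the invariants, and `det T` is up to a constant the discriminant. -/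
def IsPotentialOfTypeB {m : ℕ} (w : Fin (m + 2) → ℚ) (F : (Fin (m + 2) → ℂ) → ℂ) : Prop :=
  (∃ f : MvPolynomial (Fin (m + 2)) ℂ, ∀ x, F x = MvPolynomial.eval x f) ∧
  IsPotential w Set.univ F ∧
  ∃ P : Fin (m + 2) → MvPolynomial (Fin (m + 2)) ℂ, IsBasicInvariantsB P ∧
    (∃ c : ℂ, c ≠ 0 ∧ ∀ y i j,
      ∑ k, MvPolynomial.eval y (MvPolynomial.pderiv k (P i))
          * MvPolynomial.eval y (MvPolynomial.pderiv k (P j))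
        = c * matT w F (fun l => MvPolynomial.eval y (P l)) i.rev j) ∧
    ∃ c : ℂ, c ≠ 0 ∧ ∀ y, (matT w F (fun l => MvPolynomial.eval y (P l))).det = c * discB y

/-- The polynomial potential of the reflection group of type `B₄` in flat coordinates. -/
noncomputable def potentialB4 (x₁ x₂ x₃ x₄ : ℂ) : ℂ :=
    (1/2) * x₁ * x₄^2 + x₂ * x₃ * x₄ + (1/6) * x₃^3 + (1/2) * x₁ * x₂ * x₃^2
    + (1/6) * x₁^3 * x₃^2 + (1/3) * x₂^3 * x₃ + (1/2) * x₁^2 * x₂^2 * x₃ + (1/4) * x₁ * x₂^4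
    + (1/6) * x₁^3 * x₂^3 + (1/10) * x₁^5 * x₂^2 + (1/504) * x₁^9

/-- The algebraic potential of type `H₃` in which `z` satisfies `-x₂ - x₁² + z² = 0`. -/
noncomputable def potentialH3 (x₁ x₂ x₃ z : ℂ) : ℂ :=
    (x₁ * x₃^2 + x₂^2 * x₃) / 2 + (4063/1701) * x₁^7 + (19/135) * x₁^5 * z^2
    - (73/27) * x₁^3 * z^4 + (11/9) * x₁ * z^6 - (16/35) * z^7

/-- The algebraic potential of type `D₄` in which `ζ` satisfies `-x₁² + x₂² + x₃ + ζ² = 0`. -/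
noncomputable def potentialD4 (x₁ x₂ x₃ x₄ ζ : ℂ) : ℂ :=
    (1/2) * x₁ * x₄^2 + x₂ * x₃ * x₄ - (19/15) * x₁^5 + (14/3) * x₁^3 * x₂^2 - x₁ * x₂^4
    - (4/3) * x₁^3 * x₃ - 4 * x₁ * x₂^2 * x₃ - (1/2) * x₁ * x₃^2 + (8/15) * ζ^5

/-- The polynomial `v` of the defining equation of `z` for type `H₄`. -/
noncomputable def vH4 (x₁ x₂ : ℂ) : ℂ :=
    -4 * x₁ * (x₁^5 - 3 * x₂)

/-- The potential of type `H₄`, as an expression in the flat coordinates and `z`. -/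
noncomputable def potentialH4 (x₁ x₂ x₃ x₄ z : ℂ) : ℂ :=
    x₂ * x₃ * x₄ + (1/2) * x₁ * x₄^2
    + (4/13167) * x₁ * (51139 * x₁^20 - 175560 * x₁^15 * x₂ - 95760 * x₁^10 * x₂^2
      + 1790712 * x₁^5 * x₂^3 - 13167 * x₂^4)
    - (4/45) * (17 * x₁^15 + 75 * x₁^10 * x₂ - 900 * x₁^5 * x₂^2 + 30 * x₂^3) * z^2
    - (1/18) * x₁^4 * (17 * x₁^5 - 90 * x₂) * z^4 + (1/6) * x₁^3 * z^6 + (1/105) * z^7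

/-- The polynomial `v` of the defining equation of `z` for type `E₆`. -/
noncomputable def vE6 (x₁ x₂ x₃ x₄ : ℂ) : ℂ :=
    -9 * x₁^4 - 12 * x₁ * x₂^2 + 2 * x₂ * x₃ + 2 * x₁ * x₄

/-- The potential of type `E₆`, as an expression in the flat coordinates and `z`. -/
noncomputable def potentialE6 (x₁ x₂ x₃ x₄ x₅ x₆ z : ℂ) : ℂ :=
    x₃ * x₄ * x₆ + x₂ * x₅ * x₆ + (1/2) * x₁ * x₆^2 + (2106/5) * x₁^10 + (8100/7) * x₁^7 * x₂^2
    + 348 * x₁^4 * x₂^4 + (104/3) * x₁ * x₂^6 + 54 * x₁^6 * x₂ * x₃ - 84 * x₁^3 * x₂^3 * x₃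
    - (44/5) * x₂^5 * x₃ + (648/5) * x₁^5 * x₃^2 + 27 * x₁^2 * x₂^2 * x₃^2 + 6 * x₁ * x₂ * x₃^3
    + (3/8) * x₃^4 + 54 * x₁^7 * x₄ - 180 * x₁^4 * x₂^2 * x₄ - 20 * x₁ * x₂^4 * x₄
    + 126 * x₁^3 * x₂ * x₃ * x₄ + 4 * x₂^3 * x₃ * x₄ + 18 * x₁^2 * x₃^2 * x₄ + 27 * x₁^4 * x₄^2
    + 10 * x₁ * x₂^2 * x₄^2 + x₂ * x₃ * x₄^2 + (5/3) * x₁ * x₄^3 - 27 * x₁^6 * x₅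
    + 90 * x₁^3 * x₂^2 * x₅ + 6 * x₂^4 * x₅ - 27 * x₁^2 * x₂ * x₃ * x₅ + (9/2) * x₁ * x₃^2 * x₅
    + 9 * x₁^3 * x₄ * x₅ - 4 * x₂^2 * x₄ * x₅ + (1/2) * x₄^2 * x₅ + (9/4) * x₁^2 * x₅^2
    + (2/5) * z^5

/-- The polynomial `v` of the defining equation of `z` for type `E₇`. -/
noncomputable def vE7 (x₁ x₂ x₃ x₄ x₅ : ℂ) : ℂ :=
    -36 * x₁^6 - 36 * x₁^4 * x₂ + 12 * x₁^3 * x₃ - 231 * x₁^2 * x₂^2 - 6 * x₁^2 * x₄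
    - 84 * x₁ * x₂ * x₃ - x₁ * x₅ - 49 * x₂^3 - 7 * x₂ * x₄ - 7 * x₃^2

/-- Part of the potential of type `E₇`. -/
noncomputable def partE7a (x₁ x₂ x₃ x₄ x₅ x₆ : ℂ) : ℂ :=
    (3939238656/1092455) * x₁^15 - (10368/7) * x₁^13 * x₂ + (3456/7) * x₁^12 * x₃
    + (18166464/539) * x₁^11 * x₂^2 - (1728/7) * x₁^11 * x₄ - (19008/7) * x₁^10 * x₂ * x₃
    - (288/7) * x₁^10 * x₅ + (216576/7) * x₁^9 * x₂^3 + (643392/49) * x₁^9 * x₃^2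
    - (4608/7) * x₁^9 * x₂ * x₄ - (288/7) * x₁^9 * x₆ - (1728/7) * x₁^8 * x₂^2 * x₃
    + (864/7) * x₁^8 * x₃ * x₄ - (432/7) * x₁^8 * x₂ * x₅ + 60264 * x₁^7 * x₂^4
    - (115776/7) * x₁^7 * x₂ * x₃^2 + (72360/343) * x₁^7 * x₄^2 + 3024 * x₁^7 * x₂^2 * x₄
    + (144/7) * x₁^7 * x₃ * x₅ - (432/7) * x₁^7 * x₂ * x₆ + (42528/7) * x₁^6 * x₃^3
    + 19152 * x₁^6 * x₂^3 * x₃ + (36864/7) * x₁^6 * x₂ * x₃ * x₄ + 576 * x₁^6 * x₂^2 * x₅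
    - (72/7) * x₁^6 * x₄ * x₅ + (144/7) * x₁^6 * x₃ * x₆ + (252252/5) * x₁^5 * x₂^5
    + 18216 * x₁^5 * x₂^2 * x₃^2 + (2844/7) * x₁^5 * x₂ * x₄^2 + (942/245) * x₁^5 * x₅^2
    + 4824 * x₁^5 * x₂^3 * x₄ - (10944/7) * x₁^5 * x₃^2 * x₄ + 360 * x₁^5 * x₂ * x₃ * x₅
    + 576 * x₁^5 * x₂^2 * x₆ - (72/7) * x₁^5 * x₄ * x₆ - 7008 * x₁^4 * x₂ * x₃^3
    + (36/7) * x₁^4 * x₃ * x₄^2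

/-- Part of the potential of type `E₇`. -/
noncomputable def partE7b (x₁ x₂ x₃ x₄ x₅ x₆ : ℂ) : ℂ :=
    23940 * x₁^4 * x₂^4 * x₃ + 1728 * x₁^4 * x₂^2 * x₃ * x₄ + 420 * x₁^4 * x₂^3 * x₅
    + (1632/7) * x₁^4 * x₃^2 * x₅ + (456/7) * x₁^4 * x₂ * x₄ * x₅ + 360 * x₁^4 * x₂ * x₃ * x₆
    - (12/7) * x₁^4 * x₅ * x₆ + 38220 * x₁^3 * x₂^6 + 3032 * x₁^3 * x₃^4 - (102/7) * x₁^3 * x₄^3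
    + 4116 * x₁^3 * x₂^3 * x₃^2 + 444 * x₁^3 * x₂^2 * x₄^2 - (27/7) * x₁^3 * x₂ * x₅^2
    + (54/49) * x₁^3 * x₆^2 + 5082 * x₁^3 * x₂^4 * x₄ + 264 * x₁^3 * x₂ * x₃^2 * x₄
    + 156 * x₁^3 * x₂^2 * x₃ * x₅ - (276/7) * x₁^3 * x₃ * x₄ * x₅ + 420 * x₁^3 * x₂^3 * x₆
    + 48 * x₁^3 * x₃^2 * x₆ + 24 * x₁^3 * x₂ * x₄ * x₆ + 1988 * x₁^2 * x₂^2 * x₃^3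
    - 150 * x₁^2 * x₂ * x₃ * x₄^2 + (25/7) * x₁^2 * x₃ * x₅^2 + 24402 * x₁^2 * x₂^5 * x₃
    - 544 * x₁^2 * x₃^3 * x₄ + 2436 * x₁^2 * x₂^3 * x₃ * x₄ + 357 * x₁^2 * x₂^4 * x₅
    - 156 * x₁^2 * x₂ * x₃^2 * x₅ - (3/7) * x₁^2 * x₄^2 * x₅ + 48 * x₁^2 * x₂^2 * x₄ * x₅
    + 84 * x₁^2 * x₂^2 * x₃ * x₆ + (156/7) * x₁^2 * x₃ * x₄ * x₆ - (6/7) * x₁^2 * x₂ * x₅ * x₆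
    + 5439 * x₁ * x₂^7 - 812 * x₁ * x₂ * x₃^4 - 6 * x₁ * x₂ * x₄^3

/-- Part of the potential of type `E₇`. -/
noncomputable def partE7c (x₁ x₂ x₃ x₄ x₅ x₆ : ℂ) : ℂ :=
    6468 * x₁ * x₂^4 * x₃^2 + 147 * x₁ * x₂^3 * x₄^2 + 54 * x₁ * x₃^2 * x₄^2
    + (5/2) * x₁ * x₂^2 * x₅^2 - (5/14) * x₁ * x₄ * x₅^2 + (9/7) * x₁ * x₂ * x₆^2
    + 1764 * x₁ * x₂^5 * x₄ + 42 * x₁ * x₂^2 * x₃^2 * x₄ + (160/3) * x₁ * x₃^3 * x₅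
    + 140 * x₁ * x₂^3 * x₃ * x₅ + 20 * x₁ * x₂ * x₃ * x₄ * x₅ + 294 * x₁ * x₂^4 * x₆
    - 12 * x₁ * x₂ * x₃^2 * x₆ + (9/7) * x₁ * x₄^2 * x₆ + 36 * x₁ * x₂^2 * x₄ * x₆
    - (10/7) * x₁ * x₃ * x₅ * x₆ + (1484/15) * x₃^5 + (1666/3) * x₂^3 * x₃^3 + x₃ * x₄^3
    + (1/84) * x₅^3 + 7 * x₂^2 * x₃ * x₄^2 - (1/2) * x₂ * x₃ * x₅^2 + (1/7) * x₃ * x₆^2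
    + 1029 * x₂^6 * x₃ + (364/3) * x₂ * x₃^3 * x₄ + 392 * x₂^4 * x₃ * x₄ + (49/5) * x₂^5 * x₅
    + 21 * x₂^2 * x₃^2 * x₅ - (1/2) * x₂ * x₄^2 * x₅ + 7 * x₂^3 * x₄ * x₅ - 6 * x₃^2 * x₄ * x₅
    - (20/3) * x₃^3 * x₆ + 84 * x₂^3 * x₃ * x₆ + 8 * x₂ * x₃ * x₄ * x₆ + 2 * x₂^2 * x₅ * x₆
    + (1/7) * x₄ * x₅ * x₆

/-- The potential of type `E₇`, as an expression in the flat coordinates and `z`. -/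
noncomputable def potentialE7 (x₁ x₂ x₃ x₄ x₅ x₆ x₇ z : ℂ) : ℂ :=
    (1/2) * x₁ * x₇^2 + (1/2) * x₄^2 * x₇ + x₃ * x₅ * x₇ + x₂ * x₆ * x₇
    + partE7a x₁ x₂ x₃ x₄ x₅ x₆
    + partE7b x₁ x₂ x₃ x₄ x₅ x₆
    + partE7c x₁ x₂ x₃ x₄ x₅ x₆
    + (8/105) * z^5

/-- The polynomial `v` of the defining equation of `z` for type `E₈`. -/
noncomputable def vE8 (x₁ x₂ x₃ x₄ x₅ x₆ : ℂ) : ℂ :=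
    -x₁^10 + 5 * x₁^7 * x₂ + (1/2) * x₁^6 * x₃ - 78 * x₁^4 * x₂^2 + 2 * x₁^4 * x₄
    + 20 * x₁^3 * x₂ * x₃ - x₁^3 * x₅ - (3/2) * x₁^2 * x₃^2 + 88 * x₁ * x₂^3 - 24 * x₁ * x₂ * x₄
    + 2 * x₁ * x₆ - 12 * x₂^2 * x₃ + 2 * x₂ * x₅ + 2 * x₃ * x₄

/-- Part of the potential of type `E₈`. -/
noncomputable def partE8a (x₁ x₂ x₃ x₄ x₅ x₆ x₇ : ℂ) : ℂ :=
    (472561/883200) * x₁^25 + (5/6) * x₁^22 * x₂ + (1/12) * x₁^21 * x₃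
    + (14781/304) * x₁^19 * x₂^2 + (1/3) * x₁^19 * x₄ + (65/24) * x₁^18 * x₂ * x₃
    - (1/6) * x₁^18 * x₅ + (6255/1088) * x₁^17 * x₃^2 - (1225/6) * x₁^16 * x₂^3
    - (13/2) * x₁^16 * x₂ * x₄ + (1/3) * x₁^16 * x₆ + (415/8) * x₁^15 * x₂^2 * x₃
    + (1/12) * x₁^15 * x₃ * x₄ + (19/12) * x₁^15 * x₂ * x₅ - (1/6) * x₁^15 * x₇
    + (269/8) * x₁^14 * x₂ * x₃^2 + (1/8) * x₁^14 * x₃ * x₅ + (14879/12) * x₁^13 * x₂^4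
    + (565/96) * x₁^13 * x₃^3 + (2135/104) * x₁^13 * x₄^2 - 19 * x₁^13 * x₂^2 * x₄
    - (5/2) * x₁^13 * x₂ * x₆ - (766/3) * x₁^12 * x₂^3 * x₃ + (329/4) * x₁^12 * x₂ * x₃ * x₄
    + 22 * x₁^12 * x₂^2 * x₅ + (1/2) * x₁^12 * x₄ * x₅ - (1/4) * x₁^12 * x₃ * x₆
    + (5/4) * x₁^12 * x₂ * x₇ + 150 * x₁^11 * x₂^2 * x₃^2 + (199/352) * x₁^11 * x₅^2
    + (373/16) * x₁^11 * x₃^2 * x₄ - (43/4) * x₁^11 * x₂ * x₃ * x₅ + (1/8) * x₁^11 * x₃ * x₇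
    - (21216/5) * x₁^10 * x₂^5 + (1583/48) * x₁^10 * x₂ * x₃^3

/-- Part of the potential of type `E₈`. -/
noncomputable def partE8b (x₁ x₂ x₃ x₄ x₅ x₆ x₇ : ℂ) : ℂ :=
    -(95/2) * x₁^10 * x₂ * x₄^2 + (1727/3) * x₁^10 * x₂^3 * x₄ + (109/32) * x₁^10 * x₃^2 * x₅
    - 49 * x₁^10 * x₂^2 * x₆ - x₁^10 * x₄ * x₆ + (1559/192) * x₁^9 * x₃^4
    + (59/2) * x₁^9 * x₃ * x₄^2 + (10795/6) * x₁^9 * x₂^4 * x₃ - (239/2) * x₁^9 * x₂^2 * x₃ * x₄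
    - (743/6) * x₁^9 * x₂^3 * x₅ + (105/2) * x₁^9 * x₂ * x₄ * x₅ + 21 * x₁^9 * x₂ * x₃ * x₆
    + (1/2) * x₁^9 * x₅ * x₆ + (49/2) * x₁^9 * x₂^2 * x₇ + (1/2) * x₁^9 * x₄ * x₇
    - 233 * x₁^8 * x₂^3 * x₃^2 - (7/8) * x₁^8 * x₂ * x₅^2 + (429/4) * x₁^8 * x₂ * x₃^2 * x₄
    + (207/4) * x₁^8 * x₂^2 * x₃ * x₅ + (21/2) * x₁^8 * x₃ * x₄ * x₅ - (7/4) * x₁^8 * x₃^2 * x₆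
    - (21/2) * x₁^8 * x₂ * x₃ * x₇ - (1/4) * x₁^8 * x₅ * x₇ + (32150/3) * x₁^7 * x₂^6
    + (189/2) * x₁^7 * x₂^2 * x₃^3 + (163/6) * x₁^7 * x₄^3 + 442 * x₁^7 * x₂^2 * x₄^2
    + (7/8) * x₁^7 * x₃ * x₅^2 + (67/28) * x₁^7 * x₆^2 - 2491 * x₁^7 * x₂^4 * x₄
    + (637/24) * x₁^7 * x₃^3 * x₄ + (103/8) * x₁^7 * x₂ * x₃^2 * x₅ + (584/3) * x₁^7 * x₂^3 * x₆
    - 26 * x₁^7 * x₂ * x₄ * x₆ + (7/8) * x₁^7 * x₃^2 * x₇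

/-- Part of the potential of type `E₈`. -/
noncomputable def partE8c (x₁ x₂ x₃ x₄ x₅ x₆ x₇ : ℂ) : ℂ :=
    (475/24) * x₁^6 * x₂ * x₃^4 + (307/2) * x₁^6 * x₂ * x₃ * x₄^2 - 5607 * x₁^6 * x₂^5 * x₃
    + (3446/3) * x₁^6 * x₂^3 * x₃ * x₄ + (2659/6) * x₁^6 * x₂^4 * x₅
    + (131/48) * x₁^6 * x₃^3 * x₅ - (1/4) * x₁^6 * x₄^2 * x₅ - 96 * x₁^6 * x₂^2 * x₄ * x₅
    - 48 * x₁^6 * x₂^2 * x₃ * x₆ + (39/2) * x₁^6 * x₃ * x₄ * x₆ + (9/2) * x₁^6 * x₂ * x₅ * x₆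
    - (292/3) * x₁^6 * x₂^3 * x₇ + 13 * x₁^6 * x₂ * x₄ * x₇ + (1/2) * x₁^6 * x₆ * x₇
    + (419/160) * x₁^5 * x₃^5 + (2737/2) * x₁^5 * x₂^4 * x₃^2 + (195/4) * x₁^5 * x₃^2 * x₄^2
    + (51/4) * x₁^5 * x₂^2 * x₅^2 + (19/8) * x₁^5 * x₄ * x₅^2 + (17/80) * x₁^5 * x₇^2
    + 9 * x₁^5 * x₂^2 * x₃^2 * x₄ - 147 * x₁^5 * x₂^3 * x₃ * x₅ + 33 * x₁^5 * x₂ * x₃ * x₄ * x₅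
    + (9/2) * x₁^5 * x₂ * x₃^2 * x₆ + (13/4) * x₁^5 * x₃ * x₅ * x₆ + 24 * x₁^5 * x₂^2 * x₃ * x₇
    - 3 * x₁^5 * x₃ * x₄ * x₇ - (26144/3) * x₁^4 * x₂^7 - (400/3) * x₁^4 * x₂^3 * x₃^3
    - (64/3) * x₁^4 * x₂ * x₄^3 - (1/48) * x₁^4 * x₅^3 - 640 * x₁^4 * x₂^3 * x₄^2
    + (13/8) * x₁^4 * x₂ * x₃ * x₅^2 + 8 * x₁^4 * x₂ * x₆^2 + 4956 * x₁^4 * x₂^5 * x₄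

/-- Part of the potential of type `E₈`. -/
noncomputable def partE8d (x₁ x₂ x₃ x₄ x₅ x₆ x₇ : ℂ) : ℂ :=
    65 * x₁^4 * x₂ * x₃^3 * x₄ + 30 * x₁^4 * x₂^2 * x₃^2 * x₅ + (51/4) * x₁^4 * x₃^2 * x₄ * x₅
    - 470 * x₁^4 * x₂^4 * x₆ + (29/12) * x₁^4 * x₃^3 * x₆ + 14 * x₁^4 * x₄^2 * x₆
    + 122 * x₁^4 * x₂^2 * x₄ * x₆ + (5/8) * x₁^4 * x₃ * x₅ * x₇ + (185/8) * x₁^3 * x₂^2 * x₃^4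
    + (86/3) * x₁^3 * x₃ * x₄^3 + 190 * x₁^3 * x₂^2 * x₃ * x₄^2 + x₁^3 * x₃^2 * x₅^2
    + (7/2) * x₁^3 * x₃ * x₆^2 + (10672/3) * x₁^3 * x₂^6 * x₃ + (383/48) * x₁^3 * x₃^4 * x₄
    - 1900 * x₁^3 * x₂^4 * x₃ * x₄ - 452 * x₁^3 * x₂^5 * x₅ + (41/12) * x₁^3 * x₂ * x₃^3 * x₅
    + 34 * x₁^3 * x₂ * x₄^2 * x₅ + 198 * x₁^3 * x₂^3 * x₄ * x₅ + 162 * x₁^3 * x₂^3 * x₃ * x₆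
    + 18 * x₁^3 * x₂ * x₃ * x₄ * x₆ - 15 * x₁^3 * x₂^2 * x₅ * x₆ + 4 * x₁^3 * x₄ * x₅ * x₆
    + 220 * x₁^3 * x₂^4 * x₇ - (1/12) * x₁^3 * x₃^3 * x₇ + (13/2) * x₁^3 * x₄^2 * x₇
    - 43 * x₁^3 * x₂^2 * x₄ * x₇ + x₁^3 * x₂ * x₆ * x₇ + (25/16) * x₁^2 * x₂ * x₃^5
    - 492 * x₁^2 * x₂^5 * x₃^2 + 36 * x₁^2 * x₂ * x₃^2 * x₄^2 - 9 * x₁^2 * x₂^3 * x₅^2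
    - x₁^2 * x₂ * x₇^2 + 302 * x₁^2 * x₂^3 * x₃^2 * x₄

/-- Part of the potential of type `E₈`. -/
noncomputable def partE8e (x₁ x₂ x₃ x₄ x₅ x₆ x₇ : ℂ) : ℂ :=
    (25/32) * x₁^2 * x₃^4 * x₅ + (27/2) * x₁^2 * x₃ * x₄^2 * x₅ + 124 * x₁^2 * x₂^4 * x₃ * x₅
    - 3 * x₁^2 * x₂^2 * x₃ * x₄ * x₅ - 15 * x₁^2 * x₂^2 * x₃^2 * x₆ + (1/2) * x₁^2 * x₅^2 * x₆
    + (21/2) * x₁^2 * x₃^2 * x₄ * x₆ + 9 * x₁^2 * x₂ * x₃ * x₅ * x₆ - 69 * x₁^2 * x₂^3 * x₃ * x₇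
    + 9 * x₁^2 * x₂ * x₃ * x₄ * x₇ + (15/2) * x₁^2 * x₂^2 * x₅ * x₇
    - (1/2) * x₁^2 * x₄ * x₅ * x₇ + x₁^2 * x₃ * x₆ * x₇ + 1240 * x₁ * x₂^8 + (11/96) * x₁ * x₃^6
    + (35/3) * x₁ * x₄^4 + (76/3) * x₁ * x₂^4 * x₃^3 + 20 * x₁ * x₂^2 * x₄^3
    + (1/6) * x₁ * x₂ * x₅^3 + 360 * x₁ * x₂^4 * x₄^2 + 8 * x₁ * x₃^3 * x₄^2
    + (3/2) * x₁ * x₂^2 * x₃ * x₅^2 + x₁ * x₃ * x₄ * x₅^2 + 10 * x₁ * x₂^2 * x₆^2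
    + 5 * x₁ * x₄ * x₆^2 + (1/8) * x₁ * x₃ * x₇^2 - (3200/3) * x₁ * x₂^6 * x₄
    - 5 * x₁ * x₂^2 * x₃^3 * x₄ - 7 * x₁ * x₂^3 * x₃^2 * x₅ + (21/2) * x₁ * x₂ * x₃^2 * x₄ * x₅
    + 96 * x₁ * x₂^5 * x₆ + (5/2) * x₁ * x₂ * x₃^3 * x₆ + 20 * x₁ * x₂ * x₄^2 * x₆
    - 80 * x₁ * x₂^3 * x₄ * x₆ + (5/4) * x₁ * x₃^2 * x₅ * x₆

/-- Part of the potential of type `E₈`. -/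
noncomputable def partE8f (x₁ x₂ x₃ x₄ x₅ x₆ x₇ : ℂ) : ℂ :=
    (15/2) * x₁ * x₂^2 * x₃^2 * x₇ + (1/8) * x₁ * x₅^2 * x₇ + (3/4) * x₁ * x₃^2 * x₄ * x₇
    - (3/2) * x₁ * x₂ * x₃ * x₅ * x₇ + (1/3) * x₂^3 * x₃^4 + (44/3) * x₂ * x₃ * x₄^3
    + (1/24) * x₃ * x₅^3 - 44 * x₂^3 * x₃ * x₄^2 + (1/4) * x₂ * x₃^2 * x₅^2 + x₂ * x₃ * x₆^2
    + (1/2) * x₅ * x₆^2 - (704/3) * x₂^7 * x₃ + (7/4) * x₂ * x₃^4 * x₄ + 176 * x₂^5 * x₃ * x₄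
    + (160/3) * x₂^6 * x₅ + (1/2) * x₂^2 * x₃^3 * x₅ + (2/3) * x₄^3 * x₅ + 2 * x₂^2 * x₄^2 * x₅
    - 32 * x₂^4 * x₄ * x₅ + (3/4) * x₃^3 * x₄ * x₅ + (1/8) * x₃^4 * x₆ + 6 * x₃ * x₄^2 * x₆
    - 8 * x₂^4 * x₃ * x₆ + 12 * x₂^2 * x₃ * x₄ * x₆ + 4 * x₂^3 * x₅ * x₆ + 2 * x₂ * x₄ * x₅ * x₆
    - (168/5) * x₂^5 * x₇ - (1/4) * x₂ * x₃^3 * x₇ - 4 * x₂ * x₄^2 * x₇ + 24 * x₂^3 * x₄ * x₇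
    + (1/8) * x₃^2 * x₅ * x₇ - 4 * x₂^2 * x₆ * x₇ + x₄ * x₆ * x₇

/-- The potential of type `E₈`, as an expression in the flat coordinates and `z`. -/
noncomputable def potentialE8 (x₁ x₂ x₃ x₄ x₅ x₆ x₇ x₈ z : ℂ) : ℂ :=
    (1/2) * x₁ * x₈^2 + x₄ * x₅ * x₈ + x₃ * x₆ * x₈ + x₂ * x₇ * x₈
    + partE8a x₁ x₂ x₃ x₄ x₅ x₆ x₇
    + partE8b x₁ x₂ x₃ x₄ x₅ x₆ x₇
    + partE8c x₁ x₂ x₃ x₄ x₅ x₆ x₇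
    + partE8d x₁ x₂ x₃ x₄ x₅ x₆ x₇
    + partE8e x₁ x₂ x₃ x₄ x₅ x₆ x₇
    + partE8f x₁ x₂ x₃ x₄ x₅ x₆ x₇
    + (1/15) * z^5

end WDVV

set_option linter.unusedSectionVars false

/-! Polynomials with integer coefficients as lists of monomials, each monomial being a coefficient
together with the list of its exponents. -/

/-! In every case F = d⁻¹ (G + γ ζ^(r+5)) with integral polynomials G and q = ζ² in x, and with γ =
0 for the polynomial potential. Once the weights of G and q fit, Euler's identity yields the
homogeneity of F and turns T into a matrix of second derivatives multiplied by their weights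
(`IsModel.matT_eq`). What remains is the commutation of the matrices ∂C and the squarefreeness of
det T.

Commutation: let m be the index of x_{n-1}. The substitution x_i = 2^(lam i) y_i for i ≠ m, x_m = s
y_m² + v(y), ζ = t y_m makes the third derivatives, multiplied by 8dζ, polynomials in ℤ[y], so it
suffices that certain matrices over ℤ[y] commute. The one with index m has a cyclic vector, which is
visible at one integer point modulo p, and over a domain matrices that commute with such a matrix
commute with each other (`Matrix.commute_of_commute_cyclic`). This leaves n - 1 commutators. Their
entries are weighted homogeneous, so one variable may be set to 1; in the others a Kronecker
substitution is used: an integral polynomial whose coefficients are small compared with N is zero if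
it vanishes when one variable is set to N. Iterating, one evaluation at a point with powers of two
as coordinates decides (`Data.comm_eq_zero`). The required bounds are obtained by evaluating the
same expressions with absolute values of all coefficients.

Determinant: x_n enters T only as the summand x_n on the diagonal. Hence det T is, up to scaling, a
characteristic polynomial with x_n as the indeterminate, and being monic it is squarefree as soon as
one specialization of the other variables is (`Polynomial.squarefree_of_monic_of_map`). At an
integer point the characteristic polynomial is read off from a linear relation between the vectors v
Nᵏ, and a Bézout identity with the derivative shows that it is squarefree.

For B₄ the flat coordinates are triangular in the power sums of the y_i². Their gradients are a
triangular matrix times the odd powers y_k^(2l+1), whose Gram matrix is the Hankel matrix of power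
sums; Newton's relations identify the result with T, and a Vandermonde determinant gives the
discriminant. -/

/-- A polynomial with integer coefficients, as a list of monomials. -/
abbrev MonoList := List (ℤ × List ℕ)

namespace MonoList

variable {R S : Type*} [CommRing R] [CommRing S]

/-- The monomial with a given list of exponents at the point `t`. -/
def mono (t : ℕ → R) : List ℕ → R
  | [] => 1
  | a :: e => t 0 ^ a * mono (fun i => t (i + 1)) e

/-- The value of a polynomial at the point `t`. -/
def eval (t : ℕ → R) : MonoList → R
  | [] => 0
  | (c, e) :: l => (c : R) * mono t e + eval t l

/-- The exponent of the variable `i`. -/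
def expo : ℕ → List ℕ → ℕ
  | _, [] => 0
  | 0, a :: _ => a
  | i + 1, _ :: e => expo i e

/-- Lower the exponent of the variable `i` by one. -/
def lower : ℕ → List ℕ → List ℕ
  | _, [] => []
  | 0, a :: e => (a - 1) :: e
  | i + 1, a :: e => a :: lower i e

/-- The partial derivative with respect to the variable `i`. -/
def deriv (i : ℕ) : MonoList → MonoList
  | [] => []
  | (c, e) :: l => bif (expo i e).beq 0 then deriv i l else (c * expo i e, lower i e) :: deriv i l

/-- The weight of a monomial. -/
def dot : List ℕ → List ℕ → ℕ
  | [], _ => 0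
  | _ :: _, [] => 0
  | w :: ws, a :: e => w * a + dot ws e

/-- All monomials have weight `W` and exponents for at most as many variables as `w` has entries. -/
def homog (w : List ℕ) (W : ℕ) (l : MonoList) : Bool :=
  l.all fun p => (dot w p.2).beq W && p.2.length.ble w.length

/-- The polynomial with the absolute values of the coefficients. -/
def abs (l : MonoList) : MonoList := l.map fun p => ((p.1.natAbs : ℤ), p.2)

theorem deriv_cons_of_eq_zero {i : ℕ} {e : List ℕ} (h : expo i e = 0) (c : ℤ) (l : MonoList) :
    deriv i ((c, e) :: l) = deriv i l := by
  simp [deriv, h]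

theorem deriv_cons_of_ne_zero {i : ℕ} {e : List ℕ} (h : expo i e ≠ 0) (c : ℤ) (l : MonoList) :
    deriv i ((c, e) :: l) = (c * expo i e, lower i e) :: deriv i l := by
  obtain ⟨a, ha⟩ := Nat.exists_eq_succ_of_ne_zero h
  rw [deriv, ha]
  rfl

theorem map_mono (f : R →+* S) (e : List ℕ) (t : ℕ → R) :
    f (mono t e) = mono (fun i => f (t i)) e := by
  induction e generalizing t with
  | nil => simp [mono]
  | cons a e ih => simp [mono, ih]

theorem map_eval (f : R →+* S) (l : MonoList) (t : ℕ → R) :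
    f (eval t l) = eval (fun i => f (t i)) l := by
  induction l with
  | nil => simp [eval]
  | cons p l ih => simp [eval, ih, map_mono]

theorem eval_append (t : ℕ → R) (l l' : MonoList) : eval t (l ++ l') = eval t l + eval t l' := by
  induction l with
  | nil => simp [eval]
  | cons p l ih => simp [eval, ih, add_assoc]

theorem mono_congr {t t' : ℕ → R} (e : List ℕ) (h : ∀ i < e.length, t i = t' i) :
    mono t e = mono t' e := by
  induction e generalizing t t' with
  | nil => rfl
  | cons a e ih =>
    rw [mono, mono, h 0 (by simp), ih]
    intro i hi
    exact h (i + 1) (by simpa using hi)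

theorem eval_congr {t t' : ℕ → R} {w : List ℕ} {W : ℕ} {l : MonoList} (hl : homog w W l = true)
    (h : ∀ i < w.length, t i = t' i) : eval t l = eval t' l := by
  induction l with
  | nil => rfl
  | cons p l ih =>
    simp only [homog, List.all_cons, Bool.and_eq_true, Nat.beq_eq, Nat.ble_eq] at hl
    rw [eval, eval, ih (by simpa [homog] using hl.2),
      mono_congr p.2 fun i hi => h i (lt_of_lt_of_le hi hl.1.2)]

theorem mono_congr_of_expo_eq_zero {t t' : ℕ → R} {m : ℕ} (e : List ℕ) (he : expo m e = 0)
    (h : ∀ i ≠ m, t i = t' i) : mono t e = mono t' e := by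
  induction e generalizing t t' m with
  | nil => rfl
  | cons a e ih =>
    cases m with
    | zero =>
      rw [mono, mono, mono_congr e fun i _ => h (i + 1) (by omega)]
      simp only [expo] at he
      simp [he]
    | succ m =>
      rw [mono, mono, h 0 (by omega), ih (by simpa [expo] using he) fun i hi => h (i + 1) (by omega)]

/-- A polynomial with vanishing derivative with respect to a variable does not depend on it. -/
theorem eval_congr_of_deriv_eq_nil {t t' : ℕ → R} {m : ℕ} {l : MonoList} (hl : deriv m l = [])
    (h : ∀ i ≠ m, t i = t' i) : eval t l = eval t' l := by
  induction l with
  | nil => rfl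
  | cons p l ih =>
    obtain ⟨c, e⟩ := p
    by_cases he : expo m e = 0
    · rw [deriv_cons_of_eq_zero he] at hl
      rw [eval, eval, mono_congr_of_expo_eq_zero e he h, ih hl]
    · rw [deriv_cons_of_ne_zero he] at hl
      exact absurd hl (by simp)

theorem homog_abs (w : List ℕ) (W : ℕ) (l : MonoList) : homog w W (abs l) = homog w W l := by
  simp [homog, abs, List.all_map, Function.comp_def]

theorem length_lower (i : ℕ) (e : List ℕ) : (lower i e).length = e.length := by
  induction e generalizing i with
  | nil => cases i <;> rfl
  | cons a e ih => cases i <;> simp [lower, ih]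

/-- The factor `t i` restores the lowered exponent. An exponent 0, which `lower` leaves at 0 by
truncated subtraction, is harmless because both sides then vanish. -/
theorem mul_mono_lower (t : ℕ → R) (i : ℕ) (e : List ℕ) :
    t i * ((expo i e : R) * mono t (lower i e)) = expo i e * mono t e := by
  induction e generalizing i t with
  | nil => cases i <;> simp [expo]
  | cons a e ih =>
    cases i with
    | zero =>
      cases a with
      | zero => simp [expo]
      | succ a => simp only [expo, lower, mono, Nat.add_sub_cancel]; ring
    | succ i =>
      have := ih (fun j => t (j + 1)) i
      simp only [expo, lower, mono]
      linear_combination t 0 ^ a * this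

theorem dot_lower (w : List ℕ) (i : ℕ) (e : List ℕ) (h : expo i e ≠ 0) (hl : e.length ≤ w.length) :
    dot w (lower i e) + w.getD i 0 = dot w e := by
  induction e generalizing i w with
  | nil => cases i <;> simp [expo] at h
  | cons a e ih =>
    cases w with
    | nil => simp at hl
    | cons b w =>
      cases i with
      | zero =>
        simp only [expo] at h
        simp only [lower, dot, List.getD_cons_zero]
        obtain ⟨a, rfl⟩ := Nat.exists_eq_succ_of_ne_zero h
        simp only [Nat.succ_eq_add_one, Nat.add_sub_cancel]; ring
      | succ i =>
        have := ih w i (by simpa [expo] using h) (by simpa using hl)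
        simp only [lower, dot, List.getD_cons_succ]
        omega

theorem homog_deriv {w : List ℕ} {W : ℕ} {l : MonoList} (h : homog w W l = true) (i : ℕ) :
    homog w (W - w.getD i 0) (deriv i l) = true := by
  induction l with
  | nil => rfl
  | cons p l ih =>
    obtain ⟨c, e⟩ := p
    simp only [homog, List.all_cons, Bool.and_eq_true, Nat.beq_eq, Nat.ble_eq] at h
    have h2 := ih (by simpa [homog] using h.2)
    by_cases he : expo i e = 0
    · simpa [deriv, he] using h2
    · rw [deriv_cons_of_ne_zero he]
      simp only [homog, List.all_cons, Bool.and_eq_true, Nat.beq_eq, Nat.ble_eq, length_lower]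
      refine ⟨⟨?_, h.1.2⟩, by simpa [homog] using h2⟩
      have := dot_lower w i e he h.1.2
      omega

/-- A monomial that contains the variable i weighs at least w_i. So the truncated difference in
`homog_deriv` is a true one unless the derivative is the empty list. -/
theorem deriv_eq_nil_or_le {w : List ℕ} {W : ℕ} {l : MonoList} (h : homog w W l = true) (i : ℕ) :
    deriv i l = [] ∨ w.getD i 0 ≤ W := by
  induction l with
  | nil => exact Or.inl rfl
  | cons p l ih =>
    obtain ⟨c, e⟩ := p
    simp only [homog, List.all_cons, Bool.and_eq_true, Nat.beq_eq, Nat.ble_eq] at h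
    by_cases he : expo i e = 0
    · simpa [deriv, he] using ih (by simpa [homog] using h.2)
    · have := dot_lower w i e he h.1.2
      right; omega

/-! ### Derivatives of G + γ τ^(r+5), cleared of denominators -/

/-- The third derivative of `G + γ τ ^ (r + 5)`, where `τ ^ 2 = q`, multiplied by `8 τ`. -/
def third (G q : MonoList) (γ : ℤ) (r : ℕ) (t : ℕ → R) (τ : R) (a b c : ℕ) : R :=
  8 * τ * eval t (deriv a (deriv b (deriv c G)))
    + γ * ((r + 5) * (r + 3) * (r + 1) * τ ^ r
          * (eval t (deriv a q) * eval t (deriv b q) * eval t (deriv c q))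
        + 2 * ((r + 5) * (r + 3)) * τ ^ (r + 2)
          * (eval t (deriv a (deriv b q)) * eval t (deriv c q)
            + eval t (deriv a (deriv c q)) * eval t (deriv b q)
            + eval t (deriv b (deriv c q)) * eval t (deriv a q))
        + 4 * (r + 5) * τ ^ (r + 4) * eval t (deriv a (deriv b (deriv c q))))

/-- The second derivative of `G + γ τ ^ (r + 5)`, where `τ ^ 2 = q`, multiplied by `4`. -/
def second (G q : MonoList) (γ : ℤ) (r : ℕ) (t : ℕ → R) (τ : R) (b c : ℕ) : R :=
  4 * eval t (deriv b (deriv c G))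
    + γ * ((r + 5) * (r + 3) * τ ^ (r + 1) * (eval t (deriv b q) * eval t (deriv c q))
        + 2 * (r + 5) * τ ^ (r + 3) * eval t (deriv b (deriv c q)))

theorem map_third (f : R →+* S) (G q : MonoList) (γ : ℤ) (r : ℕ) (t : ℕ → R) (τ : R)
    (a b c : ℕ) :
    f (third G q γ r t τ a b c) = third G q γ r (fun i => f (t i)) (f τ) a b c := by
  simp [third, map_eval, map_ofNat]

theorem map_second (f : R →+* S) (G q : MonoList) (γ : ℤ) (r : ℕ) (t : ℕ → R) (τ : R)
    (b c : ℕ) :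
    f (second G q γ r t τ b c) = second G q γ r (fun i => f (t i)) (f τ) b c := by
  simp [second, map_eval, map_ofNat]

theorem sum_expo (w e : List ℕ) (h : e.length ≤ w.length) :
    ∑ k ∈ Finset.range w.length, w.getD k 0 * expo k e = dot w e := by
  induction w generalizing e with
  | nil => simp [dot]
  | cons b w ih =>
    cases e with
    | nil => simp [dot, expo]
    | cons a e =>
      rw [List.length_cons, Finset.sum_range_succ', dot, ← ih e (by simpa using h)]
      simp [expo, add_comm]

/-- Euler's identity. -/
theorem sum_mul_eval_deriv {w : List ℕ} {W : ℕ} {l : MonoList} (h : homog w W l = true)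
    (t : ℕ → R) :
    ∑ k ∈ Finset.range w.length, (w.getD k 0 : R) * t k * eval t (deriv k l) = W * eval t l := by
  induction l with
  | nil => simp [deriv, eval]
  | cons p l ih =>
    obtain ⟨c, e⟩ := p
    simp only [homog, List.all_cons, Bool.and_eq_true, Nat.beq_eq, Nat.ble_eq] at h
    have key : ∀ k, eval t (deriv k ((c, e) :: l))
        = c * (expo k e * mono t (lower k e)) + eval t (deriv k l) := by
      intro k
      by_cases he : expo k e = 0
      · simp [deriv, he]
      · rw [deriv_cons_of_ne_zero he, eval]
        push_cast; ring
    have h1 : ∀ k, (w.getD k 0 : R) * t k * eval t (deriv k ((c, e) :: l))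
        = c * mono t e * ((w.getD k 0 * expo k e : ℕ) : R)
          + (w.getD k 0 : R) * t k * eval t (deriv k l) := by
      intro k
      rw [key]
      push_cast
      linear_combination (w.getD k 0 : R) * c * mul_mono_lower t k e
    simp only [h1, Finset.sum_add_distrib, ih (by simpa [homog] using h.2), ← Finset.mul_sum,
      ← Nat.cast_sum, sum_expo w e h.1.2, h.1.1, eval]
    ring

theorem expo_lower (i j : ℕ) (e : List ℕ) (h : i ≠ j) : expo i (lower j e) = expo i e := by
  induction e generalizing i j with
  | nil => cases j <;> rfl
  | cons a e ih =>
    cases i <;> cases j <;> simp_all [expo, lower]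

theorem lower_comm (i j : ℕ) (e : List ℕ) : lower i (lower j e) = lower j (lower i e) := by
  induction e generalizing i j with
  | nil => cases i <;> cases j <;> rfl
  | cons a e ih => cases i <;> cases j <;> simp_all [lower]

/-- This is an equality of lists and not merely of values: both orders keep the same monomials in
the same order. -/
theorem deriv_comm (i j : ℕ) (l : MonoList) : deriv i (deriv j l) = deriv j (deriv i l) := by
  by_cases hij : i = j
  · rw [hij]
  induction l with
  | nil => rfl
  | cons p l ih =>
    obtain ⟨c, e⟩ := p
    have h1 := expo_lower i j e hij
    have h2 := expo_lower j i e (Ne.symm hij)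
    by_cases hi : expo i e = 0 <;> by_cases hj : expo j e = 0 <;>
      simp [deriv_cons_of_eq_zero, deriv_cons_of_ne_zero, hi, hj, h1, h2, ih, lower_comm i j,
        mul_right_comm]

theorem third_comm_right (G q : MonoList) (γ : ℤ) (r : ℕ) (t : ℕ → R) (τ : R) (a b c : ℕ) :
    third G q γ r t τ a b c = third G q γ r t τ a c b := by
  simp only [third, deriv_comm b c]; ring

theorem sum_mul_eval_deriv_deriv {w : List ℕ} {W : ℕ} {l : MonoList} (h : homog w W l = true)
    (t : ℕ → R) (i : ℕ) :
    ∑ k ∈ Finset.range w.length, (w.getD k 0 : R) * t k * eval t (deriv k (deriv i l))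
      = (W - w.getD i 0) * eval t (deriv i l) := by
  rw [sum_mul_eval_deriv (homog_deriv h i)]
  rcases deriv_eq_nil_or_le h i with h' | h'
  · simp [h', eval]
  · rw [Nat.cast_sub h']

theorem sum_mul_eval_deriv_deriv_deriv {w : List ℕ} {W : ℕ} {l : MonoList}
    (h : homog w W l = true) (t : ℕ → R) (i j : ℕ) :
    ∑ k ∈ Finset.range w.length, (w.getD k 0 : R) * t k * eval t (deriv k (deriv i (deriv j l)))
      = (W - w.getD i 0 - w.getD j 0) * eval t (deriv i (deriv j l)) := by
  rw [sum_mul_eval_deriv_deriv (homog_deriv h j)]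
  rcases deriv_eq_nil_or_le h j with h' | h'
  · simp [h', deriv, eval]
  · rw [Nat.cast_sub h']; ring

/-- Euler's identity for the second derivatives. -/
theorem sum_mul_third {w : List ℕ} {W V : ℕ} {G q : MonoList} {γ : ℤ} {r : ℕ}
    (hG : homog w W G = true) (hq : homog w V q = true) (hγ : γ = 0 ∨ (r + 5) * V = 2 * W)
    (t : ℕ → R) (τ : R) (hτ : τ ^ 2 = eval t q) (i j : ℕ) :
    ∑ k ∈ Finset.range w.length, (w.getD k 0 : R) * t k * third G q γ r t τ k i j
      = 2 * τ * ((W - w.getD i 0 - w.getD j 0) * second G q γ r t τ i j) := by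
  have e : ∀ k, (w.getD k 0 : R) * t k * third G q γ r t τ k i j
      = 8 * τ * ((w.getD k 0 : R) * t k * eval t (deriv k (deriv i (deriv j G))))
        + γ * ((r + 5) * (r + 3) * (r + 1) * τ ^ r * (eval t (deriv i q) * eval t (deriv j q)))
          * ((w.getD k 0 : R) * t k * eval t (deriv k q))
        + γ * (2 * ((r + 5) * (r + 3)) * τ ^ (r + 2) * eval t (deriv j q))
          * ((w.getD k 0 : R) * t k * eval t (deriv k (deriv i q)))
        + γ * (2 * ((r + 5) * (r + 3)) * τ ^ (r + 2) * eval t (deriv i q))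
          * ((w.getD k 0 : R) * t k * eval t (deriv k (deriv j q)))
        + γ * (2 * ((r + 5) * (r + 3)) * τ ^ (r + 2) * eval t (deriv i (deriv j q)))
          * ((w.getD k 0 : R) * t k * eval t (deriv k q))
        + γ * (4 * (r + 5) * τ ^ (r + 4))
          * ((w.getD k 0 : R) * t k * eval t (deriv k (deriv i (deriv j q)))) := by
    intro k; rw [third]; ring
  simp only [e, Finset.sum_add_distrib, ← Finset.mul_sum, sum_mul_eval_deriv_deriv_deriv hG,
    sum_mul_eval_deriv_deriv_deriv hq, sum_mul_eval_deriv_deriv hq, sum_mul_eval_deriv hq, ← hτ]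
  -- τ has weight V / 2, so this says that γ τ^(r+5) has the weight W of G.
  have hγ' : (γ : R) * ((r + 5) * V - 2 * W) = 0 := by
    rcases hγ with h | h
    · simp [h]
    · have : ((r : R) + 5) * V = 2 * W := by exact_mod_cast congrArg (Nat.cast (R := R)) h
      rw [this]; ring
  rw [second]
  linear_combination (τ ^ (r + 2) * (eval t (deriv i q) * eval t (deriv j q)) * ((r + 5) * (r + 3))
    + 2 * (r + 5) * τ ^ (r + 4) * eval t (deriv i (deriv j q))) * hγ'

end MonoList

/-! ### Partial derivatives of G + γ ζ^(r+5) on a domain where ζ is a square root of q -/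

namespace WDVV

open MonoList

variable {n : ℕ}

/-- A point of `ℂⁿ` as a sequence. -/
def extend (x : Fin n → ℂ) (i : ℕ) : ℂ := if h : i < n then x ⟨i, h⟩ else 0

@[simp] theorem extend_coe (x : Fin n → ℂ) (i : Fin n) : extend x i = x i := by
  simp [extend]

/-- `f` is differentiable at `x` with partial derivative `a` with respect to `x_j`. -/
structure HasPd (j : Fin n) (f : (Fin n → ℂ) → ℂ) (a : ℂ) (x : Fin n → ℂ) : Prop where
  differentiable : DifferentiableAt ℂ f x
  eq : pd j f x = a

namespace HasPd

variable {j : Fin n} {f g : (Fin n → ℂ) → ℂ} {a b : ℂ} {x : Fin n → ℂ}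

theorem const (c : ℂ) : HasPd j (fun _ => c) 0 x := ⟨by fun_prop, by simp [pd]⟩

theorem add (hf : HasPd j f a x) (hg : HasPd j g b x) : HasPd j (fun y => f y + g y) (a + b) x :=
  ⟨hf.1.add hg.1, by rw [← hf.2, ← hg.2, pd, fderiv_fun_add hf.1 hg.1]; rfl⟩

theorem mul (hf : HasPd j f a x) (hg : HasPd j g b x) :
    HasPd j (fun y => f y * g y) (a * g x + f x * b) x :=
  ⟨hf.1.mul hg.1, by
    rw [← hf.2, ← hg.2, pd, fderiv_fun_mul hf.1 hg.1]
    simp [pd]; ring⟩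

theorem const_mul (c : ℂ) (hf : HasPd j f a x) : HasPd j (fun y => c * f y) (c * a) x := by
  simpa using (const c).mul hf

theorem pow (hf : HasPd j f a x) (k : ℕ) :
    HasPd j (fun y => f y ^ k) (k * f x ^ (k - 1) * a) x := by
  refine ⟨hf.1.pow k, ?_⟩
  rw [← hf.2, pd, fderiv_fun_pow k hf.1]
  simp [pd]

theorem congr (hf : HasPd j f a x) (h : g =ᶠ[nhds x] f) : HasPd j g a x :=
  ⟨hf.1.congr_of_eventuallyEq h, by rw [pd, h.fderiv_eq]; exact hf.2⟩

theorem congr_right (hf : HasPd j f a x) (h : a = b) : HasPd j f b x := h ▸ hf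

end HasPd

theorem hasPd_extend (j : Fin n) (i : ℕ) (x : Fin n → ℂ) :
    HasPd j (fun y => extend y i) (if i = j then 1 else 0) x := by
  unfold extend
  by_cases h : i < n
  · simp only [h, dite_true]
    refine ⟨by fun_prop, ?_⟩
    have : (fun y : Fin n → ℂ => y ⟨i, h⟩) = ContinuousLinearMap.proj (R := ℂ) (φ := fun _ => ℂ) ⟨i, h⟩ := rfl
    rw [pd, this, ContinuousLinearMap.fderiv]
    simp [Pi.single_apply, Fin.ext_iff]
  · simp only [h, dite_false]
    have : i ≠ j := by omega
    simpa [this] using HasPd.const (j := j) (x := x) 0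

theorem hasPd_mono_zero {j : Fin n} {x : Fin n → ℂ} (e : List ℕ) (t : ℕ → (Fin n → ℂ) → ℂ)
    (h : ∀ i, HasPd j (t i) 0 x) : HasPd j (fun y => mono (fun i => t i y) e) 0 x := by
  induction e generalizing t with
  | nil => exact HasPd.const 1
  | cons a e ih =>
    exact (((h 0).pow a).mul (ih (fun i => t (i + 1)) fun i => h (i + 1))).congr_right (by simp)

/-- The coordinates are replaced by arbitrary functions `t i` with the derivatives of coordinates,
because the induction over the exponents shifts the index. -/
theorem hasPd_mono {j : Fin n} {x : Fin n → ℂ} (e : List ℕ) (k : ℕ) (t : ℕ → (Fin n → ℂ) → ℂ)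
    (h : ∀ i, HasPd j (t i) (if i = k then 1 else 0) x) :
    HasPd j (fun y => mono (fun i => t i y) e)
      (expo k e * mono (fun i => t i x) (lower k e)) x := by
  induction e generalizing t k with
  | nil => exact (HasPd.const 1).congr_right (by cases k <;> simp [expo])
  | cons a e ih =>
    cases k with
    | zero =>
      refine (((h 0).pow a).mul (hasPd_mono_zero e (fun i => t (i + 1)) fun i => ?_)).congr_right ?_
      · simpa using h (i + 1)
      · simp [expo, lower, mono]; ring
    | succ k =>
      refine (((h 0).pow a).mul (ih k (fun i => t (i + 1)) fun i => ?_)).congr_right ?_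
      · simpa using h (i + 1)
      · simp [expo, lower, mono]; ring

theorem hasPd_eval (j : Fin n) (l : MonoList) (x : Fin n → ℂ) :
    HasPd j (fun y => eval (extend y) l) (eval (extend x) (deriv j l)) x := by
  induction l with
  | nil => exact HasPd.const 0
  | cons p l ih =>
    obtain ⟨c, e⟩ := p
    have h1 := ((hasPd_mono e j (fun i y => extend y i) fun i =>
      hasPd_extend j i x).const_mul (c : ℂ)).add ih
    refine h1.congr_right ?_
    by_cases he : expo j e = 0
    · simp [deriv_cons_of_eq_zero he, he]
    · rw [deriv_cons_of_ne_zero he, eval]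
      push_cast; ring

theorem analyticAt_mono {x : Fin n → ℂ} (e : List ℕ) (t : ℕ → (Fin n → ℂ) → ℂ)
    (h : ∀ i, AnalyticAt ℂ (t i) x) : AnalyticAt ℂ (fun y => mono (fun i => t i y) e) x := by
  induction e generalizing t with
  | nil => exact analyticAt_const
  | cons a e ih => exact ((h 0).pow a).mul (ih (fun i => t (i + 1)) fun i => h (i + 1))

theorem analyticAt_eval (l : MonoList) (x : Fin n → ℂ) :
    AnalyticAt ℂ (fun y => eval (extend y) l) x := by
  induction l with
  | nil => exact analyticAt_const
  | cons p l ih =>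
    refine (analyticAt_const.mul (analyticAt_mono p.2 (fun i y => extend y i) fun i => ?_)).add ih
    unfold extend
    by_cases h : i < n
    · simp only [h, dite_true]
      exact (ContinuousLinearMap.proj (R := ℂ) (φ := fun _ => ℂ) (⟨i, h⟩ : Fin n)).analyticAt x
    · simp only [h, dite_false]
      exact analyticAt_const

/-- A holomorphic square root `ζ` of the polynomial `q` on an open set `U`. -/
structure IsRoot (q : MonoList) (U : Set (Fin n → ℂ)) (ζ : (Fin n → ℂ) → ℂ) : Prop where
  isOpen : IsOpen U
  analytic : AnalyticOnNhd ℂ ζ U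
  ne_zero : ∀ x ∈ U, ζ x ≠ 0
  sq_eq : ∀ x ∈ U, ζ x ^ 2 = eval (extend x) q

variable {q : MonoList} {U : Set (Fin n → ℂ)} {ζ : (Fin n → ℂ) → ℂ} {x : Fin n → ℂ}

/-- Differentiate ζ² = q and divide by 2ζ. -/
theorem IsRoot.hasPd (h : IsRoot q U ζ) (hx : x ∈ U) (j : Fin n) :
    HasPd j ζ (eval (extend x) (deriv j q) / (2 * ζ x)) x := by
  have hd : HasPd j ζ (pd j ζ x) x := ⟨(h.analytic x hx).differentiableAt, rfl⟩
  refine hd.congr_right ?_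
  have h1 := ((hasPd_eval j q x).congr (g := fun y => ζ y ^ 2) (by
    filter_upwards [h.isOpen.mem_nhds hx] with y hy using h.sq_eq y hy)).2
  rw [(hd.pow 2).2] at h1
  have := h.ne_zero x hx
  rw [eq_div_iff (by simpa using this), ← h1]
  simp; ring

/-- An exponent of at least 2 absorbs the denominator ζ. `hasPd_pow_succ` keeps it, for the last
differentiation, where the exponent may be 1. -/
theorem IsRoot.hasPd_pow (h : IsRoot q U ζ) (hx : x ∈ U) (j : Fin n) (k : ℕ) :
    HasPd j (fun y => ζ y ^ (k + 2)) ((k + 2) / 2 * ζ x ^ k * eval (extend x) (deriv j q)) x := by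
  refine ((h.hasPd hx j).pow (k + 2)).congr_right ?_
  have := h.ne_zero x hx
  rw [show k + 2 - 1 = k + 1 from rfl, pow_succ]
  push_cast
  field_simp

theorem IsRoot.hasPd_pow_succ (h : IsRoot q U ζ) (hx : x ∈ U) (j : Fin n) (k : ℕ) :
    HasPd j (fun y => ζ y ^ (k + 1))
      ((k + 1) / (2 * ζ x) * ζ x ^ k * eval (extend x) (deriv j q)) x := by
  refine ((h.hasPd hx j).pow (k + 1)).congr_right ?_
  have := h.ne_zero x hx
  rw [Nat.add_sub_cancel]
  push_cast
  field_simp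

variable {G : MonoList} {γ : ℤ} {r : ℕ} {d : ℂ} {F : (Fin n → ℂ) → ℂ}

theorem IsRoot.hasPd_one (h : IsRoot q U ζ)
    (hF : ∀ x ∈ U, F x = d⁻¹ * (eval (extend x) G + γ * ζ x ^ (r + 5))) (hx : x ∈ U) (j : Fin n) :
    HasPd j F (d⁻¹ * (eval (extend x) (deriv j G)
      + γ * ((r + 5) / 2 * (ζ x ^ (r + 3) * eval (extend x) (deriv j q))))) x := by
  refine ((((hasPd_eval j G x).add ((h.hasPd_pow hx j (r + 3)).const_mul (γ : ℂ))).const_mul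
    d⁻¹).congr ?_).congr_right ?_
  · filter_upwards [h.isOpen.mem_nhds hx] with y hy using hF y hy
  · push_cast; ring

theorem IsRoot.hasPd_two (h : IsRoot q U ζ)
    (hF : ∀ x ∈ U, F x = d⁻¹ * (eval (extend x) G + γ * ζ x ^ (r + 5))) (hx : x ∈ U)
    (i j : Fin n) :
    HasPd i (fun y => pd j F y) ((4 * d)⁻¹ * second G q γ r (extend x) (ζ x) i j) x := by
  refine ((((hasPd_eval i (deriv j G) x).add ((((h.hasPd_pow hx i (r + 1)).mul
    (hasPd_eval i (deriv j q) x)).const_mul (((r : ℂ) + 5) / 2)).const_mul (γ : ℂ))).const_mul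
    d⁻¹).congr ?_).congr_right ?_
  · filter_upwards [h.isOpen.mem_nhds hx] with y hy using (h.hasPd_one hF hy j).2
  · rw [second, mul_inv]
    push_cast; ring

/-- Each differentiation lowers the exponent of ζ by two, from r + 5 to r - 1, which can be
negative. The factor 8ζ in `third` removes this denominator together with the powers of 2. -/
theorem IsRoot.hasPd_three (h : IsRoot q U ζ)
    (hF : ∀ x ∈ U, F x = d⁻¹ * (eval (extend x) G + γ * ζ x ^ (r + 5))) (hx : x ∈ U)
    (k i j : Fin n) :
    HasPd k (fun y => pd i (fun y' => pd j F y') y)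
      ((8 * d * ζ x)⁻¹ * third G q γ r (extend x) (ζ x) k i j) x := by
  have A := (hasPd_eval k (deriv i (deriv j G)) x).const_mul 4
  have B := ((h.hasPd_pow_succ hx k r).mul ((hasPd_eval k (deriv i q) x).mul
    (hasPd_eval k (deriv j q) x))).const_mul (((r : ℂ) + 5) * (r + 3))
  have C := ((h.hasPd_pow hx k (r + 1)).mul
    (hasPd_eval k (deriv i (deriv j q)) x)).const_mul (2 * ((r : ℂ) + 5))
  refine (((A.add ((B.add C).const_mul (γ : ℂ))).const_mul (4 * d)⁻¹).congr ?_).congr_right ?_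
  · filter_upwards [h.isOpen.mem_nhds hx] with y hy
    rw [(h.hasPd_two hF hy i j).2, second]
    ring
  · have := h.ne_zero x hx
    rw [third, mul_inv, mul_inv, mul_inv]
    push_cast
    field_simp
    ring

theorem IsRoot.analyticOnNhd (h : IsRoot q U ζ)
    (hF : ∀ x ∈ U, F x = d⁻¹ * (eval (extend x) G + γ * ζ x ^ (r + 5))) : AnalyticOnNhd ℂ F U := by
  intro x hx
  have A : AnalyticAt ℂ (fun y => d⁻¹ * (eval (extend y) G + γ * ζ y ^ (r + 5))) x :=
    analyticAt_const.mul ((analyticAt_eval G x).add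
      (analyticAt_const.mul ((h.analytic x hx).pow (r + 5))))
  refine A.congr ?_
  filter_upwards [h.isOpen.mem_nhds hx] with y hy using (hF y hy).symm

variable {m : ℕ} {w : Fin (m + 2) → ℚ} {wt : List ℕ} {den W V : ℕ}

theorem euler_eq {f : (Fin (m + 2) → ℂ) → ℂ} {x : Fin (m + 2) → ℂ} {φ : ℕ → ℂ}
    (hlast : w (idxLast m) = 1)
    (hw : ∀ i, w i = wt.getD i 0 / den) (hlen : wt.length = m + 2)
    (hφ : ∀ j, pd j f x = φ j) :
    euler w f x
      = (den : ℂ)⁻¹ * ∑ k ∈ Finset.range wt.length, (wt.getD k 0 : ℂ) * extend x k * φ k := by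
  rw [euler, hlast, hlen, Finset.sum_range, Finset.mul_sum, Finset.mul_sum]
  refine Finset.sum_congr rfl fun j _ => ?_
  rw [hφ, hw, extend_coe]
  push_cast
  ring

/-- The potential `d⁻¹ (G + γ ζ ^ (r + 5))` together with the data about it that can be read off
from the lists of monomials. -/
structure IsModel (w : Fin (m + 2) → ℚ) (wt : List ℕ) (den W V : ℕ) (G q : MonoList) (γ : ℤ)
    (r : ℕ) : Prop where
  weight_pos : 0 < w 0
  weight_mono : Monotone w
  weight_last : w (idxLast m) = 1
  weight_eq : ∀ i, w i = wt.getD i 0 / den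
  length_eq : wt.length = m + 2
  den_ne_zero : den ≠ 0
  homog_G : homog wt W G = true
  homog_q : homog wt V q = true
  weight_F : (W : ℂ) / den = w 0 + 2
  exponent : γ = 0 ∨ (r + 5) * V = 2 * W

/-- E multiplies every second derivative of F by its weight, so T contains no third derivatives; the
factor 2ζ of Euler's identity cancels against the denominator of `hasPd_three`. -/
theorem IsModel.matT_eq {U : Set (Fin (m + 2) → ℂ)} {ζ F : (Fin (m + 2) → ℂ) → ℂ}
    {x : Fin (m + 2) → ℂ}
    (M : IsModel w wt den W V G q γ r) (h : IsRoot q U ζ)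
    (hF : ∀ x ∈ U, F x = d⁻¹ * (eval (extend x) G + γ * ζ x ^ (r + 5))) (hx : x ∈ U)
    (i j : Fin (m + 2)) :
    matT w F x i j = (4 * d * den)⁻¹ * ((W - wt.getD i 0 - wt.getD j.rev 0)
      * second G q γ r (extend x) (ζ x) i j.rev) := by
  have h0 := h.ne_zero x hx
  have E := euler_eq (f := fun y => matC F y i j)
    (φ := fun k => (8 * d * ζ x)⁻¹ * third G q γ r (extend x) (ζ x) k i j.rev)
    M.weight_last M.weight_eq M.length_eq fun k => (h.hasPd_three hF hx k i j.rev).2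
  refine E.trans ?_
  have := sum_mul_third M.homog_G M.homog_q M.exponent (extend x) (ζ x) (h.sq_eq x hx) i j.rev
  simp only [mul_left_comm _ ((8 * d * ζ x)⁻¹), ← Finset.mul_sum, this]
  simp only [mul_inv]
  field_simp
  ring

/-- Homogeneity is Euler's identity, and the matrices ∂C differ from those in `hc` by the scalar 1 /
(8dζ). Only the dependence on x_n and the commutation have to be supplied. -/
theorem IsModel.isPotential {U : Set (Fin (m + 2) → ℂ)} {ζ F : (Fin (m + 2) → ℂ) → ℂ}
    (M : IsModel w wt den W V G q γ r) (h : IsRoot q U ζ)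
    (hF : ∀ x ∈ U, F x = d⁻¹ * (eval (extend x) G + γ * ζ x ^ (r + 5)))
    (hn : ∀ x ∈ U, HasPd (idxLast m) (fun y => F y - F0 y) 0 x)
    (hc : ∀ x ∈ U, ∀ j k : Fin (m + 2),
      Commute (Matrix.of fun i l : Fin (m + 2) => third G q γ r (extend x) (ζ x) j i l.rev)
        (Matrix.of fun i l : Fin (m + 2) => third G q γ r (extend x) (ζ x) k i l.rev)) :
    IsPotential w U F where
  weight_pos := M.weight_pos
  weight_mono := M.weight_mono
  weight_last := M.weight_last
  analytic := h.analyticOnNhd hF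
  normal_form x hx := (hn x hx).2
  homogeneous x hx := by
    have h0 := h.ne_zero x hx
    rw [euler_eq (φ := fun j => d⁻¹ * (eval (extend x) (MonoList.deriv j G)
      + γ * ((r + 5) / 2 * (ζ x ^ (r + 3) * eval (extend x) (MonoList.deriv j q)))))
      M.weight_last M.weight_eq M.length_eq fun k => (h.hasPd_one hF hx k).2, hF x hx]
    have e : ∀ k, (wt.getD k 0 : ℂ) * extend x k * (d⁻¹ * (eval (extend x) (MonoList.deriv k G)
          + γ * ((r + 5) / 2 * (ζ x ^ (r + 3) * eval (extend x) (MonoList.deriv k q)))))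
        = d⁻¹ * ((wt.getD k 0 : ℂ) * extend x k * eval (extend x) (MonoList.deriv k G))
          + d⁻¹ * (γ * ((r + 5) / 2 * ζ x ^ (r + 3)))
            * ((wt.getD k 0 : ℂ) * extend x k * eval (extend x) (MonoList.deriv k q)) := by
      intro k; ring
    simp only [e, Finset.sum_add_distrib, ← Finset.mul_sum, sum_mul_eval_deriv M.homog_G,
      sum_mul_eval_deriv M.homog_q, ← h.sq_eq x hx, ← M.weight_F]
    have hγ' : (γ : ℂ) * ((r + 5) * V - 2 * W) = 0 := by
      rcases M.exponent with h | h
      · simp [h]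
      · have : ((r : ℂ) + 5) * V = 2 * W := by exact_mod_cast congrArg (Nat.cast (R := ℂ)) h
        rw [this]; ring
    rw [div_eq_mul_inv]
    linear_combination ((den : ℂ)⁻¹ * d⁻¹ * ζ x ^ (r + 5) / 2) * hγ'
  wdvv x hx j k := by
    have e : ∀ k, matB F k x = (8 * d * ζ x)⁻¹ •
        (Matrix.of fun i l : Fin (m + 2) => third G q γ r (extend x) (ζ x) k i l.rev) := by
      intro k
      ext i l
      exact (h.hasPd_three hF hx k i l.rev).2
    rw [e, e, ← commute_iff_lie_eq]
    exact ((hc x hx j k).smul_left _).smul_right _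

end WDVV

/-! ### Coefficient bounds and Kronecker substitution -/

namespace MvPolynomial

variable {σ : Type*} [Fintype σ] [DecidableEq σ]

/-- The sum of the absolute values of the terms of a polynomial at a point with natural
coordinates. -/
def absEval (p : σ → ℕ) (E : MvPolynomial σ ℤ) : ℤ :=
  ∑ m ∈ E.support, |coeff m E| * ∏ i, (p i : ℤ) ^ m i

variable {p : σ → ℕ} {E E' : MvPolynomial σ ℤ}

theorem absEval_eq_sum {s : Finset (σ →₀ ℕ)} (h : E.support ⊆ s) :
    absEval p E = ∑ m ∈ s, |coeff m E| * ∏ i, (p i : ℤ) ^ m i := by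
  refine Finset.sum_subset h fun m _ hm => ?_
  simp [notMem_support_iff.mp hm]

theorem absEval_nonneg : 0 ≤ absEval p E :=
  Finset.sum_nonneg fun m _ => by positivity

theorem absEval_zero : absEval p 0 = 0 := by simp [absEval]

theorem absEval_add_le : absEval p (E + E') ≤ absEval p E + absEval p E' := by
  rw [absEval_eq_sum (support_add (p := E) (q := E')),
    absEval_eq_sum (E := E) Finset.subset_union_left,
    absEval_eq_sum (E := E') Finset.subset_union_right, ← Finset.sum_add_distrib]
  refine Finset.sum_le_sum fun m _ => ?_
  rw [coeff_add, ← add_mul]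
  exact mul_le_mul_of_nonneg_right (abs_add_le _ _) (by positivity)

theorem absEval_sum_le {ι : Type*} (s : Finset ι) (f : ι → MvPolynomial σ ℤ) :
    absEval p (∑ i ∈ s, f i) ≤ ∑ i ∈ s, absEval p (f i) := by
  classical
  induction s using Finset.induction_on with
  | empty => simp [absEval_zero]
  | insert a s ha ih =>
    rw [Finset.sum_insert ha, Finset.sum_insert ha]
    exact absEval_add_le.trans (by gcongr)

theorem absEval_monomial (m : σ →₀ ℕ) (c : ℤ) :
    absEval p (monomial m c) = |c| * ∏ i, (p i : ℤ) ^ m i := by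
  rw [absEval_eq_sum (support_monomial_subset), Finset.sum_singleton, coeff_monomial, if_pos rfl]

theorem absEval_neg : absEval p (-E) = absEval p E := by
  simp [absEval]

theorem absEval_mul_le : absEval p (E * E') ≤ absEval p E * absEval p E' := by
  conv_lhs => rw [E.as_sum, E'.as_sum, Finset.sum_mul_sum]
  refine (absEval_sum_le _ _).trans ?_
  rw [absEval, absEval, Finset.sum_mul_sum]
  refine Finset.sum_le_sum fun m _ => (absEval_sum_le _ _).trans (Finset.sum_le_sum fun m' _ => ?_)
  rw [monomial_mul, absEval_monomial, abs_mul]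
  simp only [Finsupp.add_apply, pow_add, Finset.prod_mul_distrib]
  exact le_of_eq (by ring)

theorem absEval_C (c : ℤ) : absEval p (C c : MvPolynomial σ ℤ) = |c| := by
  rw [← monomial_zero', absEval_monomial]; simp

theorem absEval_X (i : σ) : absEval p (X i : MvPolynomial σ ℤ) = p i := by
  rw [X, absEval_monomial, Finset.prod_eq_single i] <;>
    simp +contextual [eq_comm]

theorem absEval_pow_le (k : ℕ) : absEval p (E ^ k) ≤ absEval p E ^ k := by
  induction k with
  | zero => simpa using (absEval_C (p := p) 1).le
  | succ k ih =>
    rw [pow_succ, pow_succ]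
    exact absEval_mul_le.trans (mul_le_mul_of_nonneg_right ih absEval_nonneg)

/-- With all coordinates at least 1, each term of the sum dominates its own coefficient. -/
theorem abs_coeff_le_absEval (hp : ∀ i, 1 ≤ p i) (m : σ →₀ ℕ) : |coeff m E| ≤ absEval p E := by
  by_cases hm : m ∈ E.support
  · refine le_trans ?_ (Finset.single_le_sum (f := fun m => |coeff m E| * ∏ i, (p i : ℤ) ^ m i)
      (fun _ _ => by positivity) hm)
    have : (1 : ℤ) ≤ ∏ i, (p i : ℤ) ^ m i :=
      Finset.one_le_prod fun i _ => one_le_pow₀ (by exact_mod_cast hp i)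
    exact le_mul_of_one_le_right (abs_nonneg _) this
  · rw [notMem_support_iff.mp hm, abs_zero]; exact absEval_nonneg

/-- Substitute the integer `N` for the variable `i`. -/
noncomputable def subst (i : σ) (N : ℤ) : MvPolynomial σ ℤ →ₐ[ℤ] MvPolynomial σ ℤ :=
  aeval (Function.update X i (C N))

theorem subst_monomial (i : σ) (N : ℤ) (m : σ →₀ ℕ) (c : ℤ) :
    subst i N (monomial m c) = monomial (m.erase i) (c * N ^ m i) := by
  rw [subst, aeval_monomial, Finsupp.prod_fintype _ _ (by simp), monomial_eq (s := m.erase i),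
    Finsupp.prod_fintype _ _ (by simp), Finset.prod_eq_mul_prod_sdiff_singleton_of_mem (Finset.mem_univ i),
    Finset.prod_eq_mul_prod_sdiff_singleton_of_mem (Finset.mem_univ i) (fun j => X j ^ (m.erase i) j)]
  simp only [Function.update_self, Finsupp.erase_same, pow_zero, one_mul, C_mul, C_pow]
  rw [mul_assoc]
  congr 2
  refine Finset.prod_congr rfl fun j hj => ?_
  have : j ≠ i := by simpa using hj
  rw [Function.update_of_ne this, Finsupp.erase_ne this]

theorem subst_eq_sum (i : σ) (N : ℤ) (E : MvPolynomial σ ℤ) :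
    subst i N E = ∑ m ∈ E.support, monomial (m.erase i) (coeff m E * N ^ m i) := by
  conv_lhs => rw [E.as_sum, map_sum]
  simp only [subst_monomial]

theorem eval_subst {f : σ → ℤ} {i : σ} {N : ℤ} (h : f i = N) (E : MvPolynomial σ ℤ) :
    eval f (subst i N E) = eval f E := by
  have : (eval f).comp (subst i N).toRingHom = eval f := by
    refine ringHom_ext (by simp [subst]) fun j => ?_
    by_cases hj : j = i
    · subst hj; simp [subst, h]
    · simp [subst, Function.update_of_ne hj]
  exact congrArg (fun g => g E) this

/-- The coefficients of E along the direction of the variable i become the digits, in base N, of a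
single coefficient after the substitution. -/
theorem coeff_subst (i : σ) (N : ℤ) (E : MvPolynomial σ ℤ) (r : σ →₀ ℕ) (hr : r i = 0) :
    coeff r (subst i N E)
      = ∑ k ∈ Finset.range (E.totalDegree + 1), coeff (r + Finsupp.single i k) E * N ^ k := by
  have key : ∀ (m : σ →₀ ℕ) (k : ℕ), m = r + Finsupp.single i k ↔ m.erase i = r ∧ m i = k := by
    intro m k
    constructor
    · rintro rfl
      refine ⟨?_, by simp [hr]⟩
      ext j
      by_cases hj : j = i
      · subst hj; simp [hr]
      · simp [Finsupp.erase_ne hj]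
    · rintro ⟨rfl, rfl⟩
      rw [add_comm, Finsupp.single_add_erase]
  rw [subst_eq_sum, coeff_sum]
  simp only [coeff_monomial]
  have e : ∀ k, coeff (r + Finsupp.single i k) E * N ^ k
      = ∑ m ∈ E.support, if m.erase i = r ∧ m i = k then coeff m E * N ^ m i else 0 := by
    intro k
    simp only [← key]
    rw [Finset.sum_ite_eq']
    split_ifs with h
    · simp [hr]
    · simp [notMem_support_iff.mp h]
  simp only [e]
  rw [Finset.sum_comm]
  refine Finset.sum_congr rfl fun m hm => ?_
  by_cases h : m.erase i = r
  · simp only [h, true_and, if_true]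
    rw [Finset.sum_ite_eq, if_pos]
    rw [Finset.mem_range]
    refine Nat.lt_succ_of_le (le_trans ?_ (le_totalDegree hm))
    by_cases h0 : m i = 0
    · omega
    · exact Finset.single_le_sum (f := fun j => m j) (fun _ _ => Nat.zero_le _)
        (Finsupp.mem_support_iff.mpr h0)
  · simp [h]

theorem eq_erase_add_single (i : σ) (m : σ →₀ ℕ) :
    m = m.erase i + Finsupp.single i (m i) := by
  rw [add_comm, Finsupp.single_add_erase]

theorem lt_totalDegree_of_coeff_ne_zero {m : σ →₀ ℕ} (i : σ) (h : coeff m E ≠ 0) :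
    m i < E.totalDegree + 1 := by
  refine Nat.lt_succ_of_le (le_trans ?_ (le_totalDegree (mem_support_iff.mpr h)))
  by_cases h0 : m i = 0
  · omega
  · exact Finset.single_le_sum (f := fun j => m j) (fun _ _ => Nat.zero_le _)
      (Finsupp.mem_support_iff.mpr h0)

theorem digits_eq_zero (N : ℤ) (K : ℕ) (a : ℕ → ℤ) (ha : ∀ k, 2 * |a k| < N)
    (h : ∑ k ∈ Finset.range K, a k * N ^ k = 0) : ∀ k < K, a k = 0 := by
  have hN : 0 < N := lt_of_le_of_lt (by positivity) (ha 0)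
  induction K generalizing a with
  | zero => simp
  | succ K ih =>
    rw [Finset.sum_range_succ'] at h
    have e : ∑ k ∈ Finset.range K, a (k + 1) * N ^ (k + 1)
        = N * ∑ k ∈ Finset.range K, a (k + 1) * N ^ k := by
      rw [Finset.mul_sum]
      exact Finset.sum_congr rfl fun k _ => by ring
    rw [e] at h
    -- The lowest digit is divisible by N and smaller than N in absolute value.
    have h0 : a 0 = 0 := by
      refine Int.eq_zero_of_abs_lt_dvd (m := N) ?_ (by have := ha 0; have := abs_nonneg (a 0); omega)
      exact ⟨-∑ k ∈ Finset.range K, a (k + 1) * N ^ k, by linear_combination h⟩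
    rw [h0, zero_mul, add_zero] at h
    have := ih (fun k => a (k + 1)) (fun k => ha (k + 1)) ((mul_eq_zero.mp h).resolve_left hN.ne')
    intro k hk
    cases k with
    | zero => exact h0
    | succ k => exact this k (by omega)

/-- A polynomial with small coefficients vanishes when it does so at a large value of one
variable. -/
theorem eq_zero_of_subst_eq_zero {i : σ} {N : ℤ} (hE : ∀ m, 2 * |coeff m E| < N)
    (h : subst i N E = 0) : E = 0 := by
  ext m
  by_contra hm
  have := coeff_subst i N E (m.erase i) (by simp)
  rw [h, coeff_zero] at this
  refine hm ?_
  rw [coeff_zero, eq_erase_add_single i m]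
  exact digits_eq_zero N _ (fun k => coeff (m.erase i + Finsupp.single i k) E) (fun k => hE _)
    this.symm (m i) (lt_totalDegree_of_coeff_ne_zero i (by simpa using hm))

/-- A weighted homogeneous polynomial vanishes when it does so at the value `1` of one variable. -/
theorem IsWeightedHomogeneous.eq_zero_of_subst_one {w : σ → ℤ} {W : ℤ} {i : σ}
    (hE : IsWeightedHomogeneous w E W) (hi : w i ≠ 0) (h : subst i 1 E = 0) : E = 0 := by
  ext m
  by_contra hm
  rw [coeff_zero] at hm
  have := coeff_subst i 1 E (m.erase i) (by simp)
  rw [h, coeff_zero, Finset.sum_eq_single (m i)] at this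
  · rw [← eq_erase_add_single i m] at this
    simp at this
    exact hm this.symm
  -- Homogeneity: two monomials of E that differ only in the variable i have equal weight, hence
  -- equal exponents since w_i ≠ 0. So no cancellation can occur when the variable becomes 1.
  · intro k _ hk
    by_contra hne
    have h1 := hE (left_ne_zero_of_mul hne)
    have h2 := hE hm
    rw [map_add, Finsupp.weight_single] at h1
    rw [eq_erase_add_single i m, map_add, Finsupp.weight_single, ← h1] at h2
    have h3 := add_left_cancel h2
    simp only [nsmul_eq_mul] at h3
    exact hk (by exact_mod_cast (mul_right_cancel₀ hi h3).symm)
  · intro hn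
    rw [Finset.mem_range] at hn
    exact absurd (lt_totalDegree_of_coeff_ne_zero i hm) hn

/-- Only an inequality, since distinct monomials can merge and cancel after the substitution. -/
theorem absEval_subst_le (i : σ) (N : ℕ) :
    absEval p (subst i N E) ≤ absEval (Function.update p i N) E := by
  rw [subst_eq_sum]
  refine (absEval_sum_le _ _).trans (le_of_eq (Finset.sum_congr rfl fun m _ => ?_))
  rw [absEval_monomial, Finset.prod_eq_mul_prod_sdiff_singleton_of_mem (Finset.mem_univ i),
    Finset.prod_eq_mul_prod_sdiff_singleton_of_mem (Finset.mem_univ i)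
      (fun j => (Function.update p i N j : ℤ) ^ m j)]
  simp only [Function.update_self, Finsupp.erase_same, pow_zero, one_mul, abs_mul, abs_pow,
    Nat.abs_cast]
  rw [mul_assoc]
  congr 2
  refine Finset.prod_congr rfl fun j hj => ?_
  have : j ≠ i := by simpa using hj
  rw [Function.update_of_ne this, Finsupp.erase_ne this]

theorem vars_subst {i : σ} {N : ℤ} {s : List σ} (h : ∀ m ∈ E.support, ∀ j, m j ≠ 0 → j ∈ i :: s) :
    ∀ m ∈ (subst i N E).support, ∀ j, m j ≠ 0 → j ∈ s := by
  intro m hm j hj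
  rw [subst_eq_sum] at hm
  obtain ⟨m', hm', h'⟩ := Finset.mem_biUnion.mp (support_sum hm)
  have := support_monomial_subset h'
  rw [Finset.mem_singleton] at this
  subst this
  have hji : j ≠ i := by rintro rfl; simp at hj
  rw [Finsupp.erase_ne hji] at hj
  exact (List.mem_cons.mp (h m' hm' j hj)).resolve_left hji

/-- The point with the coordinates listed in `L` and all others equal to `1`. -/
def point : List (σ × ℕ) → σ → ℕ
  | [] => 1
  | a :: L => Function.update (point L) a.1 a.2

/-- Kronecker substitution: a polynomial vanishes when it does so at a point with rapidly growing
coordinates. -/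
theorem eq_zero_of_eval_point_eq_zero (L : List (σ × ℕ)) {f : σ → ℤ} (hf : ∀ a ∈ L, f a.1 = a.2)
    (hL : ∀ a ∈ L, 1 ≤ a.2)
    (hvars : ∀ m ∈ E.support, ∀ j, m j ≠ 0 → j ∈ L.map Prod.fst)
    (hb : ∀ k (hk : k < L.length), 2 * absEval (point (L.take k)) E < L[k].2)
    (h : eval f E = 0) : E = 0 := by
  induction L generalizing E with
  | nil =>
    have : E = C (coeff 0 E) := by
      ext m
      by_cases hm : m = 0
      · rw [hm, coeff_zero_C]
      · rw [coeff_C, if_neg (Ne.symm hm)]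
        by_contra hne
        refine hm (Finsupp.ext fun j => ?_)
        by_contra hj
        simpa using hvars m (mem_support_iff.mpr hne) j hj
    rw [this, eval_C] at h
    rw [this, h, C_0]
  | cons a L ih =>
    -- For k = 0 the point is (1, …, 1), so the hypothesis bounds the sum of the absolute values of
    -- all coefficients of E.
    have h0 := hb 0 (by simp)
    simp only [List.take_zero, List.getElem_cons_zero] at h0
    refine eq_zero_of_subst_eq_zero (i := a.1) (N := a.2)
      (fun m => lt_of_le_of_lt (by gcongr; exact abs_coeff_le_absEval (fun _ => le_rfl) m) h0) ?_
    refine ih (fun b hb => hf b (by simp [hb])) (fun b hb => hL b (by simp [hb]))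
      (vars_subst hvars) (fun k hk => ?_) ?_
    -- Substituting the first value moves it from the polynomial into the point, so the bound for k
    -- + 1 steps becomes the bound for k steps of the new polynomial.
    · have := hb (k + 1) (by simpa using hk)
      simp only [List.take_succ_cons, List.getElem_cons_succ] at this
      refine lt_of_le_of_lt ?_ this
      gcongr
      exact absEval_subst_le _ _
    · rw [eval_subst (hf a (by simp)), h]

end MvPolynomial

/-! ### The commutant of a matrix with a cyclic vector -/

namespace Matrix

/-- Matrices over a domain commute if they commute with a matrix that has a cyclic vector. -/
theorem commute_of_commute_cyclic {R : Type*} [CommRing R] [IsDomain R] {n : ℕ}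
    {A X Y : Matrix (Fin n) (Fin n) R} (hX : Commute A X) (hY : Commute A Y) (v : Fin n → R)
    (hv : (of fun k : Fin n => v ᵥ* A ^ (k : ℕ)).det ≠ 0) : Commute X Y := by
  set K : Matrix (Fin n) (Fin n) R := of fun k : Fin n => v ᵥ* A ^ (k : ℕ) with hK
  have hrow : ∀ u : Fin n → R, u ᵥ* K = v ᵥ* ∑ k : Fin n, u k • A ^ (k : ℕ) := by
    intro u
    ext j
    simp only [hK, vecMul, dotProduct, of_apply, Matrix.sum_apply, smul_apply, smul_eq_mul,
      Finset.mul_sum]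
    rw [Finset.sum_comm]
    exact Finset.sum_congr rfl fun _ _ => Finset.sum_congr rfl fun _ _ => by ring
  -- Multiplying by the adjugate of K writes det K · vZ as vQ with a polynomial Q in A, without
  -- dividing. Such a Q commutes with everything that commutes with A, which allows X and Y to be
  -- traded for polynomials in A.
  have hpoly : ∀ Z : Matrix (Fin n) (Fin n) R, ∃ Q : Matrix (Fin n) (Fin n) R,
      (∀ B, Commute A B → Commute Q B) ∧ K.det • (v ᵥ* Z) = v ᵥ* Q := by
    intro Z
    refine ⟨∑ k : Fin n, ((v ᵥ* Z) ᵥ* K.adjugate) k • A ^ (k : ℕ), fun B hB => ?_, ?_⟩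
    · exact Commute.sum_left _ _ _ fun k _ => (hB.pow_left _).smul_left _
    · rw [← hrow, vecMul_vecMul, adjugate_mul, vecMul_smul, vecMul_one]
  obtain ⟨P, hPc, hP⟩ := hpoly X
  obtain ⟨Q, hQc, hQ⟩ := hpoly Y
  have hPQ : Commute P Q := hPc Q (hQc A (Commute.refl A)).symm
  have h1 : K.det ^ 2 • (v ᵥ* (X * Y)) = v ᵥ* (P * Q) := by
    rw [pow_two, mul_smul, ← vecMul_vecMul, ← smul_vecMul, hP, vecMul_vecMul, (hPc Y hY).eq,
      ← vecMul_vecMul, ← smul_vecMul, hQ, vecMul_vecMul, hPQ.eq]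
  have h2 : K.det ^ 2 • (v ᵥ* (Y * X)) = v ᵥ* (P * Q) := by
    rw [pow_two, mul_smul, ← vecMul_vecMul, ← smul_vecMul, hQ, vecMul_vecMul, (hQc X hX).eq,
      ← vecMul_vecMul, ← smul_vecMul, hP, vecMul_vecMul]
  have h3 : v ᵥ* (X * Y - Y * X) = 0 := by
    rw [vecMul_sub, sub_eq_zero]
    refine smul_right_injective _ (pow_ne_zero 2 hv) ?_
    simp only [h1, h2]
  -- The commutator kills v and commutes with A, hence it kills all v Aᵏ, the rows of K.
  have hc : Commute A (X * Y - Y * X) :=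
    (hX.mul_right hY).sub_right (hY.mul_right hX)
  have h4 : K * (X * Y - Y * X) = 0 := by
    ext k j
    have : (K * (X * Y - Y * X)) k = (v ᵥ* A ^ (k : ℕ)) ᵥ* (X * Y - Y * X) := by
      rw [mul_apply_eq_vecMul]; rfl
    rw [this, vecMul_vecMul, (hc.pow_left _).eq, ← vecMul_vecMul, h3, zero_vecMul]
    rfl
  have h5 : K.det • (X * Y - Y * X) = 0 := by
    rw [← one_mul (X * Y - Y * X), ← smul_mul_assoc, ← adjugate_mul, Matrix.mul_assoc, h4,
      Matrix.mul_zero]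
  exact sub_eq_zero.mp ((smul_eq_zero.mp h5).resolve_left hv)

end Matrix

/-! ### Weighted homogeneity of the third derivatives -/

namespace MonoList

open MvPolynomial

variable {n : ℕ}

/-- All monomials have weight `W`. -/
def HasWeight (w : List ℕ) (W : ℤ) (l : MonoList) : Prop :=
  ∀ p ∈ l, (dot w p.2 : ℤ) = W ∧ p.2.length ≤ w.length

theorem hasWeight_of_homog {w : List ℕ} {W : ℕ} {l : MonoList} (h : homog w W l = true) :
    HasWeight w W l := by
  intro p hp
  have := List.all_eq_true.mp h p hp
  simp only [Bool.and_eq_true, Nat.beq_eq, Nat.ble_eq] at this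
  exact ⟨by rw [this.1], this.2⟩

/-- With integral weights the difference needs no lower bound, unlike in `homog_deriv`. -/
theorem HasWeight.deriv {w : List ℕ} {W : ℤ} {l : MonoList} (h : HasWeight w W l) (i : ℕ) :
    HasWeight w (W - w.getD i 0) (deriv i l) := by
  induction l with
  | nil => intro p hp; simp [MonoList.deriv] at hp
  | cons p l ih =>
    obtain ⟨c, e⟩ := p
    have h1 := h (c, e) (by simp)
    have h2 := ih fun p hp => h p (by simp [hp])
    by_cases he : expo i e = 0
    · rwa [deriv_cons_of_eq_zero he]
    · rw [deriv_cons_of_ne_zero he]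
      intro p hp
      rcases List.mem_cons.mp hp with rfl | hp
      · have := dot_lower w i e he h1.2
        refine ⟨?_, by rw [length_lower]; exact h1.2⟩
        simp only at h1 ⊢
        omega
      · exact h2 p hp

section weight

variable {σ M : Type*} [AddCommGroup M] {v : σ → M} {R : Type*} [CommRing R] (w' : ℕ → M)
  {t : ℕ → MvPolynomial σ R}

/-- The weight of a monomial when the weights of the variables are given by a sequence. -/
def weight {M : Type*} [AddCommGroup M] : (ℕ → M) → List ℕ → M
  | _, [] => 0
  | w, a :: e => a • w 0 + weight (fun i => w (i + 1)) e

theorem isWeightedHomogeneous_mono {w : ℕ → M} (ht : ∀ i, IsWeightedHomogeneous v (t i) (w i))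
    (e : List ℕ) : IsWeightedHomogeneous v (mono t e) (weight w e) := by
  induction e generalizing t w with
  | nil => exact isWeightedHomogeneous_one R v
  | cons a e ih => exact ((ht 0).pow a).mul (ih fun i => ht (i + 1))

theorem isWeightedHomogeneous_eval {w : ℕ → M} {W : M}
    (ht : ∀ i, IsWeightedHomogeneous v (t i) (w i)) {l : MonoList}
    (h : ∀ p ∈ l, weight w p.2 = W) : IsWeightedHomogeneous v (eval t l) W := by
  induction l with
  | nil => exact isWeightedHomogeneous_zero R v W
  | cons p l ih =>
    refine IsWeightedHomogeneous.add ?_ (ih fun p hp => h p (by simp [hp]))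
    rw [← h p (by simp)]
    have : ((p.1 : ℤ) : MvPolynomial σ R) = C ((p.1 : ℤ) : R) := by simp
    rw [this]
    exact (isWeightedHomogeneous_mono ht p.2).C_mul _

end weight

theorem weight_eq_dot {K : Type*} [Field K] (w : List ℕ) (den : K) (e : List ℕ)
    (he : e.length ≤ w.length) :
    weight (fun i => (w.getD i 0 : K) / den) e = dot w e / den := by
  induction e generalizing w with
  | nil => cases w <;> simp [weight, dot]
  | cons a e ih =>
    cases w with
    | nil => simp at he
    | cons b w =>
      have := ih w (by simpa using he)
      simp only [weight, dot, List.getD_cons_zero, List.getD_cons_succ] at this ⊢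
      rw [this]
      push_cast
      rw [nsmul_eq_mul]
      ring

theorem weight_int_eq_dot (w : List ℕ) (e : List ℕ) (he : e.length ≤ w.length) :
    weight (fun i => (w.getD i 0 : ℤ)) e = dot w e := by
  induction e generalizing w with
  | nil => cases w <;> simp [weight, dot]
  | cons a e ih =>
    cases w with
    | nil => simp at he
    | cons b w =>
      have := ih w (by simpa using he)
      simp only [weight, dot, List.getD_cons_zero, List.getD_cons_succ] at this ⊢
      rw [this]
      push_cast
      rw [nsmul_eq_mul]
      ring

theorem HasWeight.isWeightedHomogeneous {σ : Type*} {v : σ → ℤ} {t : ℕ → MvPolynomial σ ℤ}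
    {w : List ℕ} {W : ℤ} {l : MonoList} (h : HasWeight w W l)
    (ht : ∀ i, IsWeightedHomogeneous v (t i) (w.getD i 0 : ℤ)) :
    IsWeightedHomogeneous v (eval t l) W :=
  isWeightedHomogeneous_eval ht fun p hp => by
    rw [weight_int_eq_dot w p.2 (h p hp).2, (h p hp).1]

theorem _root_.MvPolynomial.IsWeightedHomogeneous.congr_weight {σ M R : Type*} [AddCommMonoid M]
    [CommSemiring R] {v : σ → M} {P : MvPolynomial σ R} {a b : M} (h : IsWeightedHomogeneous v P a)
    (e : a = b) : IsWeightedHomogeneous v P b := e ▸ h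

/-- The additional weight u comes from the factor 8τ. All summands agree because W = (r + 5) u
whenever γ ≠ 0. -/
theorem isWeightedHomogeneous_third {σ : Type*} {v : σ → ℤ} {t : ℕ → MvPolynomial σ ℤ}
    {τ : MvPolynomial σ ℤ} {u : ℤ}
    {w : List ℕ} {W V : ℕ} {G q : MonoList} {γ : ℤ} {r : ℕ}
    (hG : homog w W G = true) (hq : homog w V q = true) (hγ : γ = 0 ∨ (r + 5) * V = 2 * W)
    (hu : 2 * u = V)
    (ht : ∀ i, IsWeightedHomogeneous v (t i) (w.getD i 0 : ℤ))
    (hτ : IsWeightedHomogeneous v τ u) (a b c : ℕ) :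
    IsWeightedHomogeneous v (third G q γ r t τ a b c)
      (u + W - w.getD a 0 - w.getD b 0 - w.getD c 0) := by
  have hG' := hasWeight_of_homog hG
  have hq' := hasWeight_of_homog hq
  have cast : ∀ k : ℤ, IsWeightedHomogeneous v (k : MvPolynomial σ ℤ) (0 : ℤ) := fun k => by
    simpa using isWeightedHomogeneous_C v k
  have key : ∀ {l W'}, HasWeight w W' l → IsWeightedHomogeneous v (eval t l) W' :=
    fun h => h.isWeightedHomogeneous ht
  have e : third G q γ r t τ a b c
      = ((8 : ℤ) : MvPolynomial σ ℤ) * τ * eval t (deriv a (deriv b (deriv c G)))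
        + (γ : MvPolynomial σ ℤ) *
          ((((r + 5) * (r + 3) * (r + 1) : ℤ) : MvPolynomial σ ℤ) * τ ^ r
            * (eval t (deriv a q) * eval t (deriv b q) * eval t (deriv c q))
          + ((2 * ((r + 5) * (r + 3)) : ℤ) : MvPolynomial σ ℤ) * τ ^ (r + 2)
            * (eval t (deriv a (deriv b q)) * eval t (deriv c q)
              + eval t (deriv a (deriv c q)) * eval t (deriv b q)
              + eval t (deriv b (deriv c q)) * eval t (deriv a q))
          + ((4 * (r + 5) : ℤ) : MvPolynomial σ ℤ) * τ ^ (r + 4)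
            * eval t (deriv a (deriv b (deriv c q)))) := by
    rw [third]; push_cast; rfl
  rw [e]
  have A := ((cast 8).mul hτ).mul (key (((hG'.deriv c).deriv b).deriv a))
  replace A := A.congr_weight (b := u + W - w.getD a 0 - w.getD b 0 - w.getD c 0) (by ring)
  rcases hγ with hγ | hγ
  · rw [hγ, Int.cast_zero, zero_mul, add_zero]; exact A
  have h2 : (W : ℤ) = ((r : ℤ) + 5) * u := by
    have : ((r : ℤ) + 5) * V = 2 * W := by exact_mod_cast hγ
    rw [← hu] at this; linarith
  have B := ((cast ((r + 5) * (r + 3) * (r + 1))).mul (hτ.pow r)).mul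
    (((key (hq'.deriv a)).mul (key (hq'.deriv b))).mul (key (hq'.deriv c)))
  replace B := B.congr_weight (b := u + W - w.getD a 0 - w.getD b 0 - w.getD c 0)
    (by rw [← hu, h2, nsmul_eq_mul]; ring)
  have C1 := (key ((hq'.deriv b).deriv a)).mul (key (hq'.deriv c))
  replace C1 := C1.congr_weight (b := (2 * V - w.getD a 0 - w.getD b 0 - w.getD c 0 : ℤ)) (by ring)
  have C2 := (key ((hq'.deriv c).deriv a)).mul (key (hq'.deriv b))
  replace C2 := C2.congr_weight (b := (2 * V - w.getD a 0 - w.getD b 0 - w.getD c 0 : ℤ)) (by ring)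
  have C3 := (key ((hq'.deriv c).deriv b)).mul (key (hq'.deriv a))
  replace C3 := C3.congr_weight (b := (2 * V - w.getD a 0 - w.getD b 0 - w.getD c 0 : ℤ)) (by ring)
  have C := ((cast (2 * ((r + 5) * (r + 3)))).mul (hτ.pow (r + 2))).mul ((C1.add C2).add C3)
  replace C := C.congr_weight (b := u + W - w.getD a 0 - w.getD b 0 - w.getD c 0)
    (by rw [← hu, h2, nsmul_eq_mul]; push_cast; ring)
  have D := ((cast (4 * (r + 5))).mul (hτ.pow (r + 4))).mul
    (key (((hq'.deriv c).deriv b).deriv a))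
  replace D := D.congr_weight (b := u + W - w.getD a 0 - w.getD b 0 - w.getD c 0)
    (by rw [← hu, h2, nsmul_eq_mul]; push_cast; ring)
  exact A.add (((cast γ).mul ((B.add C).add D)).congr_weight (zero_add _))

end MonoList

namespace MonoList

open MvPolynomial

/-! ### Values at points whose coordinates are powers of two -/

/-- Powers of an integer. -/
def ipow (a : ℤ) : ℕ → ℤ
  | 0 => 1
  | k + 1 => ipow a k * a

theorem ipow_eq (a : ℤ) (k : ℕ) : ipow a k = a ^ k := by
  induction k with
  | zero => exact (pow_zero a).symm
  | succ k ih => rw [ipow, ih, pow_succ]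

/-- The value of a polynomial at the point with the coordinates `2 ^ b_i` for `i ≠ m` and with the
coordinate `P` for `i = m`. -/
def evalBits (b : List ℕ) (m : ℕ) (P : ℤ) : MonoList → ℤ
  | [] => 0
  | (c, e) :: l =>
    (bif (expo m e).beq 0 then c * Int.ofNat (2 ^ dot b e)
      else c * Int.ofNat (2 ^ dot b e) * ipow P (expo m e)) + evalBits b m P l

theorem mono_two_pow (b e : List ℕ) (t : ℕ → ℤ) (h : ∀ i < b.length, t i = 2 ^ b.getD i 0)
    (he : e.length ≤ b.length) : mono t e = 2 ^ dot b e := by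
  induction e generalizing b t with
  | nil => cases b <;> simp [mono, dot]
  | cons a e ih =>
    cases b with
    | nil => simp at he
    | cons k b =>
      rw [mono, dot, ih b (fun i => t (i + 1)) (fun i hi => by
        have := h (i + 1) (by simpa using hi)
        rwa [List.getD_cons_succ] at this) (by simpa using he), h 0 (by simp),
        List.getD_cons_zero, ← pow_mul, pow_add]

/-- The entry 0 at position m makes `dot b e` ignore that variable, so all other variables
contribute a single power of two; the coordinate m is an arbitrary integer, since x_m is not a power
of two after the parametrization. -/
theorem mono_bits (b e : List ℕ) (m : ℕ) (P : ℤ) (t : ℕ → ℤ)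
    (h : ∀ i < b.length, i ≠ m → t i = 2 ^ b.getD i 0) (hm : b.getD m 0 = 0) (hP : t m = P)
    (he : e.length ≤ b.length) : mono t e = 2 ^ dot b e * P ^ expo m e := by
  induction e generalizing b t m with
  | nil => cases b <;> cases m <;> simp [mono, dot, expo]
  | cons a e ih =>
    cases b with
    | nil => simp at he
    | cons k b =>
      cases m with
      | zero =>
        rw [List.getD_cons_zero] at hm
        rw [mono, dot, mono_two_pow b e (fun i => t (i + 1)) (fun i hi => by
          have := h (i + 1) (by simpa using hi) (by omega)
          rwa [List.getD_cons_succ] at this) (by simpa using he), hP, hm, expo]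
        ring
      | succ m =>
        rw [mono, dot, ih b m (fun i => t (i + 1)) (fun i hi hne => by
          have := h (i + 1) (by simpa using hi) (by omega)
          rwa [List.getD_cons_succ] at this) (by simpa using hm) hP (by simpa using he),
          h 0 (by simp) (by omega), List.getD_cons_zero, ← pow_mul, expo, pow_add]
        ring

theorem evalBits_eq {b : List ℕ} {m : ℕ} {P : ℤ} {t : ℕ → ℤ} {w : List ℕ} {W : ℤ} {l : MonoList}
    (hl : HasWeight w W l) (hw : w.length = b.length)
    (h : ∀ i < b.length, i ≠ m → t i = 2 ^ b.getD i 0) (hm : b.getD m 0 = 0) (hP : t m = P) :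
    evalBits b m P l = eval t l := by
  induction l with
  | nil => rfl
  | cons p l ih =>
    obtain ⟨c, e⟩ := p
    have h1 := (hl (c, e) (by simp)).2
    rw [evalBits, eval, ih fun p hp => hl p (by simp [hp]),
      mono_bits b e m P t h hm hP (by rw [← hw]; exact h1)]
    by_cases he : expo m e = 0
    · simp [he]
    · obtain ⟨k, hk⟩ := Nat.exists_eq_succ_of_ne_zero he
      rw [hk, ipow_eq]
      change c * Int.ofNat (2 ^ dot b e) * P ^ k.succ + eval t l = _
      simp [mul_assoc]

/-- The polynomial `third` at a point of the kind considered in `evalBits`. -/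
def thirdBits (G q : MonoList) (γ : ℤ) (r : ℕ) (b : List ℕ) (m : ℕ) (P τ : ℤ) (i j k : ℕ) : ℤ :=
  8 * τ * evalBits b m P (deriv i (deriv j (deriv k G)))
    + γ * (Int.ofNat ((r + 5) * (r + 3) * (r + 1)) * ipow τ r
          * (evalBits b m P (deriv i q) * evalBits b m P (deriv j q) * evalBits b m P (deriv k q))
        + Int.ofNat (2 * ((r + 5) * (r + 3))) * ipow τ (r + 2)
          * (evalBits b m P (deriv i (deriv j q)) * evalBits b m P (deriv k q)
            + evalBits b m P (deriv i (deriv k q)) * evalBits b m P (deriv j q)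
            + evalBits b m P (deriv j (deriv k q)) * evalBits b m P (deriv i q))
        + Int.ofNat (4 * (r + 5)) * ipow τ (r + 4)
          * evalBits b m P (deriv i (deriv j (deriv k q))))

theorem thirdBits_eq {b : List ℕ} {m : ℕ} {P : ℤ} {t : ℕ → ℤ} {w : List ℕ} {W V : ℕ}
    {G q : MonoList} (hG : homog w W G = true) (hq : homog w V q = true)
    (hw : w.length = b.length)
    (h : ∀ i < b.length, i ≠ m → t i = 2 ^ b.getD i 0) (hm : b.getD m 0 = 0) (hP : t m = P)
    (γ : ℤ) (r : ℕ) (τ : ℤ) (i j k : ℕ) :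
    thirdBits G q γ r b m P τ i j k = third G q γ r t τ i j k := by
  have hG' := hasWeight_of_homog hG
  have hq' := hasWeight_of_homog hq
  rw [thirdBits, evalBits_eq (((hG'.deriv k).deriv j).deriv i) hw h hm hP,
    evalBits_eq (hq'.deriv k) hw h hm hP,
    evalBits_eq (hq'.deriv j) hw h hm hP,
    evalBits_eq (hq'.deriv i) hw h hm hP,
    evalBits_eq ((hq'.deriv k).deriv j) hw h hm hP,
    evalBits_eq ((hq'.deriv k).deriv i) hw h hm hP,
    evalBits_eq ((hq'.deriv j).deriv i) hw h hm hP,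
    evalBits_eq (((hq'.deriv k).deriv j).deriv i) hw h hm hP, third]
  simp only [ipow_eq, Int.ofNat_eq_natCast]
  push_cast
  rfl

/-! ### Bounds -/

section abs

variable {σ : Type*} [Fintype σ] [DecidableEq σ] {p : σ → ℕ} {t : ℕ → MvPolynomial σ ℤ}
  {s : ℕ → ℤ}

/-- Differentiation multiplies coefficients by exponents, which are nonnegative. -/
theorem deriv_abs (i : ℕ) (l : MonoList) : deriv i (abs l) = abs (deriv i l) := by
  induction l with
  | nil => rfl
  | cons q l ih =>
    obtain ⟨c, e⟩ := q
    have : abs ((c, e) :: l) = ((c.natAbs : ℤ), e) :: abs l := rfl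
    rw [this]
    by_cases he : expo i e = 0
    · rw [deriv_cons_of_eq_zero he, deriv_cons_of_eq_zero he, ih]
    · rw [deriv_cons_of_ne_zero he, deriv_cons_of_ne_zero he, ih]
      simp [abs]

theorem absEval_mono_le (h : ∀ i, absEval p (t i) ≤ s i) (e : List ℕ) :
    absEval p (mono t e) ≤ mono s e := by
  induction e generalizing t s with
  | nil => simpa [mono] using (absEval_C (p := p) 1).le
  | cons a e ih =>
    refine absEval_mul_le.trans (mul_le_mul ?_ (ih fun i => h (i + 1)) absEval_nonneg ?_)
    · exact (absEval_pow_le a).trans (pow_le_pow_left₀ absEval_nonneg (h 0) a)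
    · exact pow_nonneg (absEval_nonneg.trans (h 0)) a

theorem absEval_intCast (c : ℤ) : absEval p (c : MvPolynomial σ ℤ) = |c| := by
  simpa using absEval_C (p := p) c

theorem absEval_eval_le (h : ∀ i, absEval p (t i) ≤ s i) (l : MonoList) :
    absEval p (eval t l) ≤ eval s (abs l) := by
  induction l with
  | nil => simp [eval, absEval_zero, abs]
  | cons q l ih =>
    have : abs (q :: l) = ((q.1.natAbs : ℤ), q.2) :: abs l := rfl
    rw [this, eval, eval]
    refine absEval_add_le.trans (add_le_add (absEval_mul_le.trans ?_) ih)
    rw [absEval_intCast]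
    simp only [Int.cast_eq, Int.natCast_natAbs]
    exact mul_le_mul_of_nonneg_left (absEval_mono_le h _) (abs_nonneg _)

theorem absEval_mul_le_mul {E E' : MvPolynomial σ ℤ} {a b : ℤ} (h : absEval p E ≤ a)
    (h' : absEval p E' ≤ b) : absEval p (E * E') ≤ a * b :=
  absEval_mul_le.trans (mul_le_mul h h' absEval_nonneg (absEval_nonneg.trans h))

theorem absEval_add_le_add {E E' : MvPolynomial σ ℤ} {a b : ℤ} (h : absEval p E ≤ a)
    (h' : absEval p E' ≤ b) : absEval p (E + E') ≤ a + b :=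
  absEval_add_le.trans (add_le_add h h')

/-- The majorant of `third` is `third` itself for the data with absolute values, so bounds and
values can be computed by the same evaluation. -/
theorem absEval_third_le {τ : MvPolynomial σ ℤ} {u : ℤ} (h : ∀ i, absEval p (t i) ≤ s i)
    (hτ : absEval p τ ≤ u) (G q : MonoList) (γ : ℤ) (r i j k : ℕ) :
    absEval p (third G q γ r t τ i j k) ≤ third (abs G) (abs q) γ.natAbs r s u i j k := by
  have key : ∀ l, absEval p (eval t l) ≤ eval s (abs l) := absEval_eval_le h
  have cast : ∀ k : ℕ, absEval p (k : MvPolynomial σ ℤ) ≤ k := fun k => by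
    simpa using (absEval_intCast (p := p) k).le
  have pow : ∀ k, absEval p (τ ^ k) ≤ u ^ k := fun k =>
    (absEval_pow_le k).trans (pow_le_pow_left₀ absEval_nonneg hτ k)
  have e : third G q γ r t τ i j k
      = ((8 : ℕ) : MvPolynomial σ ℤ) * τ * eval t (deriv i (deriv j (deriv k G)))
        + (γ : MvPolynomial σ ℤ) *
          ((((r + 5) * (r + 3) * (r + 1) : ℕ) : MvPolynomial σ ℤ) * τ ^ r
            * (eval t (deriv i q) * eval t (deriv j q) * eval t (deriv k q))
          + ((2 * ((r + 5) * (r + 3)) : ℕ) : MvPolynomial σ ℤ) * τ ^ (r + 2)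
            * (eval t (deriv i (deriv j q)) * eval t (deriv k q)
              + eval t (deriv i (deriv k q)) * eval t (deriv j q)
              + eval t (deriv j (deriv k q)) * eval t (deriv i q))
          + ((4 * (r + 5) : ℕ) : MvPolynomial σ ℤ) * τ ^ (r + 4)
            * eval t (deriv i (deriv j (deriv k q)))) := by
    rw [third]; push_cast; rfl
  have e' : third (abs G) (abs q) γ.natAbs r s u i j k
      = ((8 : ℕ) : ℤ) * u * eval s (abs (deriv i (deriv j (deriv k G))))
        + |γ| *
          ((((r + 5) * (r + 3) * (r + 1) : ℕ) : ℤ) * u ^ r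
            * (eval s (abs (deriv i q)) * eval s (abs (deriv j q)) * eval s (abs (deriv k q)))
          + ((2 * ((r + 5) * (r + 3)) : ℕ) : ℤ) * u ^ (r + 2)
            * (eval s (abs (deriv i (deriv j q))) * eval s (abs (deriv k q))
              + eval s (abs (deriv i (deriv k q))) * eval s (abs (deriv j q))
              + eval s (abs (deriv j (deriv k q))) * eval s (abs (deriv i q)))
          + ((4 * (r + 5) : ℕ) : ℤ) * u ^ (r + 4)
            * eval s (abs (deriv i (deriv j (deriv k q))))) := by
    rw [third]; simp only [deriv_abs]; push_cast; rfl
  rw [e, e']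
  refine absEval_add_le_add (absEval_mul_le_mul (absEval_mul_le_mul (cast _) hτ) (key _))
    (absEval_mul_le_mul (absEval_intCast γ).le (absEval_add_le_add (absEval_add_le_add
      (absEval_mul_le_mul (absEval_mul_le_mul (cast _) (pow _)) (absEval_mul_le_mul
        (absEval_mul_le_mul (key _) (key _)) (key _)))
      (absEval_mul_le_mul (absEval_mul_le_mul (cast _) (pow _)) (absEval_add_le_add
        (absEval_add_le_add (absEval_mul_le_mul (key _) (key _))
          (absEval_mul_le_mul (key _) (key _))) (absEval_mul_le_mul (key _) (key _)))))
      (absEval_mul_le_mul (absEval_mul_le_mul (cast _) (pow _)) (key _))))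

end abs

/-! ### Commutators -/

section commEntry

variable {R S : Type*} [CommRing R] [CommRing S]

/-- The entry `(i, n - 1 - l)` of `A B + ε B A`, where `A` and `B` are the matrices with the
entries `H_{m, i, n - 1 - k}` and `H_{j, i, n - 1 - k}`. -/
def commEntry (ε : R) (n : ℕ) (H : ℕ → ℕ → ℕ → R) (m j i l : ℕ) : R :=
  ∑ k ∈ Finset.range n,
    (H m i k * H j (n - 1 - k) l + ε * (H j i k * H m (n - 1 - k) l))

/-- The sum of the first `n` terms. -/
def sumTo (f : ℕ → ℤ) : ℕ → ℤ
  | 0 => 0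
  | k + 1 => sumTo f k + f k

theorem sumTo_eq (f : ℕ → ℤ) (n : ℕ) : sumTo f n = ∑ k ∈ Finset.range n, f k := by
  induction n with
  | zero => rfl
  | succ n ih => rw [sumTo, ih, Finset.sum_range_succ]

/-- All of the first `n` values are `true`. -/
def allTo (f : ℕ → Bool) : ℕ → Bool
  | 0 => true
  | k + 1 => f k && allTo f k

theorem of_allTo {f : ℕ → Bool} {n : ℕ} (h : allTo f n = true) : ∀ k < n, f k = true := by
  induction n with
  | zero => simp
  | succ n ih =>
    rw [allTo, Bool.and_eq_true] at h
    intro k hk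
    rcases Nat.lt_succ_iff_lt_or_eq.mp hk with hk | rfl
    · exact ih h.2 k hk
    · exact h.1

/-- The integer is zero. -/
def isZero : ℤ → Bool
  | Int.ofNat a => a.beq 0
  | Int.negSucc _ => false

/-- The integer is less than `N`. -/
def isLt (N : ℕ) : ℤ → Bool
  | Int.ofNat a => Nat.ble (a + 1) N
  | Int.negSucc _ => true

theorem of_isZero {a : ℤ} (h : isZero a = true) : a = 0 := by
  cases a with
  | ofNat a => simpa [isZero] using h
  | negSucc a => simp [isZero] at h

theorem of_isLt {N : ℕ} {a : ℤ} (h : isLt N a = true) : a < N := by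
  cases a with
  | ofNat a => simp [isLt] at h; simp; omega
  | negSucc a => have := Int.negSucc_lt_zero a; omega

/-- `commEntry` for integers. -/
def commInt (ε : ℤ) (n : ℕ) (H : ℕ → ℕ → ℕ → ℤ) (m j i l : ℕ) : ℤ :=
  sumTo (fun k => H m i k * H j (n - 1 - k) l + ε * (H j i k * H m (n - 1 - k) l)) n

theorem commInt_eq (ε : ℤ) (n : ℕ) (H : ℕ → ℕ → ℕ → ℤ) (m j i l : ℕ) :
    commInt ε n H m j i l = commEntry ε n H m j i l := sumTo_eq _ _

theorem map_comm (f : R →+* S) (ε : R) (n : ℕ) (H : ℕ → ℕ → ℕ → R) (m j i l : ℕ) :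
    f (commEntry ε n H m j i l) = commEntry (f ε) n (fun a b c => f (H a b c)) m j i l := by
  simp [commEntry]

/-- Reversing the summation and using the symmetry in the last two indices exchanges the two
products. By this antisymmetry only the entries on one side of the diagonal need checking. -/
theorem comm_swap {n : ℕ} {H : ℕ → ℕ → ℕ → R} (hH : ∀ a b c, H a b c = H a c b) (m j i l : ℕ) :
    commEntry (-1) n H m j i l = - commEntry (-1) n H m j l i := by
  rw [commEntry, commEntry, ← Finset.sum_range_reflect, ← Finset.sum_neg_distrib]
  refine Finset.sum_congr rfl fun k hk => ?_
  rw [Finset.mem_range] at hk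
  have : n - 1 - (n - 1 - k) = k := by omega
  rw [this, hH m i, hH j k, hH j i, hH m k]
  ring

theorem commute_of_comm_eq_zero {n : ℕ} {H : ℕ → ℕ → ℕ → R} {m j : ℕ}
    (h : ∀ i < n, ∀ l < n, commEntry (-1) n H m j i l = 0) :
    Commute (Matrix.of fun i l : Fin n => H m i l.rev)
      (Matrix.of fun i l : Fin n => H j i l.rev) := by
  refine sub_eq_zero.mp ?_
  ext i l
  -- The columns of the matrices are in reverse order, so both the column index l and the summation
  -- index are reflected to match `commEntry`.
  rw [Matrix.sub_apply, Matrix.mul_apply, Matrix.mul_apply, ← Finset.sum_sub_distrib,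
    Matrix.zero_apply, ← h i i.2 l.rev l.rev.2, commEntry, Finset.sum_range, ← Equiv.sum_comp Fin.revPerm]
  refine Finset.sum_congr rfl fun k _ => ?_
  have : ((Fin.rev k : Fin n) : ℕ) = n - 1 - k := by rw [Fin.val_rev]; omega
  simp only [Matrix.of_apply, Fin.revPerm_apply, Fin.rev_rev, this]
  ring

end commEntry

end MonoList

/-! ### Monomial data of a potential and the commutators as integer computations -/

namespace WDVV

open MonoList MvPolynomial

/-- Monomial lists that determine an algebraic potential `d⁻¹ (G + γ ζ ^ (r + 5))`, where
`ζ ^ 2 = q`, in `m + 2` flat coordinates `x_i` of weights `wt_i / den`. The coordinates are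
parametrized by `x_i = 2 ^ lam_i y_i` for `i ≠ m` and `x_m = s y_m ^ 2 + v(y)`, such that
`ζ = t y_m`. The list `steps` consists of the variables `y_i`, `i ≠ 0`, together with exponents
`b_i` such that the values `2 ^ b_i` are suitable for a Kronecker substitution. -/
structure Data (m : ℕ) where
  wt : List ℕ
  wtY : List ℕ
  den : ℕ
  W : ℕ
  V : ℕ
  G : MonoList
  q : MonoList
  γ : ℤ
  r : ℕ
  d : ℕ
  lam : List ℕ
  v : MonoList
  s : ℤ
  t : ℤ
  steps : List (Fin (m + 2) × ℕ)

namespace Data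

variable {m : ℕ} (D : Data m) {R S : Type*} [CommRing R] [CommRing S]

/-- The coordinates `x_i` in terms of the parameters `y_i`. -/
def param (y : ℕ → R) (i : ℕ) : R :=
  if i = m then D.s * y m ^ 2 + eval y D.v else 2 ^ D.lam.getD i 0 * y i

/-- The third derivatives in terms of the parameters. -/
def thirdParam (y : ℕ → R) (a b c : ℕ) : R :=
  third D.G D.q D.γ D.r (D.param y) (D.t * y m) a b c

theorem map_param (f : R →+* S) (y : ℕ → R) (i : ℕ) :
    f (D.param y i) = D.param (fun i => f (y i)) i := by
  unfold param
  split_ifs <;> simp [MonoList.map_eval, map_ofNat]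

theorem map_thirdParam (f : R →+* S) (y : ℕ → R) (a b c : ℕ) :
    f (D.thirdParam y a b c) = D.thirdParam (fun i => f (y i)) a b c := by
  simp [thirdParam, map_third, map_param]

/-- The exponents of the coordinates of a point all of whose coordinates are powers of two. -/
def bits {m : ℕ} : List (Fin (m + 2) × ℕ) → List ℕ
  | [] => List.replicate (m + 2) 0
  | a :: L => (bits L).set a.1.val a.2

/-- The value of `thirdParam` at the point with the coordinates `2 ^ b_i`. -/
def thirdNum (b : List ℕ) : ℕ → ℕ → ℕ → ℤ :=
  let y : ℤ := Int.ofNat (2 ^ b.getD m 0)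
  let b' := b.set m 0
  thirdBits D.G D.q D.γ D.r (List.zipWith Nat.add b' D.lam) m
    (D.s * (y * y) + evalBits b' m 0 D.v) (D.t * y)

/-- Replace all coefficients by their absolute values. -/
def abs : Data m :=
  { D with
    G := D.G.abs, q := D.q.abs, γ := D.γ.natAbs, v := D.v.abs, s := D.s.natAbs, t := D.t.natAbs }

/-- The commutator of the matrices with the indices `m` and `j` vanishes at the point described by
`steps`. -/
def checkZero (j : ℕ) : Bool :=
  let H := D.thirdNum (bits D.steps)
  allTo (fun i => allTo (fun l => isZero (commInt (-1) (m + 2) H m j l i)) i) (m + 2)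

/-- The entries of the commutator of the matrices with the indices `m` and `j` are less than `N`
in absolute value when the first `k` steps are taken. -/
def checkBound (j k N : ℕ) : Bool :=
  let H := D.abs.thirdNum (bits (D.steps.take k))
  allTo (fun i => allTo (fun l => isLt N (2 * commInt 1 (m + 2) H m j l i)) i) (m + 2)

/-- The conditions `checkBound` for all steps. -/
def checkBounds (j : ℕ) : Bool :=
  allTo (fun k => D.checkBound j k (2 ^ ((D.steps.map Prod.snd).getD k 0))) D.steps.length

/-- The conditions which do not depend on the point. -/
structure IsSound : Prop where
  length_wt : D.wt.length = m + 2
  length_wtY : D.wtY.length = m + 2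
  length_lam : D.lam.length = m + 2
  homog_G : homog D.wt D.W D.G = true
  homog_q : homog D.wt D.V D.q = true
  homog_v : homog D.wtY (D.wt.getD m 0) D.v = true
  free_v : deriv m D.v = []
  wtY_eq : ∀ i : Fin (m + 2), (i : ℕ) ≠ m → D.wtY.getD i 0 = D.wt.getD i 0
  wtY_m : 2 * D.wtY.getD m 0 = D.wt.getD m 0
  V_eq : D.V = D.wt.getD m 0
  exponent : D.γ = 0 ∨ (D.r + 5) * D.V = 2 * D.W
  weight_zero : D.wtY.getD 0 0 ≠ 0
  dual : ∀ i : Fin (m + 2), D.wt.getD i 0 + D.wt.getD (m + 1 - i) 0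
    = D.wt.getD 0 0 + D.wt.getD (m + 1) 0
  lam_m : D.lam.getD m 0 = 0
  steps_mem : ∀ i : Fin (m + 2), i ∈ 0 :: D.steps.map Prod.fst
  steps_nodup : (0 :: D.steps.map Prod.fst).Nodup

variable {D}

theorem length_bits (L : List (Fin (m + 2) × ℕ)) : (bits L).length = m + 2 := by
  induction L with
  | nil => simp [bits]
  | cons a L ih => simp [bits, ih]

/-- The list of values for the Kronecker substitution. -/
def values (L : List (Fin (m + 2) × ℕ)) : List (Fin (m + 2) × ℕ) :=
  L.map fun a => (a.1, 2 ^ a.2)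

theorem point_values (L : List (Fin (m + 2) × ℕ)) (i : Fin (m + 2)) :
    point (values L) i = 2 ^ (bits L).getD i 0 := by
  induction L with
  | nil => simp [values, point, bits, List.getD_eq_getElem?_getD]
  | cons a L ih =>
    have : values (a :: L) = (a.1, 2 ^ a.2) :: values L := rfl
    rw [this, point, bits]
    by_cases h : i = a.1
    · subst h
      rw [Function.update_self, List.getD_eq_getElem?_getD, List.getElem?_set_self
        (by rw [length_bits]; exact a.1.2)]
      rfl
    · rw [Function.update_of_ne h, ih, List.getD_eq_getElem?_getD, List.getD_eq_getElem?_getD,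
        List.getElem?_set_ne]
      exact fun e => h (Fin.ext e.symm)

/-- The polynomial v does not contain y_m, so any value P may be put there. -/
theorem evalBits_v (hD : D.IsSound) {b : List ℕ} (hb : b.length = m + 2) {y : ℕ → ℤ}
    (hy : ∀ i < m + 2, y i = 2 ^ b.getD i 0) (P : ℤ) :
    evalBits (b.set m 0) m P D.v = MonoList.eval y D.v := by
  rw [eval_congr_of_deriv_eq_nil (t' := Function.update y m P) hD.free_v
    fun i hi => (Function.update_of_ne hi _ _).symm]
  refine evalBits_eq (hasWeight_of_homog hD.homog_v) ?_ ?_ ?_ (Function.update_self _ _ _)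
  · simp [hD.length_wtY, hb]
  · intro i hi him
    rw [Function.update_of_ne him, hy i (by simpa [hb] using hi), List.getD_eq_getElem?_getD,
      List.getD_eq_getElem?_getD, List.getElem?_set_ne him.symm]
  · rw [List.getD_eq_getElem?_getD, List.getElem?_set_self (by omega)]; rfl

theorem thirdNum_eq (hD : D.IsSound) {b : List ℕ} (hb : b.length = m + 2) {y : ℕ → ℤ}
    (hy : ∀ i < m + 2, y i = 2 ^ b.getD i 0) (i j k : ℕ) :
    D.thirdNum b i j k = D.thirdParam y i j k := by
  have hset : ∀ i ≠ m, (b.set m 0).getD i 0 = b.getD i 0 := by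
    intro i hi
    rw [List.getD_eq_getElem?_getD, List.getD_eq_getElem?_getD, List.getElem?_set_ne hi.symm]
  have hsetm : (b.set m 0).getD m 0 = 0 := by
    rw [List.getD_eq_getElem?_getD, List.getElem?_set_self (by omega)]; rfl
  have hzip : ∀ i < m + 2, (List.zipWith Nat.add (b.set m 0) D.lam).getD i 0
      = (b.set m 0).getD i 0 + D.lam.getD i 0 := by
    intro i hi
    have h1 : i < (b.set m 0).length := by simpa [hb] using hi
    have h2 : i < D.lam.length := by rw [hD.length_lam]; exact hi
    simp [List.getD_eq_getElem?_getD, List.getElem?_zipWith, List.getElem?_eq_getElem h1,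
      List.getElem?_eq_getElem h2]
  have hy' : (Int.ofNat (2 ^ b.getD m 0)) = y m := by
    rw [hy m (by omega)]; simp
  rw [thirdNum, thirdParam]
  simp only [hy']
  refine thirdBits_eq hD.homog_G hD.homog_q ?_ ?_ ?_ ?_ _ _ _ _ _ _
  · simp [hD.length_wt, hb, hD.length_lam]
  · intro i hi him
    have hi' : i < m + 2 := by
      have : i < (b.set m 0).length ∧ i < D.lam.length := by
        simpa only [List.length_zipWith, lt_inf_iff, lt_min_iff] using hi
      rw [hD.length_lam] at this
      exact this.2
    rw [param, if_neg him, hzip i hi', hset i him, pow_add, hy i hi', mul_comm]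
  · rw [hzip m (by omega), hsetm, hD.lam_m]
  · rw [param, if_pos rfl, evalBits_v hD hb hy, pow_two]
    rfl

/-- Soundness concerns the exponents only, apart from a possible γ = 0, which is preserved. -/
theorem isSound_abs (hD : D.IsSound) : D.abs.IsSound where
  length_wt := hD.length_wt
  length_wtY := hD.length_wtY
  length_lam := hD.length_lam
  homog_G := (homog_abs _ _ _).trans hD.homog_G
  homog_q := (homog_abs _ _ _).trans hD.homog_q
  homog_v := (homog_abs _ _ _).trans hD.homog_v
  free_v := (deriv_abs _ _).trans (by rw [hD.free_v]; rfl)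
  wtY_eq := hD.wtY_eq
  wtY_m := hD.wtY_m
  V_eq := hD.V_eq
  exponent := hD.exponent.imp_left fun h => by simp [abs, h]
  weight_zero := hD.weight_zero
  dual := hD.dual
  lam_m := hD.lam_m
  steps_mem := hD.steps_mem
  steps_nodup := hD.steps_nodup

theorem values_append (L : List (Fin (m + 2) × ℕ)) : (values L).map Prod.fst = L.map Prod.fst := by
  simp [values]

theorem point_of_notMem {L : List (Fin (m + 2) × ℕ)} {i : Fin (m + 2)}
    (h : i ∉ L.map Prod.fst) : point (values L) i = 1 := by
  induction L with
  | nil => rfl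
  | cons a L ih =>
    have : values (a :: L) = (a.1, 2 ^ a.2) :: values L := rfl
    rw [List.map_cons, List.mem_cons, not_or] at h
    rw [this, point, Function.update_of_ne h.1, ih h.2]

theorem point_of_mem {L : List (Fin (m + 2) × ℕ)} (h : (L.map Prod.fst).Nodup) :
    ∀ a ∈ values L, point (values L) a.1 = a.2 := by
  induction L with
  | nil => simp [values]
  | cons b L ih =>
    have : values (b :: L) = (b.1, 2 ^ b.2) :: values L := rfl
    rw [List.map_cons, List.nodup_cons] at h
    intro a ha
    rw [this] at ha ⊢
    rcases List.mem_cons.mp ha with rfl | ha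
    · simp [point]
    · have hne : a.1 ≠ b.1 := by
        rintro e
        rw [← e, ← values_append] at h
        exact h.1 (List.mem_map_of_mem ha)
      rw [point, Function.update_of_ne hne, ih h.2 a ha]

/-- The variables `y_i` as polynomials. -/
noncomputable def var (m : ℕ) (i : ℕ) : MvPolynomial (Fin (m + 2)) ℤ :=
  if h : i < m + 2 then X ⟨i, h⟩ else 0

theorem absEval_var (p : Fin (m + 2) → ℕ) (i : ℕ) :
    absEval p (var m i) = if h : i < m + 2 then (p ⟨i, h⟩ : ℤ) else 0 := by
  unfold var
  split_ifs
  · exact absEval_X _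
  · exact absEval_zero

theorem absEval_thirdParam_le (p : Fin (m + 2) → ℕ) (a b c : ℕ) :
    absEval p (D.thirdParam (var m) a b c)
      ≤ D.abs.thirdParam (fun i => absEval p (var m i)) a b c := by
  refine absEval_third_le (fun i => ?_) ?_ _ _ _ _ _ _ _
  · unfold param
    split_ifs with h
    · refine absEval_add_le_add (absEval_mul_le_mul ?_ (absEval_pow_le 2))
        (absEval_eval_le (fun _ => le_rfl) _)
      simpa [abs] using (absEval_intCast (p := p) D.s).le
    · refine absEval_mul_le_mul ((absEval_pow_le _).trans (pow_le_pow_left₀ absEval_nonneg ?_ _))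
        le_rfl
      simpa using (absEval_intCast (p := p) 2).le
  · refine absEval_mul_le_mul ?_ le_rfl
    simpa [abs] using (absEval_intCast (p := p) D.t).le

theorem isWeightedHomogeneous_var (D : Data m) (i : ℕ) :
    IsWeightedHomogeneous (fun i : Fin (m + 2) => (D.wtY.getD i 0 : ℤ)) (var m i)
      (D.wtY.getD i 0 : ℤ) := by
  unfold var
  split_ifs with h
  · exact isWeightedHomogeneous_X ℤ _ (⟨i, h⟩ : Fin (m + 2))
  · exact isWeightedHomogeneous_zero _ _ _

/-- The parametrization respects weights when y_m gets half the weight of x_m, which is also the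
weight of ζ = t y_m. -/
theorem isWeightedHomogeneous_thirdParam (hD : D.IsSound) (a b c : ℕ) :
    IsWeightedHomogeneous (fun i : Fin (m + 2) => (D.wtY.getD i 0 : ℤ))
      (D.thirdParam (var m) a b c)
      (D.wtY.getD m 0 + D.W - D.wt.getD a 0 - D.wt.getD b 0 - D.wt.getD c 0 : ℤ) := by
  have hv := isWeightedHomogeneous_var D
  have hm : (2 * D.wtY.getD m 0 : ℤ) = D.wt.getD m 0 := by exact_mod_cast hD.wtY_m
  have cast : ∀ k : ℤ, IsWeightedHomogeneous (fun i : Fin (m + 2) => (D.wtY.getD i 0 : ℤ))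
      (k : MvPolynomial (Fin (m + 2)) ℤ) (0 : ℤ) := fun k => by
    simpa using isWeightedHomogeneous_C _ k
  refine isWeightedHomogeneous_third hD.homog_G hD.homog_q hD.exponent ?_ (fun i => ?_) ?_ a b c
  · rw [hD.V_eq]; exact hm
  · unfold param
    split_ifs with h
    · subst h
      refine IsWeightedHomogeneous.add ?_
        ((hasWeight_of_homog hD.homog_v).isWeightedHomogeneous hv)
      refine ((cast _).mul ((hv i).pow 2)).congr_weight ?_
      rw [← hm]; simp
    · by_cases hi : i < m + 2
      · have := hD.wtY_eq ⟨i, hi⟩ h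
        simp only at this
        have c2 := (cast 2).pow (D.lam.getD i 0)
        rw [← this]
        simpa using c2.mul (hv i)
      · rw [var, dif_neg hi, mul_zero]
        exact isWeightedHomogeneous_zero _ _ _
  · simpa using (cast D.t).mul (hv m)

/-- In the summand k the indices k and m + 1 - k occur in the two factors, and by duality the sum of
their weights does not depend on k. -/
theorem isWeightedHomogeneous_comm (hD : D.IsSound) (j i l : ℕ) :
    IsWeightedHomogeneous (fun i : Fin (m + 2) => (D.wtY.getD i 0 : ℤ))
      (commEntry (-1) (m + 2) (D.thirdParam (var m)) m j i l)
      (2 * (D.wtY.getD m 0 + D.W) - D.wt.getD 0 0 - D.wt.getD (m + 1) 0 - D.wt.getD m 0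
        - D.wt.getD j 0 - D.wt.getD i 0 - D.wt.getD l 0 : ℤ) := by
  refine IsWeightedHomogeneous.sum _ _ _ fun k hk => ?_
  rw [Finset.mem_range] at hk
  have hd : (D.wt.getD k 0 + D.wt.getD (m + 1 - k) 0 : ℤ)
      = D.wt.getD 0 0 + D.wt.getD (m + 1) 0 := by exact_mod_cast hD.dual ⟨k, hk⟩
  have H := isWeightedHomogeneous_thirdParam hD
  have e : m + 2 - 1 - k = m + 1 - k := by omega
  rw [neg_one_mul, e]
  refine IsWeightedHomogeneous.add (((H m i k).mul (H j _ l)).congr_weight ?_)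
    (((H j i k).mul (H m _ l)).neg.congr_weight ?_)
  · linear_combination -hd
  · linear_combination -hd

/-- Homogeneity allows y_0 = 1. The remaining variables are eliminated in the order of `steps`: the
bounds of `checkBounds` make each value large enough for a Kronecker substitution, and `checkZero`
is the vanishing at the resulting point. -/
theorem comm_eq_zero (hD : D.IsSound) {j i l : ℕ} (hi : i < m + 2) (hl : l < i)
    (hz : D.checkZero j = true) (hb : D.checkBounds j = true) :
    commEntry (-1) (m + 2) (D.thirdParam (var m)) m j l i = 0 := by
  have hnd := List.nodup_cons.mp hD.steps_nodup
  have hfst := values_append D.steps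
  refine (isWeightedHomogeneous_comm hD j l i).eq_zero_of_subst_one (i := 0)
    (by simpa using hD.weight_zero) ?_
  refine eq_zero_of_eval_point_eq_zero (values D.steps)
    (f := fun i => (point (values D.steps) i : ℤ)) (fun a ha => ?_) (fun a ha => ?_) ?_
    (fun k hk => ?_) ?_
  · exact_mod_cast point_of_mem hnd.2 a ha
  · obtain ⟨b, _, rfl⟩ := List.mem_map.mp ha
    exact Nat.one_le_two_pow
  · exact vars_subst fun m _ j _ => by rw [hfst]; exact hD.steps_mem j
  · have hk' : k < D.steps.length := by simpa [values] using hk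
    have htake : (values D.steps).take k = values (D.steps.take k) := by
      simp [values, List.map_take]
    have hN : (values D.steps)[k].2 = 2 ^ ((D.steps.map Prod.snd).getD k 0) := by
      simp [values, List.getD_eq_getElem?_getD, List.getElem?_eq_getElem hk']
    have hc := of_isLt (of_allTo (of_allTo (of_allTo hb k hk') i hi) l hl)
    rw [htake, hN]
    refine lt_of_le_of_lt ?_ hc
    have h0 : (0 : Fin (m + 2)) ∉ (D.steps.take k).map Prod.fst := fun h => by
      rw [List.map_take] at h
      exact hnd.1 (List.mem_of_mem_take h)
    rw [commInt_eq]
    refine mul_le_mul_of_nonneg_left ((absEval_subst_le 0 1).trans ?_) (by norm_num)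
    -- The index 0 is not among the steps, so the point already has the coordinate 1 there.
    rw [Function.update_eq_self_iff.mpr (point_of_notMem h0).symm, commEntry, commEntry]
    refine (absEval_sum_le _ _).trans (Finset.sum_le_sum fun k' _ => ?_)
    have H : ∀ a b c, absEval (point (values (D.steps.take k))) (D.thirdParam (var m) a b c)
        ≤ D.abs.thirdNum (bits (D.steps.take k)) a b c := by
      intro a b c
      rw [thirdNum_eq (isSound_abs hD) (length_bits _)
        (y := fun i => absEval (point (values (D.steps.take k))) (var m i))]
      · exact absEval_thirdParam_le _ a b c
      · intro i hi
        rw [absEval_var, dif_pos hi, point_values]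
        push_cast; rfl
    refine absEval_add_le_add (absEval_mul_le_mul (H _ _ _) (H _ _ _)) ?_
    -- The sign of the second product is lost in the majorant, which is why `checkBound` uses ε = 1.
    rw [neg_one_mul, absEval_neg, one_mul]
    exact absEval_mul_le_mul (H _ _ _) (H _ _ _)
  · rw [eval_subst (by exact_mod_cast point_of_notMem hnd.1), MonoList.map_comm]
    have hc := of_isZero (of_allTo (of_allTo hz i hi) l hl)
    rw [commInt_eq] at hc
    rw [← hc, map_neg, map_one]
    congr 1
    funext a b c
    rw [map_thirdParam, thirdNum_eq hD (length_bits _)]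
    intro i hi
    rw [var, dif_pos hi, eval_X, point_values]
    push_cast; rfl

/-- The matrix of third derivatives with the index `j`, in terms of the parameters. -/
def matrix (D : Data m) (y : ℕ → R) (j : ℕ) : Matrix (Fin (m + 2)) (Fin (m + 2)) R :=
  Matrix.of fun i l => D.thirdParam y j i l.rev

theorem commute_matrix (hD : D.IsSound) {j : ℕ}
    (hz : D.checkZero j = true) (hb : D.checkBounds j = true) :
    Commute (D.matrix (var m) m) (D.matrix (var m) j) := by
  have hs := comm_swap (H := D.thirdParam (var m)) (n := m + 2)
    (fun a b c => third_comm_right _ _ _ _ _ _ a b c) m j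
  refine commute_of_comm_eq_zero fun i hi l hl => ?_
  rcases lt_trichotomy i l with h | h | h
  · exact comm_eq_zero hD hl h hz hb
  · subst h
    exact self_eq_neg.mp (hs i i)
  · rw [hs, comm_eq_zero hD hi h hz hb, neg_zero]

end Data

end WDVV

/-! ### A cyclic vector modulo p, and commutation of all matrices -/

namespace WDVV

open MonoList MvPolynomial

namespace Data

variable {m : ℕ} {D : Data m} {R S : Type*} [CommRing R] [CommRing S]

/-- The entry `(i, j)` of a matrix given by its rows. -/
def entry (K : List (List ℤ)) (i j : ℕ) : ℤ := (K.getD i []).getD j 0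

/-- The matrices with the rows in `K` and `L` are inverse to each other modulo `p`. -/
def checkInverse (n p : ℕ) (K L : List (List ℤ)) : Bool :=
  allTo (fun i => allTo (fun j => isZero
    ((sumTo (fun k => entry K i k * entry L k j) n - bif i.beq j then 1 else 0) % p)) n) n

/-- Modulo `p`, at the point with the coordinates `2 ^ b_i`, the rows of `K` are the images of the
last unit vector under the powers of the matrix with the index `m`, and `L` is inverse to `K`. -/
def checkCyclic (D : Data m) (b : List ℕ) (p : ℕ) (K L : List (List ℤ)) : Bool :=
  let H := D.thirdNum b
  let n := m + 2
  allTo (fun j => isZero (entry K 0 j - bif j.beq (m + 1) then 1 else 0)) n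
    && allTo (fun k => allTo (fun j => isZero
      ((entry K (k + 1) j - sumTo (fun i => entry K k i * H m i (n - 1 - j)) n) % p)) n) (m + 1)
    && checkInverse n p K L

theorem map_matrix (D : Data m) (f : R →+* S) (y : ℕ → R) (j : ℕ) :
    f.mapMatrix (D.matrix y j) = D.matrix (fun i => f (y i)) j := by
  ext i l
  simp [matrix, map_thirdParam]

theorem intCast_eq_zero_of_emod {p : ℕ} {a : ℤ} (h : isZero (a % p) = true) : (a : ZMod p) = 0 :=
  (ZMod.intCast_zmod_eq_zero_iff_dvd a p).mpr (Int.dvd_of_emod_eq_zero (of_isZero h))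

/-- The product K L is the identity over ZMod p, and this ring is nontrivial; p need not be prime.
-/
theorem det_ne_zero_of_checkInverse {n p : ℕ} [Fact (1 < p)] {K L : List (List ℤ)}
    (h : checkInverse n p K L = true) :
    (Matrix.of fun i j : Fin n => ((entry K i j : ℤ) : ZMod p)).det ≠ 0 := by
  intro hdet
  have hKL : (Matrix.of fun i j : Fin n => ((entry K i j : ℤ) : ZMod p))
      * (Matrix.of fun i j : Fin n => ((entry L i j : ℤ) : ZMod p)) = 1 := by
    ext i j
    have := intCast_eq_zero_of_emod (of_allTo (of_allTo h i i.2) j j.2)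
    rw [Int.cast_sub, sub_eq_zero, sumTo_eq, Finset.sum_range] at this
    rw [Matrix.mul_apply]
    simp only [Matrix.of_apply]
    push_cast at this
    rw [this, Matrix.one_apply]
    by_cases hij : i = j
    · subst hij; simp
    · have h'' : (i : ℕ).beq j = false := by
        rw [Bool.eq_false_iff]; simpa using fun e => hij (Fin.ext e)
      simp [hij, h'']
  have := congrArg Matrix.det hKL
  rw [Matrix.det_mul, hdet, zero_mul, Matrix.det_one] at this
  exact zero_ne_one this

theorem map_vecMul_pow (f : R →+* S) {n : ℕ} (A : Matrix (Fin n) (Fin n) R) (v : Fin n → R)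
    (k : ℕ) : (fun j => f ((Matrix.vecMul v (A ^ k)) j))
      = Matrix.vecMul (fun i => f (v i)) (f.mapMatrix A ^ k) := by
  rw [← map_pow]
  funext j
  simp [Matrix.vecMul, dotProduct]

/-- A polynomial determinant is nonzero if its image at one integer point, reduced modulo p, is.
Under this reduction the vectors obtained from the last unit vector become the rows of K. -/
theorem det_cyclic_ne_zero (hD : D.IsSound) {b : List ℕ} {p : ℕ} {K L : List (List ℤ)}
    (hb : b.length = m + 2) (hp : 1 < p) (h : D.checkCyclic b p K L = true) :
    (Matrix.of fun k : Fin (m + 2) => Matrix.vecMul (Pi.single (Fin.last (m + 1)) 1)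
      (D.matrix (var m) m ^ (k : ℕ))).det ≠ 0 := by
  have : Fact (1 < p) := ⟨hp⟩
  simp only [checkCyclic, Bool.and_eq_true] at h
  obtain ⟨⟨h1, h2⟩, h3⟩ := h
  set φ : MvPolynomial (Fin (m + 2)) ℤ →+* ZMod p :=
    (Int.castRingHom (ZMod p)).comp (eval fun i : Fin (m + 2) => 2 ^ b.getD i 0) with hφ
  set y : ℕ → ℤ := fun i => if i < m + 2 then 2 ^ b.getD i 0 else 0 with hy
  have hφv : (fun i => φ (var m i)) = fun i => ((y i : ℤ) : ZMod p) := by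
    funext i
    simp only [hφ, hy, var, RingHom.comp_apply]
    split_ifs <;> simp
  have hM : φ.mapMatrix (D.matrix (var m) m)
      = Matrix.of fun i j : Fin (m + 2) => ((D.thirdNum b m i j.rev : ℤ) : ZMod p) := by
    rw [map_matrix, hφv]
    ext i j
    rw [Matrix.of_apply, thirdNum_eq hD hb (y := y) fun i hi => by simp [hy, hi]]
    exact (D.map_thirdParam (Int.castRingHom (ZMod p)) y m i j.rev).symm
  set M := φ.mapMatrix (D.matrix (var m) m) with hMdef
  have hrow : ∀ k : ℕ, k < m + 2 →
      Matrix.vecMul (Pi.single (Fin.last (m + 1)) 1) (M ^ k)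
        = fun j : Fin (m + 2) => ((entry K k j : ℤ) : ZMod p) := by
    intro k
    induction k with
    | zero =>
      intro _
      rw [pow_zero, Matrix.vecMul_one]
      funext j
      have := of_isZero (of_allTo h1 j j.2)
      rw [sub_eq_zero] at this
      rw [this]
      by_cases hj : (j : ℕ) = m + 1
      · have : j = Fin.last (m + 1) := Fin.ext hj
        subst this
        simp
      · have h' : j ≠ Fin.last (m + 1) := fun e => hj (by simp [e])
        have h'' : (j : ℕ).beq (m + 1) = false := by
          rw [Bool.eq_false_iff]; simpa using hj
        simp [h', h'']
    | succ k ih =>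
      intro hk
      rw [pow_succ, ← Matrix.vecMul_vecMul, ih (by omega)]
      funext j
      have := intCast_eq_zero_of_emod (of_allTo (of_allTo h2 k (by omega)) j j.2)
      rw [Int.cast_sub, sub_eq_zero] at this
      rw [this, sumTo_eq, Finset.sum_range, Matrix.vecMul, dotProduct, hM]
      push_cast
      refine Finset.sum_congr rfl fun i _ => ?_
      rw [Matrix.of_apply, Fin.val_rev]
      congr 3
      omega
  intro hdet
  have hmap := congrArg φ hdet
  rw [map_zero, RingHom.map_det] at hmap
  have hK : φ.mapMatrix (Matrix.of fun k : Fin (m + 2) =>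
      Matrix.vecMul (Pi.single (Fin.last (m + 1)) 1) (D.matrix (var m) m ^ (k : ℕ)))
      = Matrix.of fun i j : Fin (m + 2) => ((entry K i j : ℤ) : ZMod p) := by
    ext k j
    rw [Matrix.of_apply, ← congrFun (hrow k k.2) j]
    have := congrFun (map_vecMul_pow φ (D.matrix (var m) m) (Pi.single (Fin.last (m + 1)) 1) k) j
    refine this.trans ?_
    congr 2
    funext i
    by_cases hi : i = Fin.last (m + 1)
    · subst hi; simp
    · simp [hi]
  rw [hK] at hmap
  exact det_ne_zero_of_checkInverse h3 hmap

/-- All checks that imply the commutation relations. -/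
structure IsCommuting (D : Data m) (b : List ℕ) (p : ℕ) (K L : List (List ℤ)) : Prop where
  sound : D.IsSound
  length_eq : b.length = m + 2
  one_lt : 1 < p
  cyclic : D.checkCyclic b p K L = true
  zero : ∀ j : Fin (m + 2), (j : ℕ) ≠ m → D.checkZero j = true
  bounds : ∀ j : Fin (m + 2), (j : ℕ) ≠ m → D.checkBounds j = true

/-- The checks compare all matrices with the one of index m only; the cyclic vector supplies the
other pairs. -/
theorem IsCommuting.commute {b : List ℕ} {p : ℕ} {K L : List (List ℤ)}
    (h : D.IsCommuting b p K L) (j k : Fin (m + 2)) :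
    Commute (D.matrix (var m) j) (D.matrix (var m) k) := by
  have key : ∀ j : Fin (m + 2), Commute (D.matrix (var m) m) (D.matrix (var m) j) := by
    intro j
    by_cases hj : (j : ℕ) = m
    · rw [hj]
    · exact commute_matrix h.sound (h.zero j hj) (h.bounds j hj)
  exact Matrix.commute_of_commute_cyclic (key j) (key k) _
    (det_cyclic_ne_zero h.sound h.length_eq h.one_lt h.cyclic)

/-- The matrices of third derivatives commute at every point with a square root of `q`. -/
theorem commute_third
    (hc : ∀ j k : Fin (m + 2), Commute (D.matrix (var m) j) (D.matrix (var m) k))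
    {x : ℕ → ℂ} {ζ : ℂ} {y : ℕ → ℂ} (hyx : ∀ i, D.param y i = x i) (hyζ : D.t * y m = ζ)
    (hy : ∀ i ≥ m + 2, y i = 0) (j k : Fin (m + 2)) :
    Commute (Matrix.of fun i l : Fin (m + 2) => third D.G D.q D.γ D.r x ζ j i l.rev)
      (Matrix.of fun i l : Fin (m + 2) => third D.G D.q D.γ D.r x ζ k i l.rev) := by
  have key := fun j => map_matrix D
    (eval₂Hom (Int.castRingHom ℂ) fun i : Fin (m + 2) => y i) (var m) j
  have hv : (fun i => eval₂Hom (Int.castRingHom ℂ) (fun i : Fin (m + 2) => y i) (var m i)) = y := by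
    funext i
    unfold var
    split_ifs with h
    · simp
    · rw [map_zero, hy i (by omega)]
  simp only [hv] at key
  have e : ∀ j, (Matrix.of fun i l : Fin (m + 2) => third D.G D.q D.γ D.r x ζ j i l.rev)
      = D.matrix y j := by
    intro j
    ext i l
    simp only [matrix, Matrix.of_apply, thirdParam, hyζ]
    congr 1
    exact funext fun i => (hyx i).symm
  rw [e, e, ← key, ← key]
  exact (hc j k).map _

end Data

end WDVV

/-! ### Holomorphic branches of z -/

namespace WDVV

open MonoList

variable {m : ℕ}

/-- Along the line on which only x_{n-1} moves, by s, the equation reads z² = s + z(x)². If z(x) =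
0, the left side has derivative 0 at s = 0 and the right side has derivative 1. -/
theorem IsBranch.ne_zero {v : MvPolynomial (Fin m) ℂ} {U : Set (Fin (m + 2) → ℂ)}
    {z : (Fin (m + 2) → ℂ) → ℂ} (h : IsBranch v U z) {x : Fin (m + 2) → ℂ} (hx : x ∈ U) :
    z x ≠ 0 := by
  intro h0
  set c : ℂ → Fin (m + 2) → ℂ := fun s => Function.update x (idxPen m) (x (idxPen m) + s) with hc
  have hc0 : c 0 = x := by simp [hc]
  have hdiff : Differentiable ℂ c := by
    rw [differentiable_pi]
    intro i
    by_cases hi : i = idxPen m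
    · subst hi; simp only [hc, Function.update_self]; fun_prop
    · simp only [hc, Function.update_of_ne hi]; fun_prop
  have hzc : DifferentiableAt ℂ (fun s => z (c s)) 0 := by
    have : DifferentiableAt ℂ z (c 0) := by rw [hc0]; exact (h.analytic x hx).differentiableAt
    exact this.comp 0 (hdiff 0)
  have hev : (fun s => z (c s) ^ 2) =ᶠ[nhds 0] fun s => s + z x ^ 2 := by
    have hU : ∀ᶠ s in nhds (0 : ℂ), c s ∈ U :=
      (hdiff 0).continuousAt.eventually_mem (h.isOpen.mem_nhds (by rw [hc0]; exact hx))
    filter_upwards [hU] with s hs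
    have h1 := h.equation _ hs
    have h2 := h.equation x hx
    have hi : initial (c s) = initial x := by
      funext i
      refine Function.update_of_ne (fun e => ?_) _ _
      have := congrArg Fin.val e
      simp at this
      omega
    rw [hi] at h1
    have h3 : c s (idxPen m) = x (idxPen m) + s := by simp [hc]
    rw [h3] at h1
    linear_combination h1 - h2
  have h1 := hzc.hasDerivAt.pow 2
  have h2 := ((hasDerivAt_id (0 : ℂ)).add_const (z x ^ 2)).congr_of_eventuallyEq hev
  have := h1.unique h2
  simp [hc0, h0] at this

theorem differentiable_eval_initial (v : MvPolynomial (Fin m) ℂ) :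
    AnalyticOnNhd ℂ (fun x : Fin (m + 2) → ℂ => MvPolynomial.eval (initial x) v) Set.univ := by
  intro x _
  have := AnalyticAt.aeval_mvPolynomial (A := ℂ) (z := x)
    (f := fun x : Fin (m + 2) → ℂ => initial x) (fun i => by
      exact (ContinuousLinearMap.proj (R := ℂ) (φ := fun _ => ℂ) (i.castAdd 2)).analyticAt x) v
  exact this

/-- Let g = x_{n-1} - v. Dividing by g(p) moves the value at p to 1, inside the slit plane, where
exp(log / 2) is a square root; a root a of g(p) restores the scale. -/
theorem exists_isBranch (v : MvPolynomial (Fin m) ℂ) (p : Fin (m + 2) → ℂ)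
    (hp : p (idxPen m) ≠ MvPolynomial.eval (initial p) v) : ∃ U z, IsBranch v U z ∧ p ∈ U := by
  set g : (Fin (m + 2) → ℂ) → ℂ := fun x => x (idxPen m) - MvPolynomial.eval (initial x) v with hg
  have hg0 : g p ≠ 0 := sub_ne_zero.mpr hp
  have hga : AnalyticOnNhd ℂ (fun x => g x / g p) Set.univ := fun x _ =>
    (((ContinuousLinearMap.proj (R := ℂ) (φ := fun _ => ℂ) (idxPen m)).analyticAt x).sub
      (differentiable_eval_initial v x trivial)).div_const
  obtain ⟨a, ha⟩ := IsAlgClosed.exists_pow_nat_eq (g p) (n := 2) (by norm_num)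
  refine ⟨{x | g x / g p ∈ Complex.slitPlane},
    fun x => a * Complex.exp (Complex.log (g x / g p) / 2), ⟨?_, ?_, ?_⟩, ?_⟩
  · have : Continuous fun x => g x / g p := by
      rw [← continuousOn_univ]; exact hga.continuousOn
    exact Complex.isOpen_slitPlane.preimage this
  · intro x hx
    exact analyticAt_const.mul (((hga x trivial).clog hx).div_const).cexp
  · intro x hx
    have h0 := Complex.slitPlane_ne_zero hx
    rw [mul_pow, ha, ← Complex.exp_nat_mul]
    rw [show ((2 : ℕ) : ℂ) * (Complex.log (g x / g p) / 2) = Complex.log (g x / g p) by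
      push_cast; ring, Complex.exp_log h0, mul_div_cancel₀ _ hg0, hg]
    ring
  · simp [hg0]

end WDVV

namespace MonoList

variable {R : Type*} [CommRing R]

theorem eval_congr_of_deriv_eq_nil₂ {t t' : ℕ → R} {a b : ℕ} {l : MonoList}
    (ha : deriv a l = []) (hb : deriv b l = []) (h : ∀ i, i ≠ a → i ≠ b → t i = t' i) :
    eval t l = eval t' l := by
  rw [eval_congr_of_deriv_eq_nil (t' := Function.update t a (t' a)) ha
    fun i hi => (Function.update_of_ne hi _ _).symm]
  refine eval_congr_of_deriv_eq_nil hb fun i hi => ?_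
  by_cases hia : i = a
  · subst hia; simp
  · rw [Function.update_of_ne hia, h i hia hi]

end MonoList

/-! ### The polynomials v and u_j of the data, and the potential on a branch -/

namespace WDVV.Data

open MonoList

variable {m : ℕ} (D : Data m)

/-- The polynomial `v` in the coordinates `x_1, …, x_{n-2}`. -/
noncomputable def vPoly : MvPolynomial (Fin m) ℂ :=
  eval (fun i => if h : i < m then
    MvPolynomial.C ((2 ^ D.lam.getD i 0)⁻¹) * MvPolynomial.X ⟨i, h⟩ else 0) D.v

/-- The even part of the potential as a polynomial in `z ^ 2`. -/
noncomputable def evenPoly (G : MonoList) : Polynomial (MvPolynomial (Fin m) ℂ) :=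
  eval (fun i => if h : i < m then Polynomial.C (MvPolynomial.X ⟨i, h⟩)
    else if i = m then Polynomial.X + Polynomial.C D.vPoly else 0) G

/-- The polynomial in `z` with the coefficients `u_j`. -/
noncomputable def uPoly (κ : ℂ) (G : MonoList) : Polynomial (MvPolynomial (Fin m) ℂ) :=
  Polynomial.C (MvPolynomial.C (D.d : ℂ)⁻¹) * Polynomial.expand _ 2 (D.evenPoly G)
    + Polynomial.monomial (D.r + 5) (MvPolynomial.C ((D.d : ℂ)⁻¹ * D.γ * κ ^ (D.r + 5)))

/-- The data `D` describe a potential of the weights `w`, where `ζ = κ z`, and where the part `G₀`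
of `D.G` represents the polynomial `F₀`. -/
structure IsPresented (w : Fin (m + 2) → ℚ) (κ : ℂ) (G₀ G₁ : MonoList) : Prop where
  sound : D.IsSound
  weight_pos : 0 < w 0
  weight_mono : Monotone w
  weight_last : w (idxLast m) = 1
  weight_eq : ∀ i, w i = D.wt.getD i 0 / D.den
  den_ne_zero : D.den ≠ 0
  d_ne_zero : D.d ≠ 0
  weight_F : D.W = D.wt.getD 0 0 + 2 * D.den
  G_eq : D.G = G₀ ++ G₁
  free_G : deriv (m + 1) G₁ = []
  free_q : deriv (m + 1) D.q = []
  free_v : deriv (m + 1) D.v = []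
  F0_eq : ∀ x : Fin (m + 2) → ℂ, eval (extend x) G₀ = D.d * F0 x
  κ_sq : D.s * κ ^ 2 = D.t ^ 2
  t_ne_zero : D.t ≠ 0
  q_eq : ∀ y : ℕ → ℂ, eval (D.param y) D.q = (D.t * y m) ^ 2

variable {D} {w : Fin (m + 2) → ℚ} {κ : ℂ} {G₀ G₁ : MonoList}

namespace IsPresented

theorem κ_ne_zero (h : D.IsPresented w κ G₀ G₁) : κ ≠ 0 := by
  rintro rfl
  have := h.κ_sq
  rw [zero_pow two_ne_zero, mul_zero, eq_comm, sq_eq_zero_iff, Int.cast_eq_zero] at this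
  exact h.t_ne_zero this

theorem isModel (h : D.IsPresented w κ G₀ G₁) :
    IsModel w D.wt D.den D.W D.V D.G D.q D.γ D.r where
  weight_pos := h.weight_pos
  weight_mono := h.weight_mono
  weight_last := h.weight_last
  weight_eq := h.weight_eq
  length_eq := h.sound.length_wt
  den_ne_zero := h.den_ne_zero
  homog_G := h.sound.homog_G
  homog_q := h.sound.homog_q
  weight_F := by
    have : (D.den : ℂ) ≠ 0 := by exact_mod_cast h.den_ne_zero
    rw [h.weight_eq, h.weight_F]
    push_cast
    rw [add_div, mul_div_assoc, div_self this]
    simp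
  exponent := h.sound.exponent

/-- The parameters of the point `x` and the value `ζ` of the square root of `q`. -/
noncomputable def params (D : Data m) (x : Fin (m + 2) → ℂ) (ζ : ℂ) (i : ℕ) : ℂ :=
  if i = m then ζ / D.t else extend x i / 2 ^ D.lam.getD i 0

theorem eval_params (h : D.IsPresented w κ G₀ G₁) (x : Fin (m + 2) → ℂ) (ζ : ℂ) :
    eval (params D x ζ) D.v = MvPolynomial.eval (initial x) D.vPoly := by
  rw [vPoly, map_eval]
  refine eval_congr_of_deriv_eq_nil₂ h.sound.free_v h.free_v fun i h1 h2 => ?_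
  rw [params, if_neg h1]
  by_cases hi : i < m
  · simp [hi, initial, extend, show i < m + 2 by omega, div_eq_inv_mul]
  · simp [hi, extend, show ¬ i < m + 2 by omega]

/-- For ζ = κ z the relation s κ² = t² gives s (ζ / t)² = z², so the parametrized coordinate x_m is
z² + v, as the equation of the branch demands. -/
theorem param_params (h : D.IsPresented w κ G₀ G₁) {x : Fin (m + 2) → ℂ} {z : ℂ}
    (hz : z ^ 2 + MvPolynomial.eval (initial x) D.vPoly - x (idxPen m) = 0) (i : ℕ) :
    D.param (params D x (κ * z)) i = extend x i := by
  have ht : (D.t : ℂ) ≠ 0 := by exact_mod_cast h.t_ne_zero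
  unfold param
  split_ifs with hi
  · subst hi
    rw [h.eval_params, params, if_pos rfl, div_pow, mul_pow,
      show extend x i = x (idxPen i) from extend_coe x (idxPen i)]
    have := h.κ_sq
    field_simp
    linear_combination z ^ 2 * this + D.t ^ 2 * hz
  · rw [params, if_neg hi]
    field_simp

/-- The identity `q_eq` in the parameters, read at the parameters of the point. -/
theorem sq_eq (h : D.IsPresented w κ G₀ G₁) {x : Fin (m + 2) → ℂ} {z : ℂ}
    (hz : z ^ 2 + MvPolynomial.eval (initial x) D.vPoly - x (idxPen m) = 0) :
    (κ * z) ^ 2 = eval (extend x) D.q := by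
  have ht : (D.t : ℂ) ≠ 0 := by exact_mod_cast h.t_ne_zero
  have := h.q_eq (params D x (κ * z))
  rw [funext (h.param_params hz), params, if_pos rfl, mul_div_cancel₀ _ ht] at this
  exact this.symm

theorem isRoot (h : D.IsPresented w κ G₀ G₁) {U : Set (Fin (m + 2) → ℂ)}
    {z : (Fin (m + 2) → ℂ) → ℂ} (hz : IsBranch D.vPoly U z) :
    IsRoot D.q U (fun x => κ * z x) where
  isOpen := hz.isOpen
  analytic := fun x hx => analyticAt_const.mul (hz.analytic x hx)
  ne_zero := fun _ hx => mul_ne_zero h.κ_ne_zero (hz.ne_zero hx)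
  sq_eq := fun x hx => h.sq_eq (hz.equation x hx)

/-- `evenPoly` is G₁ with x_{n-1} replaced by X + v; putting X = z² gives back G₁ at the point.
Keeping F₀ apart makes the independence of x_n visible. -/
theorem candidate_sub (h : D.IsPresented w κ G₀ G₁) {x : Fin (m + 2) → ℂ} {z : ℂ}
    (hz : z ^ 2 + MvPolynomial.eval (initial x) D.vPoly - x (idxPen m) = 0) :
    candidate (D.uPoly κ G₁) x z
      = F0 x + (D.d : ℂ)⁻¹ * (eval (extend x) G₁ + D.γ * (κ * z) ^ (D.r + 5)) := by
  have key : (Polynomial.eval₂RingHom (MvPolynomial.eval (initial x)) (z ^ 2)) (D.evenPoly G₁)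
      = eval (extend x) G₁ := by
    rw [evenPoly, map_eval]
    refine eval_congr_of_deriv_eq_nil h.free_G fun i hi => ?_
    by_cases him : i < m
    · simp [him, initial, extend, show i < m + 2 by omega]
    · by_cases hm : i = m
      · subst hm
        rw [show extend x i = x (idxPen i) from extend_coe x (idxPen i)]
        simp
        linear_combination hz
      · simp [him, hm, extend, show ¬ i < m + 2 by omega]
  rw [candidate, uPoly, Polynomial.eval₂_add, Polynomial.eval₂_mul, Polynomial.eval₂_C,
    Polynomial.eval₂_monomial, Polynomial.expand_eq_comp_X_pow, Polynomial.eval₂_comp, Polynomial.eval₂_X_pow]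
  rw [Polynomial.coe_eval₂RingHom] at key
  rw [key]
  simp only [MvPolynomial.eval_C]
  ring

theorem candidate_eq (h : D.IsPresented w κ G₀ G₁) {x : Fin (m + 2) → ℂ} {z : ℂ}
    (hz : z ^ 2 + MvPolynomial.eval (initial x) D.vPoly - x (idxPen m) = 0) :
    candidate (D.uPoly κ G₁) x z
      = (D.d : ℂ)⁻¹ * (eval (extend x) D.G + D.γ * (κ * z) ^ (D.r + 5)) := by
  have hd : (D.d : ℂ) ≠ 0 := by exact_mod_cast h.d_ne_zero
  rw [h.candidate_sub hz, h.G_eq, eval_append, h.F0_eq]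
  field_simp
  ring

theorem isPotential (h : D.IsPresented w κ G₀ G₁)
    (hc : ∀ j k : Fin (m + 2), Commute (D.matrix (var m) j) (D.matrix (var m) k))
    {U : Set (Fin (m + 2) → ℂ)} {z : (Fin (m + 2) → ℂ) → ℂ} (hz : IsBranch D.vPoly U z) :
    IsPotential w U (fun x => candidate (D.uPoly κ G₁) x (z x)) := by
  have hr := h.isRoot hz
  have ht : (D.t : ℂ) ≠ 0 := by exact_mod_cast h.t_ne_zero
  refine h.isModel.isPotential hr (fun x hx => h.candidate_eq (hz.equation x hx)) ?_ ?_
  -- F - F₀ is built from G₁ and a root of q, and neither G₁ nor q contains x_n.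
  · intro x hx
    have h1 := ((hasPd_eval (idxLast m) G₁ x).add
      (((hr.hasPd hx (idxLast m)).pow (D.r + 5)).const_mul (D.γ : ℂ))).const_mul (D.d : ℂ)⁻¹
    refine (h1.congr ?_).congr_right ?_
    · filter_upwards [hz.isOpen.mem_nhds hx] with y hy
      rw [h.candidate_sub (hz.equation y hy)]
      ring
    · simp [Fin.val_last, h.free_G, h.free_q, eval]
  · intro x hx j k
    refine commute_third (y := params D x (κ * z x)) hc (h.param_params (hz.equation x hx)) ?_ ?_
      j k
    · rw [params, if_pos rfl, mul_div_cancel₀ _ ht]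
    · intro i hi
      rw [params, if_neg (by omega), extend, dif_neg (by omega), zero_div]

end IsPresented

end WDVV.Data

/-! ### Weighted homogeneity in z, and squarefreeness of monic polynomials -/

namespace Polynomial

open MvPolynomial (IsWeightedHomogeneous)

variable {σ R M : Type*} [CommRing R] [Field M] {w : σ → M} {a b ω : M}
  {f g : Polynomial (MvPolynomial σ R)}

/-- The polynomial `f` is weighted homogeneous of weight `a` when `X` has the weight `ω`. -/
def IsHomogeneousOver (w : σ → M) (ω : M) (f : Polynomial (MvPolynomial σ R)) (a : M) : Prop :=
  ∀ j : ℕ, IsWeightedHomogeneous w (f.coeff j) (a - j * ω)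

namespace IsHomogeneousOver

theorem zero : IsHomogeneousOver w ω (0 : Polynomial (MvPolynomial σ R)) a := fun j => by
  rw [coeff_zero]; exact MvPolynomial.isWeightedHomogeneous_zero _ _ _

theorem add (hf : IsHomogeneousOver w ω f a) (hg : IsHomogeneousOver w ω g a) :
    IsHomogeneousOver w ω (f + g) a := fun j => by
  rw [coeff_add]; exact (hf j).add (hg j)

theorem mul (hf : IsHomogeneousOver w ω f a) (hg : IsHomogeneousOver w ω g b) :
    IsHomogeneousOver w ω (f * g) (a + b) := fun j => by
  rw [coeff_mul]
  refine IsWeightedHomogeneous.sum _ _ _ fun p hp => ((hf p.1).mul (hg p.2)).congr_weight ?_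
  rw [← Finset.HasAntidiagonal.mem_antidiagonal.mp hp]
  push_cast; ring

theorem monomial (k : ℕ) {p : MvPolynomial σ R} (hp : IsWeightedHomogeneous w p (a - k * ω)) :
    IsHomogeneousOver w ω (monomial k p) a := fun j => by
  rw [coeff_monomial]
  split_ifs with h
  · exact h ▸ hp
  · exact MvPolynomial.isWeightedHomogeneous_zero _ _ _

theorem C {p : MvPolynomial σ R} (hp : IsWeightedHomogeneous w p a) :
    IsHomogeneousOver w ω (C p) a :=
  monomial 0 (by simpa using hp)

theorem X : IsHomogeneousOver w ω (X : Polynomial (MvPolynomial σ R)) ω :=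
  monomial 1 (by simpa using MvPolynomial.isWeightedHomogeneous_one R w)

theorem pow (hf : IsHomogeneousOver w ω f a) (k : ℕ) :
    IsHomogeneousOver w ω (f ^ k) (k • a) := by
  induction k with
  | zero => simpa using C (ω := ω) (MvPolynomial.isWeightedHomogeneous_one R w)
  | succ k ih => rw [pow_succ, succ_nsmul]; exact ih.mul hf

theorem expand (hf : IsHomogeneousOver w ω f a) {p : ℕ} (hp : 0 < p) {ω' : M} (h : p * ω' = ω) :
    IsHomogeneousOver w ω' (expand _ p f) a := fun j => by
  rw [coeff_expand hp]
  split_ifs with hj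
  · obtain ⟨k, rfl⟩ := hj
    rw [Nat.mul_div_cancel_left _ hp]
    refine (hf k).congr_weight ?_
    rw [← h]; push_cast; ring
  · exact MvPolynomial.isWeightedHomogeneous_zero _ _ _

theorem mono {t : ℕ → Polynomial (MvPolynomial σ R)} {u : ℕ → M}
    (ht : ∀ i, IsHomogeneousOver w ω (t i) (u i)) (e : List ℕ) :
    IsHomogeneousOver w ω (MonoList.mono t e) (MonoList.weight u e) := by
  induction e generalizing t u with
  | nil => exact C (MvPolynomial.isWeightedHomogeneous_one R w)
  | cons a e ih => exact ((ht 0).pow a).mul (ih fun i => ht (i + 1))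

theorem eval {t : ℕ → Polynomial (MvPolynomial σ R)} {u : ℕ → M} {W : M}
    (ht : ∀ i, IsHomogeneousOver w ω (t i) (u i)) {l : MonoList}
    (h : ∀ p ∈ l, MonoList.weight u p.2 = W) : IsHomogeneousOver w ω (MonoList.eval t l) W := by
  induction l with
  | nil => exact zero
  | cons p l ih =>
    refine add ?_ (ih fun p hp => h p (by simp [hp]))
    rw [← h p (by simp), ← zero_add (MonoList.weight u p.2)]
    refine mul ?_ (mono ht p.2)
    have := C (ω := ω) (MvPolynomial.isWeightedHomogeneous_C w (p.1 : R))
    simpa using this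

end IsHomogeneousOver

/-- If a² divides a monic polynomial, the leading coefficient of a is a unit, so a keeps its degree
under φ. Its image is a unit, so this degree is 0 and a is a unit. -/
theorem squarefree_of_monic_of_map {A K : Type*} [CommRing A] [IsDomain A] [Field K] (φ : A →+* K)
    {f : Polynomial A} (hf : f.Monic) (h : Squarefree (f.map φ)) : Squarefree f := by
  rintro a ⟨b, hb⟩
  have hlc : a.leadingCoeff * (a.leadingCoeff * b.leadingCoeff) = 1 := by
    rw [← mul_assoc, ← leadingCoeff_mul, ← leadingCoeff_mul, ← hb]; exact hf
  have hu : IsUnit a.leadingCoeff := IsUnit.of_mul_eq_one _ hlc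
  have h1 : IsUnit (a.map φ) := h _ ⟨b.map φ, by rw [hb, Polynomial.map_mul, Polynomial.map_mul]⟩
  have h2 : (a.map φ).natDegree = a.natDegree :=
    natDegree_map_of_leadingCoeff_ne_zero φ (hu.map φ).ne_zero
  have h3 : a.natDegree = 0 := by rw [← h2]; exact natDegree_eq_zero_of_isUnit h1
  rw [eq_C_of_natDegree_eq_zero h3]
  refine IsUnit.map _ ?_
  rwa [leadingCoeff, h3] at hu

end Polynomial

/-! ### Weights of v and of the u_j -/

namespace WDVV.Data.IsPresented

open MonoList MvPolynomial

variable {m : ℕ} {D : Data m} {w : Fin (m + 2) → ℚ} {κ : ℂ} {G₀ G₁ : MonoList}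

theorem weight_wt (D : Data m) {W : ℕ} {l : MonoList}
    (hl : homog D.wt W l = true) :
    ∀ p ∈ l, weight (fun i => (D.wt.getD i 0 : ℚ) / D.den) p.2 = W / D.den := by
  intro p hp
  have := List.all_eq_true.mp hl p hp
  simp only [Bool.and_eq_true, Nat.beq_eq, Nat.ble_eq] at this
  rw [weight_eq_dot _ _ _ this.2, this.1]

theorem homog_G₁ (h : D.IsPresented w κ G₀ G₁) : homog D.wt D.W G₁ = true := by
  have := h.sound.homog_G
  rw [h.G_eq, homog, List.all_append, Bool.and_eq_true] at this
  exact this.2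

theorem vPoly_weight (h : D.IsPresented w κ G₀ G₁) :
    IsWeightedHomogeneous (fun i : Fin m => w (i.castAdd 2)) D.vPoly (w (idxPen m)) := by
  -- Both branches of this weight are equal; the case distinction only mirrors the one in `vPoly`.
  refine isWeightedHomogeneous_eval (w := fun i => if i < m then (D.wtY.getD i 0 : ℚ) / D.den
    else (D.wtY.getD i 0 : ℚ) / D.den) (fun i => ?_) fun p hp => ?_
  · split_ifs with hi
    · have h1 := (isWeightedHomogeneous_C (fun i : Fin m => w (i.castAdd 2))
        ((2 ^ D.lam.getD i 0 : ℂ)⁻¹)).mul (isWeightedHomogeneous_X ℂ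
          (fun i : Fin m => w (i.castAdd 2)) ⟨i, hi⟩)
      refine h1.congr_weight ?_
      rw [zero_add, h.weight_eq, h.sound.wtY_eq ⟨i, by omega⟩ hi.ne]
      rfl
    · exact isWeightedHomogeneous_zero _ _ _
  · have := List.all_eq_true.mp h.sound.homog_v p hp
    simp only [Bool.and_eq_true, Nat.beq_eq, Nat.ble_eq] at this
    simp only [ite_self]
    rw [weight_eq_dot _ _ _ this.2, this.1, h.weight_eq]
    simp

theorem uPoly_weight (h : D.IsPresented w κ G₀ G₁) (j : ℕ) :
    IsWeightedHomogeneous (fun i : Fin m => w (i.castAdd 2)) ((D.uPoly κ G₁).coeff j)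
      (w 0 + 2 - j * (w (idxPen m) / 2)) := by
  have hden : (D.den : ℚ) ≠ 0 := by exact_mod_cast h.den_ne_zero
  have hW : (D.W : ℚ) / D.den = w 0 + 2 := by
    rw [h.weight_eq, h.weight_F]
    push_cast
    rw [add_div, mul_div_assoc, div_self hden]
    simp
  rw [← hW]
  refine Polynomial.IsHomogeneousOver.add (a := (D.W : ℚ) / D.den) ?_
    (Polynomial.IsHomogeneousOver.monomial _ ?_) j
  · rw [← zero_add ((D.W : ℚ) / D.den)]
    refine (Polynomial.IsHomogeneousOver.C (isWeightedHomogeneous_C _ _)).mul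
      (Polynomial.IsHomogeneousOver.expand (ω := w (idxPen m)) ?_ two_pos (by push_cast; ring))
    refine Polynomial.IsHomogeneousOver.eval (fun i => ?_) (weight_wt D h.homog_G₁)
    split_ifs with hi him
    · refine Polynomial.IsHomogeneousOver.C ?_
      refine (isWeightedHomogeneous_X ℂ (fun i : Fin m => w (i.castAdd 2)) ⟨i, hi⟩).congr_weight ?_
      rw [h.weight_eq]; rfl
    · have e : (D.wt.getD i 0 : ℚ) / D.den = w (idxPen m) := by
        rw [h.weight_eq, him]; rfl
      rw [e]
      exact Polynomial.IsHomogeneousOver.X.add (Polynomial.IsHomogeneousOver.C h.vPoly_weight)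
    · exact Polynomial.IsHomogeneousOver.zero
  · rcases h.sound.exponent with h0 | h0
    · simp only [h0, Int.cast_zero, mul_zero, zero_mul, map_zero]
      exact isWeightedHomogeneous_zero _ _ _
    · refine (isWeightedHomogeneous_C _ _).congr_weight ?_
      have h1 : ((D.r : ℚ) + 5) * D.V = 2 * D.W := by exact_mod_cast congrArg (Nat.cast (R := ℚ)) h0
      have h2 : w (idxPen m) = D.V / D.den := by rw [h.weight_eq, h.sound.V_eq]; rfl
      rw [h2]
      push_cast
      field_simp
      linear_combination h1

/-- The expanded part has even powers of z only, and the remaining monomial has degree r + 5 ≥ 5. -/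
theorem uPoly_odd (D : Data m) (κ : ℂ) (G : MonoList) {j : ℕ} (hj : ¬ 2 ∣ j) (h5 : j < 5) :
    (D.uPoly κ G).coeff j = 0 := by
  rw [uPoly, Polynomial.coeff_add, Polynomial.coeff_C_mul, Polynomial.coeff_expand two_pos,
    if_neg hj, Polynomial.coeff_monomial, if_neg (by omega), mul_zero, zero_add]

end WDVV.Data.IsPresented

/-! ### Characteristic polynomials from a cyclic vector -/

namespace Matrix

open Polynomial

/-- By Cayley–Hamilton the coefficients of the characteristic polynomial satisfy the same relation
between the vectors v Nᵏ, and independence of these vectors for k < n makes the relation unique. -/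
theorem charpoly_eq_of_cyclic {K : Type*} [Field K] {n : ℕ} (N : Matrix (Fin n) (Fin n) K)
    (v : Fin n → K) (c : Fin n → K) (hv : (of fun k : Fin n => v ᵥ* N ^ (k : ℕ)).det ≠ 0)
    (hc : v ᵥ* N ^ n + ∑ k : Fin n, c k • (v ᵥ* N ^ (k : ℕ)) = 0) :
    N.charpoly = X ^ n + ∑ k : Fin n, C (c k) * X ^ (k : ℕ) := by
  have hdeg : N.charpoly.natDegree = n := by simp
  have hsum := N.charpoly_monic.as_sum
  rw [hdeg, Finset.sum_range] at hsum
  have h1 := N.aeval_self_charpoly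
  rw [hsum] at h1
  simp only [map_add, map_pow, aeval_X, map_sum, map_mul, aeval_C] at h1
  have h2 := congrArg (v ᵥ* ·) h1
  simp only [vecMul_add, vecMul_zero, ← Algebra.smul_def, vecMul_sum, vecMul_smul] at h2
  have h3 : (fun k => c k - N.charpoly.coeff k) ᵥ* (of fun k : Fin n => v ᵥ* N ^ (k : ℕ)) = 0 := by
    have h4 := sub_eq_zero.mpr (hc.trans h2.symm)
    rw [add_sub_add_left_eq_sub, ← Finset.sum_sub_distrib] at h4
    rw [← h4]
    ext j
    simp [vecMul, dotProduct, sub_mul]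
  have h5 := eq_zero_of_vecMul_eq_zero hv h3
  rw [hsum]
  refine congrArg (X ^ n + ·) (Finset.sum_congr rfl fun k _ => ?_)
  rw [sub_eq_zero.mp (congrFun h5 k)]

end Matrix

namespace MonoList

variable {R : Type*} [CommRing R]

theorem mono_eq_of_expo_le_one {t : ℕ → R} {k : ℕ} {e : List ℕ} (he : expo k e = 1) :
    mono t e = t k * mono t (lower k e) := by
  have := mul_mono_lower t k e
  simpa [he] using this.symm

/-- A polynomial which is linear in the variable `k`. -/
theorem eval_eq_add_of_deriv_deriv {t : ℕ → R} {k : ℕ} {l : MonoList}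
    (h : deriv k (deriv k l) = []) :
    eval t l = eval (Function.update t k 0) l + t k * eval t (deriv k l) := by
  induction l with
  | nil => simp [eval, deriv]
  | cons p l ih =>
    obtain ⟨c, e⟩ := p
    by_cases he : expo k e = 0
    · rw [deriv_cons_of_eq_zero he] at h ⊢
      rw [eval, eval, ih h, mono_congr_of_expo_eq_zero (t' := Function.update t k 0) e he
        fun i hi => (Function.update_of_ne hi _ _).symm]
      ring
    · rw [deriv_cons_of_ne_zero he] at h ⊢
      have he' : expo k (lower k e) = 0 := by
        by_contra h'
        rw [deriv_cons_of_ne_zero h'] at h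
        simp at h
      rw [deriv_cons_of_eq_zero he'] at h
      have he1 : expo k e = 1 := by
        have h1 : expo k (lower k e) = expo k e - 1 := by
          clear h he' he ih
          induction e generalizing k with
          | nil => cases k <;> rfl
          | cons a e ih =>
            cases k with
            | zero => rfl
            | succ k => simpa [lower, expo] using ih
        omega
      rw [eval, eval, eval, ih h, mono_eq_of_expo_le_one he1,
        mono_eq_of_expo_le_one (t := Function.update t k 0) he1, he1, Function.update_self]
      push_cast
      ring

end MonoList

/-! ### The determinant of T as a characteristic polynomial in x_n -/

namespace WDVV.Data

open MonoList MvPolynomial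

variable {m : ℕ} (D : Data m) {R S : Type*} [CommRing R] [CommRing S]

/-- The entries of the matrix `T`, multiplied by `4 d den`. -/
def hess (t : ℕ → R) (τ : R) (i j : ℕ) : R :=
  ((D.W : R) - D.wt.getD i 0 - D.wt.getD j 0) * second D.G D.q D.γ D.r t τ i j

theorem map_hess (f : R →+* S) (t : ℕ → R) (τ : R) (i j : ℕ) :
    f (D.hess t τ i j) = D.hess (fun i => f (t i)) (f τ) i j := by
  simp [hess, map_second]

/-- The matrix `T` depends on `x_n` only through the summand `x_n` on the diagonal. -/
def IsLinear : Prop :=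
  ∀ b c : Fin (m + 2), deriv (m + 1) (deriv b (deriv c D.G))
    = bif (b.val + c.val).beq (m + 1) then [((D.d : ℤ), List.replicate (m + 2) 0)] else []

/-- At the point with the parameters `y`, the matrix `T` is up to the factor `g / (4 d den)` the
matrix with the rows `N`; the rows of `K` are the images of a vector under the powers of this
matrix, they are independent modulo `p`, and they satisfy a linear relation with coefficients
`c`. -/
def checkSpectrum (y : List ℤ) (g : ℤ) (N K : List (List ℤ)) (c : List ℤ) (p : ℕ)
    (L : List (List ℤ)) : Bool :=
  let n := m + 2
  let t := fun i => y.getD i 0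
  isZero (t (m + 1))
    && allTo (fun i => allTo (fun j => isZero
      (D.hess (D.param t) (D.t * t m) i (n - 1 - j) - g * entry N i j)) n) n
    && allTo (fun k => allTo (fun j => isZero
      (entry K (k + 1) j - sumTo (fun i => entry K k i * entry N i j) n)) n) (m + 1)
    && allTo (fun j => isZero (sumTo (fun i => entry K (m + 1) i * entry N i j) n
      + sumTo (fun k => c.getD k 0 * entry K k j) n)) n
    && checkInverse n p K L

variable {D}

theorem mono_replicate_zero (t : ℕ → R) (n : ℕ) : mono t (List.replicate n 0) = 1 := by
  induction n generalizing t with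
  | zero => rfl
  | succ n ih => rw [List.replicate_succ, mono, ih]; simp

/-- The variable x_n occurs linearly, with coefficient d, in the second derivatives for dual pairs
of indices, which form the diagonal because the columns are reversed. There W minus the two weights
is den, since dual weights add up to w_1 + 1 and F has weight w_1 + 2. -/
theorem hess_update {w : Fin (m + 2) → ℚ} {κ : ℂ} {G₀ G₁ : MonoList}
    (h : D.IsPresented w κ G₀ G₁) (hl : D.IsLinear) (t : ℕ → R) (τ : R) (i j : Fin (m + 2)) :
    D.hess t τ i j.rev = D.hess (Function.update t (m + 1) 0) τ i j.rev
      + (4 * D.d * D.den * t (m + 1)) * if i = j then 1 else 0 := by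
  have hq : ∀ l : MonoList, deriv (m + 1) l = [] →
      eval t l = eval (Function.update t (m + 1) 0) l := fun l hl =>
    eval_congr_of_deriv_eq_nil hl fun i hi => (Function.update_of_ne hi _ _).symm
  have h1 : ∀ a, deriv (m + 1) (deriv a D.q) = [] := fun a => by
    rw [deriv_comm, h.free_q]; rfl
  have h2 : ∀ a b, deriv (m + 1) (deriv a (deriv b D.q)) = [] := fun a b => by
    rw [deriv_comm, h1]; rfl
  have hlin := hl i j.rev
  have hrev : (j.rev : ℕ) = m + 1 - j := by rw [Fin.val_rev]; omega
  have hzero : deriv (m + 1) (deriv (m + 1) (deriv i (deriv j.rev D.G))) = [] := by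
    rw [hlin]
    cases (i.val + j.rev.val).beq (m + 1)
    · rfl
    · simp only [cond_true]
      rw [deriv_cons_of_eq_zero]
      · rfl
      · generalize m + 1 = k
        generalize m + 2 = n
        induction n generalizing k with
        | zero => cases k <;> rfl
        | succ n ih =>
          cases k with
          | zero => rfl
          | succ k => exact ih k
  rw [hess, hess, second, second, hq _ (h1 _), hq _ (h1 _), hq _ (h2 _ _),
    eval_eq_add_of_deriv_deriv hzero, hlin]
  by_cases hij : i = j
  · subst hij
    have hb : (i.val + i.rev.val).beq (m + 1) = true := by
      rw [Nat.beq_eq]; omega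
    have hw : ((D.W : R) - D.wt.getD i 0 - D.wt.getD i.rev 0) = D.den := by
      have e1 := h.sound.dual i
      have e2 := h.weight_F
      have e3 : D.wt.getD (m + 1) 0 = D.den := by
        have := h.weight_eq (idxLast m)
        rw [h.weight_last, eq_comm, div_eq_one_iff_eq (by exact_mod_cast h.den_ne_zero)] at this
        exact_mod_cast this
      rw [← hrev] at e1
      have e4 : D.W = D.den + D.wt.getD i 0 + D.wt.getD i.rev 0 := by omega
      rw [e4]; push_cast; ring
    rw [hb, cond_true, if_pos rfl, hw, MonoList.eval, MonoList.eval, mono_replicate_zero]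
    push_cast
    ring
  · have hb : (i.val + j.rev.val).beq (m + 1) = false := by
      rw [Bool.eq_false_iff, ne_eq, Nat.beq_eq]
      have : (i : ℕ) ≠ j := fun e => hij (Fin.ext e)
      omega
    rw [hb, cond_false, if_neg hij, MonoList.eval]
    ring

end WDVV.Data

namespace WDVV.Data

open MonoList MvPolynomial

variable {m : ℕ} {D : Data m} {R S : Type*} [CommRing R] [CommRing S]

/-- A linear relation between the rows of `K` gives the characteristic polynomial. -/
theorem charpoly_of_check {N K : List (List ℤ)} {c : List ℤ} {p n : ℕ} {L : List (List ℤ)}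
    (hp : 1 < p)
    (h1 : ∀ k < n, ∀ j < n + 1, entry K (k + 1) j
      = ∑ i : Fin (n + 1), entry K k i * entry N i j)
    (h2 : ∀ j < n + 1, (∑ i : Fin (n + 1), entry K n i * entry N i j)
      + ∑ k : Fin (n + 1), c.getD k 0 * entry K k j = 0)
    (h3 : checkInverse (n + 1) p K L = true) :
    (Matrix.of fun i j : Fin (n + 1) => ((entry N i j : ℤ) : ℂ)).charpoly
      = Polynomial.X ^ (n + 1)
        + ∑ k : Fin (n + 1), Polynomial.C ((c.getD k 0 : ℤ) : ℂ) * Polynomial.X ^ (k : ℕ) := by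
  set M := Matrix.of fun i j : Fin (n + 1) => ((entry N i j : ℤ) : ℂ) with hM
  have hrow : ∀ k : ℕ, k < n + 1 →
      Matrix.vecMul (fun j : Fin (n + 1) => ((entry K 0 j : ℤ) : ℂ)) (M ^ k)
        = fun j : Fin (n + 1) => ((entry K k j : ℤ) : ℂ) := by
    intro k
    induction k with
    | zero => intro _; rw [pow_zero, Matrix.vecMul_one]
    | succ k ih =>
      intro hk
      rw [pow_succ, ← Matrix.vecMul_vecMul, ih (by omega)]
      funext j
      rw [h1 k (by omega) j j.2]
      simp [Matrix.vecMul, dotProduct, hM]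
  refine Matrix.charpoly_eq_of_cyclic M (fun j : Fin (n + 1) => ((entry K 0 j : ℤ) : ℂ))
    (fun k => ((c.getD k 0 : ℤ) : ℂ)) ?_ ?_
  · have : Fact (1 < p) := ⟨hp⟩
    have hK : (Matrix.of fun k : Fin (n + 1) =>
        Matrix.vecMul (fun j : Fin (n + 1) => ((entry K 0 j : ℤ) : ℂ)) (M ^ (k : ℕ)))
        = (Int.castRingHom ℂ).mapMatrix (Matrix.of fun i j : Fin (n + 1) => entry K i j) := by
      ext k j
      rw [Matrix.of_apply, hrow k k.2]
      rfl
    rw [hK, ← RingHom.map_det]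
    intro h0
    have h0' : (Matrix.of fun i j : Fin (n + 1) => entry K i j).det = 0 := by
      exact Int.cast_injective (α := ℂ) (h0.trans Int.cast_zero.symm)
    refine det_ne_zero_of_checkInverse h3 ?_
    have := congrArg (Int.castRingHom (ZMod p)) h0'
    rw [RingHom.map_det, map_zero] at this
    exact this
  · funext j
    rw [pow_succ, ← Matrix.vecMul_vecMul, hrow n (by omega)]
    have := congrArg (Int.cast : ℤ → ℂ) (h2 j j.2)
    push_cast at this
    have hs : (∑ k : Fin (n + 1), ((c.getD k 0 : ℤ) : ℂ) •
        Matrix.vecMul (fun j : Fin (n + 1) => ((entry K 0 j : ℤ) : ℂ)) (M ^ (k : ℕ)))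
        = ∑ k : Fin (n + 1), ((c.getD k 0 : ℤ) : ℂ) •
          fun j : Fin (n + 1) => ((entry K k j : ℤ) : ℂ) :=
      Finset.sum_congr rfl fun k _ => by rw [hrow k k.2]
    rw [hs]
    simpa [Matrix.vecMul, dotProduct, hM, Finset.sum_apply] using this

/-- The coordinates as polynomials in `x_1, …, x_{n-2}, z, x_n`. -/
noncomputable def coord (D : Data m) (i : ℕ) : MvPolynomial (Fin (m + 2)) ℂ :=
  if i = m then X (idxPen m) ^ 2 + rename (Fin.castAdd 2) D.vPoly
  else if h : i < m + 2 then X ⟨i, h⟩ else 0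

/-- The determinant of `T` as a polynomial in `x_1, …, x_{n-2}, z, x_n`. -/
noncomputable def detPoly (D : Data m) (κ : ℂ) : MvPolynomial (Fin (m + 2)) ℂ :=
  (Matrix.of fun i j : Fin (m + 2) => C (4 * D.d * D.den : ℂ)⁻¹
    * D.hess D.coord (C κ * X (idxPen m)) i j.rev).det

theorem initial_update (x : Fin (m + 2) → ℂ) (a : ℂ) :
    initial (Function.update x (idxPen m) a) = initial x := by
  funext i
  refine Function.update_of_ne (fun e => ?_) _ _
  have := congrArg Fin.val e
  simp at this
  omega

theorem eval_coord {x : Fin (m + 2) → ℂ} {z : ℂ}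
    (hz : z ^ 2 + MvPolynomial.eval (initial x) D.vPoly - x (idxPen m) = 0) (i : ℕ) :
    MvPolynomial.eval (Function.update x (idxPen m) z) (D.coord i) = extend x i := by
  unfold coord
  split_ifs with hi h
  · subst hi
    have : (Function.update x (idxPen i) z) ∘ Fin.castAdd 2 = initial x := initial_update x z
    rw [map_add, map_pow, eval_X, eval_rename, this, Function.update_self,
      show extend x i = x (idxPen i) from extend_coe x (idxPen i)]
    linear_combination hz
  · rw [eval_X, Function.update_of_ne, extend, dif_pos h]
    exact fun e => hi (by simpa using congrArg Fin.val e)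
  · rw [map_zero, extend, dif_neg h]

variable {w : Fin (m + 2) → ℚ} {κ : ℂ} {G₀ G₁ : MonoList}

/-- Both sides are determinants of the same matrix: `detPoly` is formed from the Euler formula for T
with z² + v in place of x_{n-1}, and evaluation commutes with determinants. -/
theorem det_matT (h : D.IsPresented w κ G₀ G₁) {U : Set (Fin (m + 2) → ℂ)}
    {z : (Fin (m + 2) → ℂ) → ℂ} (hz : IsBranch D.vPoly U z) {x : Fin (m + 2) → ℂ} (hx : x ∈ U) :
    (matT w (fun y => candidate (D.uPoly κ G₁) y (z y)) x).det
      = MvPolynomial.eval (Function.update x (idxPen m) (z x)) (D.detPoly κ) := by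
  rw [detPoly, RingHom.map_det]
  congr 1
  ext i j
  rw [h.isModel.matT_eq (h.isRoot hz) (fun x hx => h.candidate_eq (hz.equation x hx)) hx]
  simp only [RingHom.mapMatrix_apply, Matrix.map_apply, Matrix.of_apply, map_mul, eval_C, map_hess,
    eval_coord (hz.equation x hx), eval_X, Function.update_self]
  rfl

/-- The last variable as the indeterminate of a polynomial ring, up to the factor `a`. -/
noncomputable def splitLast (m : ℕ) (a : ℂ) :
    MvPolynomial (Fin (m + 2)) ℂ →+* Polynomial (MvPolynomial (Fin (m + 2)) ℂ) :=
  eval₂Hom (Polynomial.C.comp C) fun i =>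
    if i = Fin.last (m + 1) then Polynomial.C (C a) * Polynomial.X else Polynomial.C (X i)

theorem eval₂_splitLast {a : ℂ} (ha : a ≠ 0) (f : MvPolynomial (Fin (m + 2)) ℂ) :
    Polynomial.eval (C a⁻¹ * X (Fin.last (m + 1))) (splitLast m a f) = f := by
  have : (Polynomial.evalRingHom (C a⁻¹ * X (Fin.last (m + 1)))).comp (splitLast m a)
      = RingHom.id _ := by
    refine MvPolynomial.ringHom_ext (fun r => ?_) fun i => ?_
    · simp [splitLast]
    · by_cases hi : i = Fin.last (m + 1)
      · subst hi
        simp [splitLast, ← mul_assoc, ← C_mul, ha]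
      · simp [splitLast, hi]
  exact RingHom.congr_fun this f

/-- If g² divides f, the image of g is a unit, and substituting a⁻¹ x_n for the indeterminate turns
it back into g. -/
theorem squarefree_of_splitLast {a : ℂ} (ha : a ≠ 0) {f : MvPolynomial (Fin (m + 2)) ℂ}
    (hf : Squarefree (splitLast m a f)) : Squarefree f := by
  rintro g ⟨k, rfl⟩
  have := (hf (splitLast m a g) ⟨splitLast m a k, by simp⟩).map
    (Polynomial.evalRingHom (C a⁻¹ * X (Fin.last (m + 1))))
  rwa [Polynomial.coe_evalRingHom, eval₂_splitLast ha] at this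

theorem splitLast_of_free (a : ℂ) (i : Fin (m + 2)) (hi : i ≠ Fin.last (m + 1)) :
    splitLast m a (X i) = Polynomial.C (X i) := by
  simp [splitLast, hi]

theorem splitLast_rename (a : ℂ) (f : MvPolynomial (Fin m) ℂ) :
    splitLast m a (rename (Fin.castAdd 2) f) = Polynomial.C (rename (Fin.castAdd 2) f) := by
  have : (splitLast m a).comp (rename (Fin.castAdd 2)).toRingHom
      = Polynomial.C.comp (rename (Fin.castAdd 2)).toRingHom := by
    refine MvPolynomial.ringHom_ext (fun r => ?_) fun i => ?_
    · simp [splitLast]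
    · have : Fin.castAdd 2 i ≠ Fin.last (m + 1) := fun e => by
        have := congrArg Fin.val e
        simp at this
        omega
      simp [splitLast, this]
  exact RingHom.congr_fun this f

theorem splitLast_coord (a : ℂ) :
    Function.update (fun i => splitLast m a (D.coord i)) (m + 1) 0
      = fun i => Polynomial.C (Function.update D.coord (m + 1) 0 i) := by
  funext i
  by_cases him : i = m + 1
  · subst him; simp
  · rw [Function.update_of_ne him, Function.update_of_ne him, coord]
    have hp : idxPen m ≠ Fin.last (m + 1) := fun e => by simpa using congrArg Fin.val e
    split_ifs with h1 h2
    · rw [map_add, map_pow, splitLast_rename, splitLast_of_free _ _ hp]; simp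
    · exact splitLast_of_free _ _ fun e => him (by simpa using congrArg Fin.val e)
    · simp

/-- With M = g⁻¹ times the part of `hess` free of x_n, T is x_n + (g / (4 d den)) M. Writing x_n = a
X with a = -g / (4 d den) makes this a (X - M), whose determinant is aⁿ times the characteristic
polynomial of M. -/
theorem splitLast_detPoly (h : D.IsPresented w κ G₀ G₁) (hl : D.IsLinear) {g : ℂ} (hg : g ≠ 0) :
    splitLast m (-(g / (4 * D.d * D.den))) (D.detPoly κ)
      = Polynomial.C (C ((-(g / (4 * D.d * D.den))) ^ (m + 2)))
        * (Matrix.of fun i j : Fin (m + 2) => C g⁻¹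
          * D.hess (Function.update D.coord (m + 1) 0) (C κ * X (idxPen m)) i j.rev).charpoly := by
  have hd : (D.d : ℂ) ≠ 0 := by exact_mod_cast h.d_ne_zero
  have hden : (D.den : ℂ) ≠ 0 := by exact_mod_cast h.den_ne_zero
  set a : ℂ := -(g / (4 * D.d * D.den)) with ha
  have hp : idxPen m ≠ Fin.last (m + 1) := fun e => by simpa using congrArg Fin.val e
  have key : (splitLast m a).mapMatrix (Matrix.of fun i j : Fin (m + 2) =>
      C (4 * D.d * D.den : ℂ)⁻¹ * D.hess D.coord (C κ * X (idxPen m)) i j.rev)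
      = (Polynomial.C (C a) : Polynomial (MvPolynomial (Fin (m + 2)) ℂ)) •
        (Matrix.of fun i j : Fin (m + 2) => C g⁻¹
          * D.hess (Function.update D.coord (m + 1) 0) (C κ * X (idxPen m)) i j.rev).charmatrix := by
    ext1 i j
    have hC : ∀ r : ℂ, splitLast m a (C r) = Polynomial.C (C r) := fun r => by simp [splitLast]
    have hX : splitLast m a (D.coord (m + 1)) = Polynomial.C (C a) * Polynomial.X := by
      rw [coord, if_neg (by omega), dif_pos (by omega)]
      have : (⟨m + 1, by omega⟩ : Fin (m + 2)) = Fin.last (m + 1) := rfl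
      simp [splitLast, this]
    have e1 : (Polynomial.C (C (4 * D.d * D.den : ℂ)⁻¹) : Polynomial (MvPolynomial (Fin (m + 2)) ℂ))
        = - Polynomial.C (C a) * Polynomial.C (C g⁻¹) := by
      rw [← Polynomial.C_neg, ← C_neg, ← Polynomial.C_mul, ← C_mul]
      congr 2
      rw [ha]; field_simp
    have e2 : (Polynomial.C (C (4 * D.d * D.den : ℂ)⁻¹) : Polynomial (MvPolynomial (Fin (m + 2)) ℂ))
        * (4 * D.d * D.den) = 1 := by
      have : (4 * D.d * D.den : Polynomial (MvPolynomial (Fin (m + 2)) ℂ))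
          = Polynomial.C (C (4 * D.d * D.den : ℂ)) := by
        simp only [map_mul, map_natCast, map_ofNat]
      rw [this, ← Polynomial.C_mul, ← C_mul, inv_mul_cancel₀ (mul_ne_zero (mul_ne_zero (by norm_num) hd) hden), C_1, Polynomial.C_1]
    rw [RingHom.mapMatrix_apply, Matrix.map_apply, Matrix.of_apply, map_mul, hC, map_hess,
      hess_update h hl, splitLast_coord, hX, map_mul, hC, splitLast_of_free _ _ hp,
      ← Polynomial.C_mul, ← map_hess, Matrix.smul_apply, Matrix.charmatrix_apply, Matrix.of_apply,
      Matrix.diagonal_apply, Polynomial.C_mul]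
    split_ifs
    · linear_combination (Polynomial.C (D.hess (Function.update D.coord (m + 1) 0)
        (C κ * X (idxPen m)) i j.rev)) * e1 + Polynomial.C (C a) * Polynomial.X * e2
    · linear_combination (Polynomial.C (D.hess (Function.update D.coord (m + 1) 0)
        (C κ * X (idxPen m)) i j.rev)) * e1
  rw [detPoly, RingHom.map_det, key, Matrix.det_smul, Fintype.card_fin, Matrix.charpoly]
  simp

/-- The polynomial `detPoly` is squarefree if a suitable specialization has this property. -/
theorem squarefree_detPoly (h : D.IsPresented w κ G₀ G₁) (hl : D.IsLinear) {y : List ℤ} {g : ℤ}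
    {N K : List (List ℤ)} {c : List ℤ} {p : ℕ} {L : List (List ℤ)} (hg : g ≠ 0) (hp : 1 < p)
    (hs : D.checkSpectrum y g N K c p L = true)
    (hsq : Squarefree (Polynomial.X ^ (m + 2) + ∑ k : Fin (m + 2),
      Polynomial.C ((c.getD k 0 : ℤ) : ℂ) * Polynomial.X ^ (k : ℕ))) :
    D.detPoly κ ≠ 0 ∧ Squarefree (D.detPoly κ) := by
  simp only [checkSpectrum, Bool.and_eq_true] at hs
  obtain ⟨⟨⟨⟨h0, h1⟩, h2⟩, h3⟩, h4⟩ := hs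
  have hd : (D.d : ℂ) ≠ 0 := by exact_mod_cast h.d_ne_zero
  have hden : (D.den : ℂ) ≠ 0 := by exact_mod_cast h.den_ne_zero
  have hgc : (g : ℂ) ≠ 0 := by exact_mod_cast hg
  have ha : (-((g : ℂ) / (4 * D.d * D.den))) ≠ 0 := by
    rw [neg_ne_zero]
    exact div_ne_zero hgc (mul_ne_zero (mul_ne_zero (by norm_num) hd) hden)
  have ht : (D.t : ℂ) ≠ 0 := by exact_mod_cast h.t_ne_zero
  have hκ := h.κ_ne_zero
  set t : ℕ → ℤ := fun i => y.getD i 0 with ht'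
  have hchar := charpoly_of_check hp
    (fun k hk j hj => by
      have := sub_eq_zero.mp (of_isZero (of_allTo (of_allTo h2 k hk) j hj))
      rwa [sumTo_eq, Finset.sum_range] at this)
    (fun j hj => by
      have := of_isZero (of_allTo h3 j hj)
      rwa [sumTo_eq, Finset.sum_range, sumTo_eq, Finset.sum_range] at this) h4
  rw [← hchar] at hsq
  set x : Fin (m + 2) → ℂ := fun i => ((D.param t i : ℤ) : ℂ) with hx
  -- Chosen such that κ z = t y_m, the value of ζ at the integer point. A vanishing z is allowed
  -- here, because `detPoly` is a polynomial and no branch near the point is needed.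
  set z : ℂ := D.t * t m / κ with hz
  have hparams : ∀ i < m + 2, IsPresented.params D x (κ * z) i = ((t i : ℤ) : ℂ) := by
    intro i hi
    unfold IsPresented.params
    split_ifs with him
    · subst him; rw [hz]; field_simp
    · rw [extend, dif_pos hi]
      simp only [hx, param, if_neg him]
      push_cast
      field_simp
  have hv : eval (initial x) D.vPoly = ((MonoList.eval t D.v : ℤ) : ℂ) := by
    rw [← h.eval_params x (κ * z)]
    have := MonoList.map_eval (Int.castRingHom ℂ) D.v t
    refine Eq.trans ?_ this.symm
    refine eval_congr h.sound.homog_v fun i hi => ?_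
    rw [h.sound.length_wtY] at hi
    exact hparams i hi
  have hzx : z ^ 2 + eval (initial x) D.vPoly - x (idxPen m) = 0 := by
    have e : x (idxPen m) = D.s * t m ^ 2 + ((MonoList.eval t D.v : ℤ) : ℂ) := by
      simp only [hx, param]
      simp
    rw [hv, e, hz]
    have := h.κ_sq
    field_simp
    linear_combination -(t m : ℂ) ^ 2 * this
  set φ : MvPolynomial (Fin (m + 2)) ℂ →+* ℂ := eval (Function.update x (idxPen m) z) with hφ
  have hφc : (fun i => φ (Function.update D.coord (m + 1) 0 i))
      = fun i => if i < m + 2 then ((D.param t i : ℤ) : ℂ) else 0 := by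
    funext i
    by_cases hi : i = m + 1
    · subst hi
      -- The integer point has x_n = 0, in agreement with the entry that was replaced by 0 in
      -- `D.coord`.
      have : D.param t (m + 1) = 0 := by
        rw [param, if_neg (by omega), ht']
        simp only [of_isZero h0, mul_zero]
      simp [this]
    · rw [Function.update_of_ne hi, hφ, eval_coord hzx]
      simp only [extend, hx]
      split_ifs <;> rfl
  have hsplit := splitLast_detPoly h hl (g := (g : ℂ)) hgc
  set M := Matrix.of fun i j : Fin (m + 2) => C (g : ℂ)⁻¹
    * D.hess (Function.update D.coord (m + 1) 0) (C κ * X (idxPen m)) i j.rev with hM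
  have hMφ : φ.mapMatrix M = Matrix.of fun i j : Fin (m + 2) => ((entry N i j : ℤ) : ℂ) := by
    ext i j
    have e1 := sub_eq_zero.mp (of_isZero (of_allTo (of_allTo h1 i i.2) j j.2))
    have e2 : ((D.hess (fun i => if i < m + 2 then D.param t i else 0) (D.t * t m) i j.rev : ℤ) : ℂ)
        = φ (D.hess (Function.update D.coord (m + 1) 0) (C κ * X (idxPen m)) i j.rev) := by
      rw [map_hess, hφc]
      have := D.map_hess (Int.castRingHom ℂ) (fun i => if i < m + 2 then D.param t i else 0)
        (D.t * t m) i j.rev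
      refine this.trans ?_
      congr 1
      · funext i
        split_ifs <;> simp
      · simp only [map_mul, hφ, eval_C, eval_X, Function.update_self, hz]
        field_simp
        simp
    -- The monomials have at most m + 2 exponents, so coordinates beyond the last one do not matter.
    have e3 : D.hess (fun i => if i < m + 2 then D.param t i else 0) (D.t * t m) i j.rev
        = D.hess (D.param t) (D.t * t m) i (m + 2 - 1 - j) := by
      have hr : (j.rev : ℕ) = m + 2 - 1 - j := by rw [Fin.val_rev]; omega
      have hcg : ∀ {W : ℕ} {l : MonoList}, homog D.wt W l = true →
          MonoList.eval (fun i => if i < m + 2 then D.param t i else 0) l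
            = MonoList.eval (D.param t) l := fun hl =>
        eval_congr hl fun i hi => if_pos (by rwa [h.sound.length_wt] at hi)
      have hG := fun a b => hcg (homog_deriv (homog_deriv h.sound.homog_G b) a)
      have hq1 := fun b => hcg (homog_deriv h.sound.homog_q b)
      have hq2 := fun a b => hcg (homog_deriv (homog_deriv h.sound.homog_q b) a)
      rw [hess, hess, second, second, hG, hq1, hq1, hq2, hr]
    rw [RingHom.mapMatrix_apply, Matrix.map_apply, hM, Matrix.of_apply, map_mul, ← e2, e3, e1,
      Matrix.of_apply, hφ, eval_C]
    push_cast
    field_simp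
  have hsqM : Squarefree M.charpoly := by
    refine Polynomial.squarefree_of_monic_of_map φ M.charpoly_monic ?_
    rwa [← Matrix.charpoly_map, ← RingHom.mapMatrix_apply, hMφ]
  have hunit : IsUnit (Polynomial.C (C ((-((g : ℂ) / (4 * D.d * D.den))) ^ (m + 2))) :
      Polynomial (MvPolynomial (Fin (m + 2)) ℂ)) :=
    ((IsUnit.mk0 _ (pow_ne_zero _ ha)).map C).map Polynomial.C
  refine ⟨fun e => ?_, squarefree_of_splitLast ha ?_⟩
  · rw [e, map_zero] at hsplit
    exact mul_ne_zero hunit.ne_zero M.charpoly_monic.ne_zero hsplit.symm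
  · rw [hsplit]
    exact (associated_unit_mul_right _ _ hunit).squarefree_iff.mp hsqM

end WDVV.Data

/-! ### Algebraic potentials from checked data -/

namespace WDVV.Data

open MonoList

variable {m : ℕ} {D : Data m}

theorem isAlgebraicPotential {w : Fin (m + 2) → ℚ} {κ : ℂ} {G₀ G₁ : MonoList}
    (h : D.IsPresented w κ G₀ G₁) {b : List ℕ} {p : ℕ} {K L : List (List ℤ)}
    (hc : D.IsCommuting b p K L) (hl : D.IsLinear) {y : List ℤ} {g : ℤ} {N K' : List (List ℤ)}
    {c : List ℤ} {p' : ℕ} {L' : List (List ℤ)} (hg : g ≠ 0) (hp : 1 < p')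
    (hs : D.checkSpectrum y g N K' c p' L' = true)
    (hsq : Squarefree (Polynomial.X ^ (m + 2) + ∑ k : Fin (m + 2),
      Polynomial.C ((c.getD k 0 : ℤ) : ℂ) * Polynomial.X ^ (k : ℕ))) :
    IsAlgebraicPotential w D.vPoly (D.uPoly κ G₁) where
  v_weight := h.vPoly_weight
  u_weight := h.uPoly_weight
  u_one := IsPresented.uPoly_odd D κ G₁ (by norm_num) (by norm_num)
  u_three := IsPresented.uPoly_odd D κ G₁ (by norm_num) (by norm_num)
  exists_branch := exists_isBranch D.vPoly
  potential _ _ hz := h.isPotential hc.commute hz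
  det_squarefree := by
    obtain ⟨h0, h1⟩ := squarefree_detPoly h hl hg hp hs hsq
    exact ⟨D.detPoly κ, h0, h1, fun U z hz x hx => det_matT h hz hx⟩

theorem IsPresented.eval_vPoly {w : Fin (m + 2) → ℚ} {κ : ℂ} {G₀ G₁ : MonoList}
    (h : D.IsPresented w κ G₀ G₁) (x : Fin m → ℂ) :
    MvPolynomial.eval x D.vPoly
      = eval (fun i => (if h : i < m then x ⟨i, h⟩ else 0) / 2 ^ D.lam.getD i 0) D.v := by
  rw [vPoly, map_eval]
  refine eval_congr_of_deriv_eq_nil₂ h.sound.free_v h.free_v fun i _ _ => ?_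
  by_cases hi : i < m
  · simp [hi, div_eq_inv_mul]
  · simp [hi]

end WDVV.Data

namespace WDVV

open Polynomial

/-- A nonzero constant as a combination of p and its derivative means that p is separable. The
constant D clears the denominators of the Bézout coefficients. -/
theorem squarefree_of_bezout {p : ℂ[X]} (q a b : ℂ[X]) {D : ℕ} (hD : D ≠ 0)
    (hq : derivative p = q) (h : a * p + b * q = D) : Squarefree p := by
  refine Separable.squarefree ⟨C (D : ℂ)⁻¹ * a, C (D : ℂ)⁻¹ * b, ?_⟩
  rw [hq, mul_assoc, mul_assoc, ← mul_add, h, ← C_eq_natCast, ← C_mul,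
    inv_mul_cancel₀ (by exact_mod_cast hD), C_1]

end WDVV

/-! ### Type H₃ -/

namespace WDVV

open MonoList Polynomial

/-- The terms of `F₀` in the potential of type H3. -/
def freeTermsH3 : MonoList := [(8505, [1, 0, 2]), (8505, [0, 2, 1])]

/-- The even part of the potential of type H3 without the terms of `F₀`. -/
def evenTermsH3 : MonoList := [(17824, [7]), (-27216, [5, 1]), (16380, [3, 2]), (20790, [1, 3])]

/-- The potential of type H3. -/
def dataH3 : Data 1 where
  wt := [1, 2, 3]
  wtY := [1, 1, 3]
  den := 3
  W := 7
  V := 2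
  G := freeTermsH3 ++ evenTermsH3
  q := [(1, [2]), (1, [0, 1])]
  γ := -7776
  r := 2
  d := 17010
  lam := [0, 0, 0]
  v := [(-1, [2])]
  s := 1
  t := 1
  -- The third derivatives do not contain x_n, so giving it a large value leaves the next bound
  -- unchanged and the same exponent serves for the next variable. The lists for the other types
  -- begin with a repeated exponent for this reason.
  steps := [(2, 47), (1, 47)]

theorem isSound_dataH3 : dataH3.IsSound := by
  constructor <;> decide +kernel

theorem isLinear_dataH3 : dataH3.IsLinear := by
  unfold Data.IsLinear
  decide +kernel

theorem isPresented_dataH3 :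
    dataH3.IsPresented ![1/3, 2/3, 1] 1 freeTermsH3 evenTermsH3 where
  sound := isSound_dataH3
  weight_pos := by norm_num
  weight_mono := by
    rw [Fin.monotone_iff_le_succ]
    intro i
    fin_cases i <;> simp <;> norm_num
  weight_last := rfl
  weight_eq i := by fin_cases i <;> simp [dataH3]
  den_ne_zero := by decide
  d_ne_zero := by decide
  weight_F := by decide
  G_eq := rfl
  free_G := by decide +kernel
  free_q := by decide +kernel
  free_v := by decide +kernel
  F0_eq x := by
    have : ({0, idxLast 1} : Finset (Fin (1 + 2)))ᶜ = {1} := by decide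
    rw [F0, this]
    simp [freeTermsH3, dataH3, MonoList.eval, mono, extend, Fin.rev, Fin.last]
    ring
  κ_sq := by simp [dataH3]
  t_ne_zero := by decide
  q_eq y := by
    simp [dataH3, Data.param, MonoList.eval, mono]

/-- The rows of a matrix that is invertible modulo 11. -/
def cyclicRowsH3 : List (List ℤ) :=
  [[0, 0, 1], [0, 10, 0], [1, 5, 6]]

/-- The inverse of `cyclicRowsH3` modulo 11. -/
def cyclicInverseH3 : List (List ℤ) :=
  [[5, 5, 1], [0, 10, 0], [1, 0, 0]]

/-- The exponents 0 stand for the point y = (1, …, 1); modulo 11 the last unit vector is already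
cyclic there. -/
theorem isCommuting_dataH3 :
    dataH3.IsCommuting [0, 0, 0] 11 cyclicRowsH3 cyclicInverseH3 where
  sound := isSound_dataH3
  length_eq := rfl
  one_lt := by decide
  cyclic := by decide +kernel
  zero := by decide +kernel
  bounds := by decide +kernel

/-- The rows of the matrix `T` at a special point up to a factor. -/
def specialRowsH3 : List (List ℤ) :=
  [[0, 22, -24], [3, -18, 22], [0, 3, 0]]

/-- The images of a vector under the powers of the matrix `specialRowsH3`. -/
def krylovRowsH3 : List (List ℤ) :=
  [[0, 0, 1], [0, 3, 0], [9, -54, 66]]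

/-- The inverse of `krylovRowsH3` modulo 5. -/
def krylovInverseH3 : List (List ℤ) :=
  [[1, 2, 4], [0, 2, 0], [1, 0, 0]]

/-- At y = (0, 1, 0), that is x = (0, 1, 0) and ζ = 1, the factor 45360 can be removed from the
entries; what remains has the characteristic polynomial X³ + 18X² - 132X + 216. -/
theorem checkSpectrum_dataH3 :
    dataH3.checkSpectrum [0, 1, 0] 45360 specialRowsH3 krylovRowsH3
      [216, -132, 18] 5 krylovInverseH3 = true := by
  decide +kernel

theorem squarefree_specialH3 : Squarefree (Polynomial.X ^ 3 + ∑ k : Fin 3,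
    Polynomial.C ((([216, -132, 18] : List ℤ).getD k 0 : ℤ) : ℂ) * Polynomial.X ^ (k : ℕ)) := by
  refine squarefree_of_bezout ((3) * X ^ 2 + (36) * X + (-132)) ((3) * X + (45))
    ((-1) * X ^ 2 + (-21) * X + (70)) (D := 480) (by norm_num) ?_ ?_
  · simp [Fin.sum_univ_succ, map_ofNat]
    try ring
  · simp [Fin.sum_univ_succ]
    ring

theorem eval_vPoly_dataH3 (x : Fin 1 → ℂ) : MvPolynomial.eval x dataH3.vPoly = -(x 0) ^ 2 := by
  rw [isPresented_dataH3.eval_vPoly]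
  simp [dataH3, MonoList.eval, mono]

theorem candidate_dataH3 (x : Fin 3 → ℂ) {z : ℂ}
    (hz : z ^ 2 + -(x 0) ^ 2 - x 1 = 0) :
    candidate (dataH3.uPoly 1 evenTermsH3) x z
      = potentialH3 (x 0) (x 1) (x 2) z := by
  have hz' : z ^ 2 + MvPolynomial.eval (initial (m := 1) x) dataH3.vPoly - x (idxPen 1) = 0 := by
    rw [eval_vPoly_dataH3]; exact hz
  rw [isPresented_dataH3.candidate_eq hz']
  -- The displayed formula uses powers of z² where the data use x_2, so x_2 is eliminated.
  have hx : x 1 = z ^ 2 + -(x 0) ^ 2 := by linear_combination -hz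
  simp [dataH3, freeTermsH3, evenTermsH3, MonoList.eval, mono, extend, hx, potentialH3]
  ring

end WDVV

/-! ### Type D₄ -/

namespace WDVV

open MonoList Polynomial

/-- The terms of `F₀` in the potential of type D4. -/
def freeTermsD4 : MonoList := [(15, [1, 0, 0, 2]), (30, [0, 1, 1, 1])]

/-- The even part of the potential of type D4 without the terms of `F₀`. -/
def evenTermsD4 : MonoList := [(-38, [5]), (140, [3, 2]), (-40, [3, 0, 1]), (-30, [1, 4]), (-120,
  [1, 2, 1]), (-15, [1, 0, 2])]

/-- The potential of type D4. -/
def dataD4 : Data 2 where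
  wt := [1, 1, 2, 2]
  wtY := [1, 1, 1, 2]
  den := 2
  W := 5
  V := 2
  G := freeTermsD4 ++ evenTermsD4
  q := [(1, [2]), (-1, [0, 2]), (-1, [0, 0, 1])]
  γ := 16
  r := 0
  d := 30
  lam := [0, 0, 0, 0]
  v := [(1, [2]), (-1, [0, 2])]
  -- Here κ = √-1 and ζ² = -z², so x_3 = v - ζ². The sign s keeps the parametrization integral.
  s := -1
  t := 1
  steps := [(3, 27), (2, 27), (1, 130)]

theorem isSound_dataD4 : dataD4.IsSound := by
  constructor <;> decide +kernel

theorem isLinear_dataD4 : dataD4.IsLinear := by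
  unfold Data.IsLinear
  decide +kernel

theorem isPresented_dataD4 :
    dataD4.IsPresented ![1/2, 1/2, 1, 1] Complex.I freeTermsD4 evenTermsD4 where
  sound := isSound_dataD4
  weight_pos := by norm_num
  weight_mono := by
    rw [Fin.monotone_iff_le_succ]
    intro i
    fin_cases i <;> simp
    norm_num
  weight_last := rfl
  weight_eq i := by fin_cases i <;> simp [dataD4]
  den_ne_zero := by decide
  d_ne_zero := by decide
  weight_F := by decide
  G_eq := rfl
  free_G := by decide +kernel
  free_q := by decide +kernel
  free_v := by decide +kernel
  F0_eq x := by
    have : ({0, idxLast 2} : Finset (Fin (2 + 2)))ᶜ = {1, 2} := by decide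
    rw [F0, this]
    simp [freeTermsD4, dataD4, MonoList.eval, mono, extend, Fin.rev, Fin.last]
    ring
  κ_sq := by simp [dataD4]
  t_ne_zero := by decide
  q_eq y := by
    simp [dataD4, Data.param, MonoList.eval, mono]
    ring

/-- The rows of a matrix that is invertible modulo 11. -/
def cyclicRowsD4 : List (List ℤ) :=
  [[0, 0, 0, 1], [0, 0, 9, 0], [0, 7, 3, 4], [8, 1, 6, 6]]

/-- The inverse of `cyclicRowsD4` modulo 11. -/
def cyclicInverseD4 : List (List ℤ) :=
  [[6, 3, 10, 7], [1, 1, 8, 0], [0, 5, 0, 0], [1, 0, 0, 0]]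

theorem isCommuting_dataD4 :
    dataD4.IsCommuting [0, 0, 0, 0] 11 cyclicRowsD4 cyclicInverseD4 where
  sound := isSound_dataD4
  length_eq := rfl
  one_lt := by decide
  cyclic := by decide +kernel
  zero := by decide +kernel
  bounds := by decide +kernel

/-- The rows of the matrix `T` at a special point up to a factor. -/
def specialRowsD4 : List (List ℤ) :=
  [[0, 1, 0, 4], [-1, 0, -4, 0], [0, 1, 0, 1], [0, 0, -1, 0]]

/-- The images of a vector under the powers of the matrix `specialRowsD4`. -/
def krylovRowsD4 : List (List ℤ) :=
  [[0, 0, 0, 1], [0, 0, -1, 0], [0, -1, 0, -1], [1, 0, 5, 0]]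

/-- The inverse of `krylovRowsD4` modulo 5. -/
def krylovInverseD4 : List (List ℤ) :=
  [[0, 0, 0, 1], [4, 0, 4, 0], [0, 4, 0, 0], [1, 0, 0, 0]]

/-- The point is x = (0, 0, -1, 0) with ζ = 1, and the characteristic polynomial is X⁴ + 6X² - 3. -/
theorem checkSpectrum_dataD4 :
    dataD4.checkSpectrum [0, 0, 1, 0] 240 specialRowsD4 krylovRowsD4
      [-3, 0, 6, 0] 5 krylovInverseD4 = true := by
  decide +kernel

theorem squarefree_specialD4 : Squarefree (Polynomial.X ^ 4 + ∑ k : Fin 4,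
    Polynomial.C ((([-3, 0, 6, 0] : List ℤ).getD k 0 : ℤ) : ℂ) * Polynomial.X ^ (k : ℕ)) := by
  refine squarefree_of_bezout ((4) * X ^ 3 + (12) * X) ((-4) * X ^ 2 + (-16))
    (X ^ 3 + (7) * X) (D := 48) (by norm_num) ?_ ?_
  · simp [Fin.sum_univ_succ, map_ofNat]
    try ring
  · simp [Fin.sum_univ_succ]
    ring

theorem eval_vPoly_dataD4 (x : Fin 2 → ℂ) : MvPolynomial.eval x dataD4.vPoly = (x 0) ^ 2 - (x 1) ^ 2 := by
  rw [isPresented_dataD4.eval_vPoly]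
  simp [dataD4, MonoList.eval, mono]
  ring

theorem candidate_dataD4 (x : Fin 4 → ℂ) {z ζ : ℂ} (hζ : ζ = Complex.I * z)
    (hz : -(x 0) ^ 2 + (x 1) ^ 2 + x 2 + ζ ^ 2 = 0) :
    candidate (dataD4.uPoly Complex.I evenTermsD4) x z
      = potentialD4 (x 0) (x 1) (x 2) (x 3) ζ := by
  have hz' : z ^ 2 + MvPolynomial.eval (initial (m := 2) x) dataD4.vPoly - x (idxPen 2) = 0 := by
    rw [hζ, mul_pow, Complex.I_sq] at hz
    have : z ^ 2 + ((x 0) ^ 2 - (x 1) ^ 2) - x 2 = 0 := by linear_combination -hz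
    rw [eval_vPoly_dataD4]; exact this
  rw [isPresented_dataD4.candidate_eq hz']
  rw [← hζ]
  simp [dataD4, freeTermsD4, evenTermsD4, MonoList.eval, mono, extend, potentialD4]
  ring

end WDVV

/-! ### Type F₄: the polynomial potential of B₄ in the framework of branches -/

namespace WDVV

open MonoList Polynomial

/-- The terms of `F₀` in the potential of type B4. -/
def freeTermsB4 : MonoList := [(1260, [1, 0, 0, 2]), (2520, [0, 1, 1, 1])]

/-- The even part of the potential of type B4 without the terms of `F₀`. -/
def evenTermsB4 : MonoList := [(5, [9]), (252, [5, 2]), (420, [3, 3]), (420, [3, 0, 2]), (1260, [2,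
  2, 1]), (630, [1, 4]), (1260, [1, 1, 2]), (840, [0, 3, 1]), (420, [0, 0, 3])]

/-- The potential of type B4. -/
def dataB4 : Data 2 where
  -- The weights 1/4, …, 1 are written with denominator 8 so that y_m, of half the weight of x_m,
  -- has an integral weight.
  wt := [2, 4, 6, 8]
  wtY := [2, 4, 3, 8]
  den := 8
  W := 18
  V := 6
  G := freeTermsB4 ++ evenTermsB4
  q := [(1, [0, 0, 1])]
  -- The potential has no odd part. With q = x_3 and v = 0, so z² = x_3, it still fits the general
  -- form.
  γ := 0
  r := 0
  d := 2520
  lam := [0, 0, 0, 0]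
  v := []
  s := 1
  t := 1
  steps := [(3, 36), (2, 36), (1, 247)]

theorem isSound_dataB4 : dataB4.IsSound := by
  constructor <;> decide +kernel

theorem isLinear_dataB4 : dataB4.IsLinear := by
  unfold Data.IsLinear
  decide +kernel

theorem isPresented_dataB4 :
    dataB4.IsPresented ![1/4, 1/2, 3/4, 1] 1 freeTermsB4 evenTermsB4 where
  sound := isSound_dataB4
  weight_pos := by norm_num
  weight_mono := by
    rw [Fin.monotone_iff_le_succ]
    intro i
    fin_cases i <;> simp <;> norm_num
  weight_last := rfl
  weight_eq i := by fin_cases i <;> simp [dataB4] <;> norm_num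
  den_ne_zero := by decide
  d_ne_zero := by decide
  weight_F := by decide
  G_eq := rfl
  free_G := by decide +kernel
  free_q := by decide +kernel
  free_v := by decide +kernel
  F0_eq x := by
    have : ({0, idxLast 2} : Finset (Fin (2 + 2)))ᶜ = {1, 2} := by decide
    rw [F0, this]
    simp [freeTermsB4, dataB4, MonoList.eval, mono, extend, Fin.rev, Fin.last]
    ring
  κ_sq := by simp [dataB4]
  t_ne_zero := by decide
  q_eq y := by
    simp [dataB4, Data.param, MonoList.eval, mono]

/-- The rows of a matrix that is invertible modulo 11. -/
def cyclicRowsB4 : List (List ℤ) :=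
  [[0, 0, 0, 1], [0, 0, 8, 0], [0, 9, 9, 7], [6, 1, 3, 8]]

/-- The inverse of `cyclicRowsB4` modulo 11. -/
def cyclicInverseB4 : List (List ℤ) :=
  [[10, 5, 1, 2], [9, 4, 5, 0], [0, 7, 0, 0], [1, 0, 0, 0]]

theorem isCommuting_dataB4 :
    dataB4.IsCommuting [0, 0, 0, 0] 11 cyclicRowsB4 cyclicInverseB4 where
  sound := isSound_dataB4
  length_eq := rfl
  one_lt := by decide
  cyclic := by decide +kernel
  zero := by decide +kernel
  bounds := by decide +kernel

/-- The rows of the matrix `T` at a special point up to a factor. -/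
def specialRowsB4 : List (List ℤ) :=
  [[0, 0, 1, 0], [1, 0, 0, 1], [0, 1, 0, 0], [0, 0, 1, 0]]

/-- The images of a vector under the powers of the matrix `specialRowsB4`. -/
def krylovRowsB4 : List (List ℤ) :=
  [[1, 0, 0, 0], [0, 0, 1, 0], [0, 1, 0, 0], [1, 0, 0, 1]]

/-- The inverse of `krylovRowsB4` modulo 5. -/
def krylovInverseB4 : List (List ℤ) :=
  [[1, 0, 0, 0], [0, 0, 1, 0], [0, 1, 0, 0], [4, 0, 0, 1]]

theorem checkSpectrum_dataB4 :
    dataB4.checkSpectrum [0, 0, 1, 0] 60480 specialRowsB4 krylovRowsB4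
      [0, -2, 0, 0] 5 krylovInverseB4 = true := by
  decide +kernel

theorem squarefree_specialB4 : Squarefree (Polynomial.X ^ 4 + ∑ k : Fin 4,
    Polynomial.C ((([0, -2, 0, 0] : List ℤ).getD k 0 : ℤ) : ℂ) * Polynomial.X ^ (k : ℕ)) := by
  refine squarefree_of_bezout ((4) * X ^ 3 + (-2)) ((-8) * X ^ 2)
    ((2) * X ^ 3 + (-3)) (D := 6) (by norm_num) ?_ ?_
  · simp [Fin.sum_univ_succ, map_ofNat]
    try ring
  · simp [Fin.sum_univ_succ]
    ring

theorem candidate_dataB4 (x : Fin 4 → ℂ) {z : ℂ}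
    (hz : z ^ 2 + MvPolynomial.eval (initial (m := 2) x) dataB4.vPoly - x 2 = 0) :
    candidate (dataB4.uPoly 1 evenTermsB4) x z
      = potentialB4 (x 0) (x 1) (x 2) (x 3) := by
  have hz' : z ^ 2 + MvPolynomial.eval (initial (m := 2) x) dataB4.vPoly - x (idxPen 2) = 0 := hz
  rw [isPresented_dataB4.candidate_eq hz']
  simp [dataB4, freeTermsB4, evenTermsB4, MonoList.eval, mono, extend, potentialB4]
  ring

end WDVV

/-! ### Type H₄ -/

namespace WDVV

open MonoList Polynomial

/-- The terms of `F₀` in the potential of type H4. -/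
def freeTermsH4 : MonoList := [(65835, [1, 0, 0, 2]), (131670, [0, 1, 1, 1])]

/-- The even part of the potential of type H4 without the terms of `F₀`. -/
def evenTermsH4 : MonoList := [(664488, [21]), (1685376, [16, 1]), (-140448, [15, 0, 1]), (5649840,
  [11, 2]), (1053360, [10, 1, 1]), (138985, [9, 0, 2]), (702240, [6, 3]), (4213440, [5, 2, 1]),
  (-131670, [4, 1, 2]), (21945, [3, 0, 3]), (3686760, [1, 4]), (-351120, [0, 3, 1])]

/-- The potential of type H4. -/
def dataH4 : Data 2 where
  wt := [1, 5, 6, 10]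
  wtY := [1, 5, 3, 10]
  den := 10
  W := 21
  V := 6
  G := freeTermsH4 ++ evenTermsH4
  q := [(4, [6]), (-12, [1, 1]), (1, [0, 0, 1])]
  γ := 1254
  r := 2
  d := 131670
  lam := [0, 0, 0, 0]
  v := [(-4, [6]), (12, [1, 1])]
  s := 1
  t := 1
  steps := [(3, 63), (2, 63), (1, 547)]

theorem isSound_dataH4 : dataH4.IsSound := by
  constructor <;> decide +kernel

theorem isLinear_dataH4 : dataH4.IsLinear := by
  unfold Data.IsLinear
  decide +kernel

theorem isPresented_dataH4 :
    dataH4.IsPresented ![1/10, 1/2, 3/5, 1] 1 freeTermsH4 evenTermsH4 where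
  sound := isSound_dataH4
  weight_pos := by norm_num
  weight_mono := by
    rw [Fin.monotone_iff_le_succ]
    intro i
    fin_cases i <;> simp <;> norm_num
  weight_last := rfl
  weight_eq i := by fin_cases i <;> simp [dataH4] <;> norm_num
  den_ne_zero := by decide
  d_ne_zero := by decide
  weight_F := by decide
  G_eq := rfl
  free_G := by decide +kernel
  free_q := by decide +kernel
  free_v := by decide +kernel
  F0_eq x := by
    have : ({0, idxLast 2} : Finset (Fin (2 + 2)))ᶜ = {1, 2} := by decide
    rw [F0, this]
    simp [freeTermsH4, dataH4, MonoList.eval, mono, extend, Fin.rev, Fin.last]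
    ring
  κ_sq := by simp [dataH4]
  t_ne_zero := by decide
  q_eq y := by
    simp [dataH4, Data.param, MonoList.eval, mono]
    ring

/-- The rows of a matrix that is invertible modulo 13. -/
def cyclicRowsH4 : List (List ℤ) :=
  [[0, 0, 0, 1], [0, 0, 9, 0], [0, 5, 9, 8], [6, 10, 9, 3]]

/-- The inverse of `cyclicRowsH4` modulo 13. -/
def cyclicInverseH4 : List (List ℤ) :=
  [[0, 11, 4, 11], [1, 5, 8, 0], [0, 3, 0, 0], [1, 0, 0, 0]]

theorem isCommuting_dataH4 :
    dataH4.IsCommuting [0, 0, 0, 0] 13 cyclicRowsH4 cyclicInverseH4 where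
  sound := isSound_dataH4
  length_eq := rfl
  one_lt := by decide
  cyclic := by decide +kernel
  zero := by decide +kernel
  bounds := by decide +kernel

/-- The rows of the matrix `T` at a special point up to a factor. -/
def specialRowsH4 : List (List ℤ) :=
  [[0, 0, -8, 0], [8, 0, 0, -8], [0, 1, 0, 0], [0, 0, 8, 0]]

/-- The images of a vector under the powers of the matrix `specialRowsH4`. -/
def krylovRowsH4 : List (List ℤ) :=
  [[0, 0, 0, 1], [0, 0, 8, 0], [0, 8, 0, 0], [64, 0, 0, -64]]

/-- The inverse of `krylovRowsH4` modulo 5. -/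
def krylovInverseH4 : List (List ℤ) :=
  [[1, 0, 0, 4], [0, 0, 2, 0], [0, 2, 0, 0], [1, 0, 0, 0]]

/-- With x_3 = ζ = 1 and all other coordinates 0 the matrix is sparse; its characteristic polynomial
is X⁴ + 128X. -/
theorem checkSpectrum_dataH4 :
    dataH4.checkSpectrum [0, 0, 1, 0] 395010 specialRowsH4 krylovRowsH4
      [0, 128, 0, 0] 5 krylovInverseH4 = true := by
  decide +kernel

theorem squarefree_specialH4 : Squarefree (Polynomial.X ^ 4 + ∑ k : Fin 4,
    Polynomial.C ((([0, 128, 0, 0] : List ℤ).getD k 0 : ℤ) : ℂ) * Polynomial.X ^ (k : ℕ)) := by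
  refine squarefree_of_bezout ((4) * X ^ 3 + (128)) ((-4) * X ^ 2)
    (X ^ 3 + (96)) (D := 12288) (by norm_num) ?_ ?_
  · simp [Fin.sum_univ_succ, map_ofNat]
    try ring
  · simp [Fin.sum_univ_succ]
    ring

theorem eval_vPoly_dataH4 (x : Fin 2 → ℂ) : MvPolynomial.eval x dataH4.vPoly = vH4 (x 0) (x 1) := by
  rw [isPresented_dataH4.eval_vPoly]
  simp [dataH4, MonoList.eval, mono, vH4]
  ring

theorem candidate_dataH4 (x : Fin 4 → ℂ) {z : ℂ}
    (hz : z ^ 2 + vH4 (x 0) (x 1) - x 2 = 0) :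
    candidate (dataH4.uPoly 1 evenTermsH4) x z
      = potentialH4 (x 0) (x 1) (x 2) (x 3) z := by
  have hz' : z ^ 2 + MvPolynomial.eval (initial (m := 2) x) dataH4.vPoly - x (idxPen 2) = 0 := by
    rw [eval_vPoly_dataH4]; exact hz
  rw [isPresented_dataH4.candidate_eq hz']
  have hx : x 2 = z ^ 2 + vH4 (x 0) (x 1) := by linear_combination -hz
  simp [dataH4, freeTermsH4, evenTermsH4, MonoList.eval, mono, extend, hx, potentialH4, vH4]
  ring

end WDVV

/-! ### Type E₆ -/

namespace WDVV

open MonoList Polynomial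

/-- The terms of `F₀` in the potential of type E6. -/
def freeTermsE6 : MonoList := [(420, [1, 0, 0, 0, 0, 2]), (840, [0, 1, 0, 0, 1, 1]), (840, [0, 0, 1,
  1, 0, 1])]

/-- The even part of the potential of type E6 without the terms of `F₀`. -/
def evenTermsE6 : MonoList := [(353808, [10]), (972000, [7, 2]), (45360, [7, 0, 0, 1]), (45360, [6,
  1, 1]), (-22680, [6, 0, 0, 0, 1]), (108864, [5, 0, 2]), (292320, [4, 4]), (-151200, [4, 2, 0, 1]),
  (22680, [4, 0, 0, 2]), (-70560, [3, 3, 1]), (75600, [3, 2, 0, 0, 1]), (105840, [3, 1, 1, 1]),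
  (7560, [3, 0, 0, 1, 1]), (22680, [2, 2, 2]), (-22680, [2, 1, 1, 0, 1]), (15120, [2, 0, 2, 1]),
  (1890, [2, 0, 0, 0, 2]), (29120, [1, 6]), (-16800, [1, 4, 0, 1]), (8400, [1, 2, 0, 2]), (5040, [1,
  1, 3]), (3780, [1, 0, 2, 0, 1]), (1400, [1, 0, 0, 3]), (-7392, [0, 5, 1]), (5040, [0, 4, 0, 0,
  1]), (3360, [0, 3, 1, 1]), (-3360, [0, 2, 0, 1, 1]), (840, [0, 1, 1, 2]), (315, [0, 0, 4]), (420,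
  [0, 0, 0, 2, 1])]

/-- The potential of type E6. -/
def dataE6 : Data 4 where
  wt := [2, 3, 5, 6, 8, 9]
  wtY := [2, 3, 5, 6, 4, 9]
  den := 9
  W := 20
  V := 8
  G := freeTermsE6 ++ evenTermsE6
  q := [(9, [4]), (12, [1, 2]), (-2, [1, 0, 0, 1]), (-2, [0, 1, 1]), (1, [0, 0, 0, 0, 1])]
  γ := 336
  r := 0
  d := 840
  lam := [0, 0, 0, 0, 0, 0]
  v := [(-9, [4]), (-12, [1, 2]), (2, [1, 0, 0, 1]), (2, [0, 1, 1])]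
  s := 1
  t := 1
  -- Each power of two exceeds twice the bound for the commutator entries at the point given by the
  -- preceding steps.
  steps := [(5, 51), (1, 51), (4, 351), (3, 1792), (2, 5760)]

theorem isSound_dataE6 : dataE6.IsSound := by
  constructor <;> decide +kernel

theorem isLinear_dataE6 : dataE6.IsLinear := by
  unfold Data.IsLinear
  decide +kernel

theorem isPresented_dataE6 :
    dataE6.IsPresented ![2/9, 1/3, 5/9, 2/3, 8/9, 1] 1 freeTermsE6 evenTermsE6 where
  sound := isSound_dataE6
  weight_pos := by norm_num
  weight_mono := by
    rw [Fin.monotone_iff_le_succ]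
    intro i
    fin_cases i <;> simp <;> norm_num
  weight_last := rfl
  weight_eq i := by fin_cases i <;> simp [dataE6] <;> norm_num
  den_ne_zero := by decide
  d_ne_zero := by decide
  weight_F := by decide
  G_eq := rfl
  free_G := by decide +kernel
  free_q := by decide +kernel
  free_v := by decide +kernel
  F0_eq x := by
    have : ({0, idxLast 4} : Finset (Fin (4 + 2)))ᶜ = {1, 2, 3, 4} := by decide
    rw [F0, this]
    simp [freeTermsE6, dataE6, MonoList.eval, mono, extend, Fin.rev, Fin.last]
    ring
  κ_sq := by simp [dataE6]
  t_ne_zero := by decide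
  q_eq y := by
    simp [dataE6, Data.param, MonoList.eval, mono]
    ring

/-- The rows of a matrix that is invertible modulo 13. -/
def cyclicRowsE6 : List (List ℤ) :=
  [[0, 0, 0, 0, 0, 1], [0, 0, 0, 0, 12, 0], [0, 4, 5, 5, 10, 11], [9, 0, 1, 10, 8, 7], [0, 9, 10, 8,
    11, 5], [4, 10, 5, 4, 9, 3]]

/-- The inverse of `cyclicRowsE6` modulo 13. -/
def cyclicInverseE6 : List (List ℤ) :=
  [[4, 3, 3, 9, 5, 6], [10, 2, 12, 10, 1, 10], [5, 4, 7, 0, 7, 0], [3, 12, 7, 5, 0, 5], [0, 12, 0,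
    0, 0, 0], [1, 0, 0, 0, 0, 0]]

theorem isCommuting_dataE6 :
    dataE6.IsCommuting [0, 0, 0, 0, 0, 0] 13 cyclicRowsE6 cyclicInverseE6 where
  sound := isSound_dataE6
  length_eq := rfl
  one_lt := by decide
  cyclic := by decide +kernel
  zero := by decide +kernel
  bounds := by decide +kernel

/-- The rows of the matrix `T` at a special point up to a factor. -/
def specialRowsE6 : List (List ℤ) :=
  [[0, 9, 0, 0, 18, 0], [0, 0, 0, 0, 0, 18], [0, 0, 0, 9, 0, 0], [1, 0, 0, 0, 0, 0], [0, 0, 0, 0, 0,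
    9], [0, 0, 1, 0, 0, 0]]

/-- The images of a vector under the powers of the matrix `specialRowsE6`. -/
def krylovRowsE6 : List (List ℤ) :=
  [[0, 0, 0, 0, 1, 0], [0, 0, 0, 0, 0, 9], [0, 0, 9, 0, 0, 0], [0, 0, 0, 81, 0, 0], [81, 0, 0, 0, 0,
    0], [0, 729, 0, 0, 1458, 0]]

/-- The inverse of `krylovRowsE6` modulo 5. -/
def krylovInverseE6 : List (List ℤ) :=
  [[0, 0, 0, 0, 1, 0], [3, 0, 0, 0, 0, 4], [0, 0, 4, 0, 0, 0], [0, 0, 0, 1, 0, 0], [1, 0, 0, 0, 0,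
    0], [0, 4, 0, 0, 0, 0]]

/-- Only x_3 = 1 is nonzero, so the point lies on the branch locus z = 0. The characteristic
polynomial is X⁶ - 2916X. -/
theorem checkSpectrum_dataE6 :
    dataE6.checkSpectrum [0, 0, 1, 0, 0, 0] 16800 specialRowsE6 krylovRowsE6
      [0, -2916, 0, 0, 0, 0] 5 krylovInverseE6 = true := by
  decide +kernel

theorem squarefree_specialE6 : Squarefree (Polynomial.X ^ 6 + ∑ k : Fin 6,
    Polynomial.C ((([0, -2916, 0, 0, 0, 0] : List ℤ).getD k 0 : ℤ) : ℂ) * Polynomial.X ^ (k : ℕ)) := by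
  refine squarefree_of_bezout ((6) * X ^ 5 + (-2916)) ((-6) * X ^ 4)
    (X ^ 5 + (-2430)) (D := 7085880) (by norm_num) ?_ ?_
  · simp [Fin.sum_univ_succ, map_ofNat]
    try ring
  · simp [Fin.sum_univ_succ]
    ring

theorem eval_vPoly_dataE6 (x : Fin 4 → ℂ) : MvPolynomial.eval x dataE6.vPoly = vE6 (x 0) (x 1) (x 2) (x 3) := by
  rw [isPresented_dataE6.eval_vPoly]
  simp [dataE6, MonoList.eval, mono, vE6]
  ring

theorem candidate_dataE6 (x : Fin 6 → ℂ) {z : ℂ}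
    (hz : z ^ 2 + vE6 (x 0) (x 1) (x 2) (x 3) - x 4 = 0) :
    candidate (dataE6.uPoly 1 evenTermsE6) x z
      = potentialE6 (x 0) (x 1) (x 2) (x 3) (x 4) (x 5) z := by
  have hz' : z ^ 2 + MvPolynomial.eval (initial (m := 4) x) dataE6.vPoly - x (idxPen 4) = 0 := by
    rw [eval_vPoly_dataE6]; exact hz
  rw [isPresented_dataE6.candidate_eq hz']
  simp [dataE6, freeTermsE6, evenTermsE6, MonoList.eval, mono, extend, potentialE6]
  ring

end WDVV

/-! ### Type E₇ -/

namespace WDVV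

open MonoList Polynomial

/-- The terms of `F₀` in the potential of type E7. -/
def freeTermsE7 : MonoList := [(72102030, [1, 0, 0, 0, 0, 0, 2]), (144204060, [0, 1, 0, 0, 0, 1,
  1]), (144204060, [0, 0, 1, 0, 1, 0, 1]), (72102030, [0, 0, 0, 2, 0, 0, 1])]

/-- The even part of the potential of type E7 without the terms of `F₀`. -/
def evenTermsE7 : MonoList := [(519979502592, [15]), (-213586813440, [13, 1]), (71195604480, [12, 0,
  1]), (4860255778560, [11, 2]), (-35597802240, [11, 0, 0, 1]), (-391575824640, [10, 1, 1]),
  (-5932967040, [10, 0, 0, 0, 1]), (4461591214080, [9, 3]), (-94927472640, [9, 1, 0, 1]),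
  (1893464052480, [9, 0, 2]), (-5932967040, [9, 0, 0, 0, 0, 1]), (-35597802240, [8, 2, 1]),
  (-8899450560, [8, 1, 0, 0, 1]), (17798901120, [8, 0, 1, 1]), (8690313471840, [7, 4]),
  (436073077440, [7, 2, 0, 1]), (-2385052750080, [7, 1, 2]), (-8899450560, [7, 1, 0, 0, 0, 1]),
  (2966483520, [7, 0, 1, 0, 1]), (30421591200, [7, 0, 0, 2]), (2761796157120, [6, 3, 1]),
  (83061538560, [6, 2, 0, 0, 1]), (759419781120, [6, 1, 1, 1]), (876101466240, [6, 0, 3]),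
  (2966483520, [6, 0, 1, 0, 0, 1]), (-1483241760, [6, 0, 0, 1, 1]), (7275152508624, [5, 5]),
  (695640385440, [5, 3, 0, 1]), (2626821156960, [5, 2, 2]), (83061538560, [5, 2, 0, 0, 0, 1]),
  (51913461600, [5, 1, 1, 0, 1]), (58588049520, [5, 1, 0, 2]), (-225452747520, [5, 0, 2, 1]),
  (-1483241760, [5, 0, 0, 1, 0, 1]), (554449896, [5, 0, 0, 0, 2]), (3452245196400, [4, 4, 1]),
  (60565705200, [4, 3, 0, 0, 1]), (249184615680, [4, 2, 1, 1]), (-1010582052480, [4, 1, 3]),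
  (51913461600, [4, 1, 1, 0, 0, 1]), (9393864480, [4, 1, 0, 1, 1]), (33620146560, [4, 0, 2, 0, 1]),
  (741620880, [4, 0, 1, 2]), (-247206960, [4, 0, 0, 0, 1, 1]), (5511479173200, [3, 6]),
  (732845032920, [3, 4, 0, 1]), (593543910960, [3, 3, 2]), (60565705200, [3, 3, 0, 0, 0, 1]),
  (22495833360, [3, 2, 1, 0, 1]), (64026602640, [3, 2, 0, 2]), (38069871840, [3, 1, 2, 1]),
  (3460897440, [3, 1, 0, 1, 0, 1]), (-556215660, [3, 1, 0, 0, 2]), (437226709920, [3, 0, 4]),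
  (6921794880, [3, 0, 2, 0, 0, 1]), (-5685760080, [3, 0, 1, 1, 1]), (-2101259160, [3, 0, 0, 3]),
  (158918760, [3, 0, 0, 0, 0, 2]), (3518867472120, [2, 5, 1]), (51480849420, [2, 4, 0, 0, 1]),
  (351281090160, [2, 3, 1, 1]), (286677671280, [2, 2, 3]), (12113141040, [2, 2, 1, 0, 0, 1]),
  (6921794880, [2, 2, 0, 1, 1]), (-22495833360, [2, 1, 2, 0, 1]), (-21630609000, [2, 1, 1, 2]),
  (-123603480, [2, 1, 0, 0, 1, 1]), (-78447008640, [2, 0, 3, 1]), (3213690480, [2, 0, 1, 1, 0, 1]),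
  (515014500, [2, 0, 1, 0, 2]), (-61801740, [2, 0, 0, 2, 1]), (784325882340, [1, 7]), (254375961840,
  [1, 5, 0, 1]), (932711860080, [1, 4, 2]), (42395993640, [1, 4, 0, 0, 0, 1]), (20188568400, [1, 3,
  1, 0, 1]), (21197996820, [1, 3, 0, 2]), (6056570520, [1, 2, 2, 1]), (5191346160, [1, 2, 0, 1, 0,
  1]), (360510150, [1, 2, 0, 0, 2]), (-117093696720, [1, 1, 4]), (-1730448720, [1, 1, 2, 0, 0, 1]),
  (2884081200, [1, 1, 1, 1, 1]), (-865224360, [1, 1, 0, 3]), (185405220, [1, 1, 0, 0, 0, 2]),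
  (7690883200, [1, 0, 3, 0, 1]), (7787019240, [1, 0, 2, 2]), (-206005800, [1, 0, 1, 0, 1, 1]),
  (185405220, [1, 0, 0, 2, 0, 1]), (-51501450, [1, 0, 0, 1, 2]), (148385977740, [0, 6, 1]),
  (1413199788, [0, 5, 0, 0, 1]), (56527991520, [0, 4, 1, 1]), (80081321320, [0, 3, 3]),
  (12113141040, [0, 3, 1, 0, 0, 1]), (1009428420, [0, 3, 0, 1, 1]), (3028285260, [0, 2, 2, 0, 1]),
  (1009428420, [0, 2, 1, 2]), (288408120, [0, 2, 0, 0, 1, 1]), (17496759280, [0, 1, 3, 1]),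
  (1153632480, [0, 1, 1, 1, 0, 1]), (-72102030, [0, 1, 1, 0, 2]), (-72102030, [0, 1, 0, 2, 1]),
  (14266588336, [0, 0, 5]), (-961360400, [0, 0, 3, 0, 0, 1]), (-865224360, [0, 0, 2, 1, 1]),
  (144204060, [0, 0, 1, 3]), (20600580, [0, 0, 1, 0, 0, 2]), (20600580, [0, 0, 0, 1, 1, 1]),
  (1716715, [0, 0, 0, 0, 3])]

/-- The potential of type E7. -/
def dataE7 : Data 5 where
  wt := [1, 2, 3, 4, 5, 6, 7]
  wtY := [1, 2, 3, 4, 5, 3, 7]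
  den := 7
  W := 15
  V := 6
  G := freeTermsE7 ++ evenTermsE7
  q := [(36, [6]), (36, [4, 1]), (-12, [3, 0, 1]), (231, [2, 2]), (6, [2, 0, 0, 1]), (84, [1, 1,
    1]), (1, [1, 0, 0, 0, 1]), (49, [0, 3]), (7, [0, 1, 0, 1]), (7, [0, 0, 2]), (1, [0, 0,
    0, 0, 0, 1])]
  γ := 10986976
  r := 0
  d := 144204060
  lam := [0, 0, 0, 0, 0, 0, 0]
  v := [(-36, [6]), (-36, [4, 1]), (12, [3, 0, 1]), (-231, [2, 2]), (-6, [2, 0, 0, 1]), (-84, [1,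
    1, 1]), (-1, [1, 0, 0, 0, 1]), (-49, [0, 3]), (-7, [0, 1, 0, 1]), (-7, [0, 0, 2])]
  s := 1
  t := 1
  steps := [(6, 98), (5, 98), (1, 654), (3, 5322), (4, 21359), (2, 64237)]

theorem isSound_dataE7 : dataE7.IsSound := by
  constructor <;> decide +kernel

theorem isLinear_dataE7 : dataE7.IsLinear := by
  unfold Data.IsLinear
  decide +kernel

theorem isPresented_dataE7 :
    dataE7.IsPresented ![1/7, 2/7, 3/7, 4/7, 5/7, 6/7, 1] 1 freeTermsE7 evenTermsE7 where
  sound := isSound_dataE7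
  weight_pos := by norm_num
  weight_mono := by
    rw [Fin.monotone_iff_le_succ]
    intro i
    fin_cases i <;> simp <;> norm_num
  weight_last := rfl
  weight_eq i := by fin_cases i <;> simp [dataE7]
  den_ne_zero := by decide
  d_ne_zero := by decide
  weight_F := by decide
  G_eq := rfl
  free_G := by decide +kernel
  free_q := by decide +kernel
  free_v := by decide +kernel
  F0_eq x := by
    have : ({0, idxLast 5} : Finset (Fin (5 + 2)))ᶜ = {1, 2, 3, 4, 5} := by decide
    rw [F0, this]
    simp [freeTermsE7, dataE7, MonoList.eval, mono, extend, Fin.rev, Fin.last]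
    ring
  κ_sq := by simp [dataE7]
  t_ne_zero := by decide
  q_eq y := by
    simp [dataE7, Data.param, MonoList.eval, mono]
    ring

/-- The rows of a matrix that is invertible modulo 17. -/
def cyclicRowsE7 : List (List ℤ) :=
  [[0, 0, 0, 0, 0, 0, 1], [0, 0, 0, 0, 0, 2, 0], [0, 3, 3, 5, 9, 1, 15], [6, 0, 14, 16, 5, 4, 12],
    [0, 0, 7, 15, 13, 2, 2], [0, 15, 5, 14, 13, 15, 3], [13, 5, 9, 2, 7, 9, 16]]

/-- The inverse of `cyclicRowsE7` modulo 17. -/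
def cyclicInverseE7 : List (List ℤ) :=
  [[10, 8, 1, 0, 2, 3, 4], [2, 2, 4, 5, 2, 3, 16], [2, 15, 2, 15, 14, 4, 14], [10, 15, 5, 11, 3, 2,
    8], [16, 2, 1, 8, 10, 6, 12], [0, 9, 0, 0, 0, 0, 0], [1, 0, 0, 0, 0, 0, 0]]

theorem isCommuting_dataE7 :
    dataE7.IsCommuting [0, 0, 0, 0, 0, 0, 0] 17 cyclicRowsE7 cyclicInverseE7 where
  sound := isSound_dataE7
  length_eq := rfl
  one_lt := by decide
  cyclic := by decide +kernel
  zero := by decide +kernel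
  bounds := by decide +kernel

/-- The rows of the matrix `T` at a special point up to a factor. -/
def specialRowsE7 : List (List ℤ) :=
  [[0, 0, 2, 0, 0, 18, 0], [7, 0, 0, 14, 0, 0, 18], [0, 2, 0, 0, 28, 0, 0], [0, 0, 1, 0, 0, 14, 0],
    [0, 0, 0, 1, 0, 0, 2], [0, 1, 0, 0, 2, 0, 0], [0, 0, 0, 0, 0, 7, 0]]

/-- The images of a vector under the powers of the matrix `specialRowsE7`. -/
def krylovRowsE7 : List (List ℤ) :=
  [[0, 0, 0, 0, 0, 0, 1], [0, 0, 0, 0, 0, 7, 0], [0, 7, 0, 0, 14, 0, 0], [49, 0, 0, 112, 0, 0, 154],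
    [0, 0, 210, 0, 0, 3528, 0], [0, 3948, 0, 0, 12936, 0, 0], [27636, 0, 0, 68208, 0, 0, 96936]]

/-- The inverse of `krylovRowsE7` modulo 11. -/
def krylovInverseE7 : List (List ℤ) :=
  [[3, 0, 0, 3, 0, 0, 2], [0, 0, 0, 0, 0, 10, 0], [0, 2, 0, 0, 1, 0, 0], [9, 0, 0, 4, 0, 0, 6], [0,
    0, 4, 0, 0, 6, 0], [0, 8, 0, 0, 0, 0, 0], [1, 0, 0, 0, 0, 0, 0]]

/-- At x_6 = ζ = 1 and zero otherwise the characteristic polynomial is X (X⁶ - 588X³ - 8064). -/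
theorem checkSpectrum_dataE7 :
    dataE7.checkSpectrum [0, 0, 0, 0, 0, 1, 0] 494413920 specialRowsE7 krylovRowsE7
      [0, -8064, 0, 0, -588, 0, 0] 11 krylovInverseE7 = true := by
  decide +kernel

theorem squarefree_specialE7 : Squarefree (Polynomial.X ^ 7 + ∑ k : Fin 7,
    Polynomial.C ((([0, -8064, 0, 0, -588, 0, 0] : List ℤ).getD k 0 : ℤ) : ℂ) * Polynomial.X ^ (k : ℕ)) := by
  refine squarefree_of_bezout ((7) * X ^ 6 + (-2352) * X ^ 3 + (-8064)) ((-371) * X ^ 5 + (125832) * X ^ 2)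
    ((53) * X ^ 6 + (-31332) * X ^ 3 + (-324000)) (D := 2612736000) (by norm_num) ?_ ?_
  · simp [Fin.sum_univ_succ, map_ofNat]
    try ring
  · simp [Fin.sum_univ_succ]
    ring

theorem eval_vPoly_dataE7 (x : Fin 5 → ℂ) : MvPolynomial.eval x dataE7.vPoly = vE7 (x 0) (x 1) (x 2) (x 3) (x 4) := by
  rw [isPresented_dataE7.eval_vPoly]
  simp [dataE7, MonoList.eval, mono, vE7]
  ring

theorem candidate_dataE7 (x : Fin 7 → ℂ) {z : ℂ}
    (hz : z ^ 2 + vE7 (x 0) (x 1) (x 2) (x 3) (x 4) - x 5 = 0) :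
    candidate (dataE7.uPoly 1 evenTermsE7) x z
      = potentialE7 (x 0) (x 1) (x 2) (x 3) (x 4) (x 5) (x 6) z := by
  have hz' : z ^ 2 + MvPolynomial.eval (initial (m := 5) x) dataE7.vPoly - x (idxPen 5) = 0 := by
    rw [eval_vPoly_dataE7]; exact hz
  rw [isPresented_dataE7.candidate_eq hz']
  simp [dataE7, freeTermsE7, evenTermsE7, MonoList.eval, mono, extend, potentialE7, partE7a, partE7b, partE7c]
  ring

end WDVV

/-! ### Type E₈ -/

namespace WDVV

open MonoList Polynomial

/-- The terms of `F₀` in the potential of type E8. -/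
def freeTermsE8 : MonoList := [(142779436800, [1, 0, 0, 0, 0, 0, 0, 2]), (285558873600, [0, 1, 0, 0,
  0, 0, 1, 1]), (285558873600, [0, 0, 1, 0, 0, 1, 0, 1]), (285558873600, [0, 0, 0, 1, 1, 0, 0, 1])]

/-- The even part of the potential of type E8 without the terms of `F₀`. -/
def evenTermsE8 : MonoList := [(152789840203, [25]), (237965728000, [22, 1]), (23796572800, [21, 0,
  1]), (13884360890400, [19, 2]), (95186291200, [19, 0, 0, 1]), (773388616000, [18, 1, 1]),
  (-47593145600, [18, 0, 0, 0, 1]), (1641701061000, [17, 0, 2]), (-58301603360000, [16, 3]),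
  (-1856132678400, [16, 1, 0, 1]), (95186291200, [16, 0, 0, 0, 0, 1]), (14813366568000, [15, 2, 1]),
  (452134883200, [15, 1, 0, 0, 1]), (23796572800, [15, 0, 1, 1]), (-47593145600, [15, 0, 0, 0, 0, 0,
  1]), (9601917124800, [14, 1, 2]), (35694859200, [14, 0, 1, 0, 1]), (354069206691200, [13, 4]),
  (-5425618598400, [13, 2, 0, 1]), (-713897184000, [13, 1, 0, 0, 0, 1]), (1680632954000, [13, 0,
  3]), (5862194184000, [13, 0, 0, 2]), (-72912699059200, [12, 3, 1]), (6282295219200, [12, 2, 0, 0,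
  1]), (23487217353600, [12, 1, 1, 1]), (356948592000, [12, 1, 0, 0, 0, 0, 1]), (-71389718400, [12,
  0, 1, 0, 0, 1]), (142779436800, [12, 0, 0, 1, 1]), (42833831040000, [11, 2, 2]), (-3069757891200,
  [11, 1, 1, 0, 1]), (6657091240800, [11, 0, 2, 1]), (35694859200, [11, 0, 1, 0, 0, 0, 1]),
  (161438113200, [11, 0, 0, 0, 2]), (-1211683412459520, [10, 5]), (164386724902400, [10, 3, 0, 1]),
  (-13992384806400, [10, 2, 0, 0, 0, 1]), (9417493685600, [10, 1, 3]), (-13564046496000, [10, 1, 0,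
  2]), (972684913200, [10, 0, 2, 0, 1]), (-285558873600, [10, 0, 0, 1, 0, 1]), (513768006752000, [9,
  4, 1]), (-35361707180800, [9, 3, 0, 0, 1]), (-34124285395200, [9, 2, 1, 1]), (6996192403200, [9,
  2, 0, 0, 0, 0, 1]), (5996736345600, [9, 1, 1, 0, 0, 1]), (14991840864000, [9, 1, 0, 1, 1]),
  (2318678562200, [9, 0, 4]), (8423986771200, [9, 0, 1, 2]), (142779436800, [9, 0, 0, 1, 0, 0, 1]),
  (142779436800, [9, 0, 0, 0, 1, 1]), (-66535217548800, [8, 3, 2]), (14777671708800, [8, 2, 1, 0,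
  1]), (30626189193600, [8, 1, 2, 1]), (-2998368172800, [8, 1, 1, 0, 0, 0, 1]), (-249864014400, [8,
  1, 0, 0, 2]), (-499728028800, [8, 0, 2, 0, 0, 1]), (2998368172800, [8, 0, 1, 1, 1]),
  (-71389718400, [8, 0, 0, 0, 1, 0, 1]), (3060239262080000, [7, 6]), (-711327154137600, [7, 4, 0,
  1]), (55588794060800, [7, 3, 0, 0, 0, 1]), (26985313555200, [7, 2, 3]), (126217022131200, [7, 2,
  0, 2]), (3676570497600, [7, 1, 2, 0, 1]), (-7424530713600, [7, 1, 0, 1, 0, 1]), (7579208436800,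
  [7, 0, 3, 1]), (249864014400, [7, 0, 2, 0, 0, 0, 1]), (249864014400, [7, 0, 1, 0, 2]),
  (7757682732800, [7, 0, 0, 3]), (683301590400, [7, 0, 0, 0, 0, 2]), (-1601128604275200, [6, 5, 1]),
  (126550174150400, [6, 4, 0, 0, 1]), (328011959475200, [6, 3, 1, 1]), (-27794397030400, [6, 3, 0,
  0, 0, 0, 1]), (-13706825932800, [6, 2, 1, 0, 0, 1]), (-27413651865600, [6, 2, 0, 1, 1]),
  (5651686040000, [6, 1, 4]), (43833287097600, [6, 1, 1, 2]), (3712265356800, [6, 1, 0, 1, 0, 0,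
  1]), (1285014931200, [6, 1, 0, 0, 1, 1]), (779337759200, [6, 0, 3, 0, 1]), (5568398035200, [6, 0,
  1, 1, 0, 1]), (-71389718400, [6, 0, 0, 2, 1]), (142779436800, [6, 0, 0, 0, 0, 1, 1]),
  (390787318521600, [5, 4, 2]), (-41977154419200, [5, 3, 1, 0, 1]), (2570029862400, [5, 2, 2, 1]),
  (6853412966400, [5, 2, 1, 0, 0, 0, 1]), (3640875638400, [5, 2, 0, 0, 2]), (1285014931200, [5, 1,
  2, 0, 0, 1]), (9423442828800, [5, 1, 1, 1, 1]), (747807300240, [5, 0, 5]), (13920995088000, [5, 0,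
  2, 2]), (-856676620800, [5, 0, 1, 1, 0, 0, 1]), (928066339200, [5, 0, 1, 0, 1, 1]), (678202324800,
  [5, 0, 0, 1, 2]), (60681260640, [5, 0, 0, 0, 0, 0, 2]), (-2488550397132800, [4, 7]),
  (1415229777561600, [4, 5, 0, 1]), (-134212670592000, [4, 4, 0, 0, 0, 1]), (-38074516480000, [4, 3,
  3]), (-182757679104000, [4, 3, 0, 2]), (8566766208000, [4, 2, 2, 0, 1]), (34838182579200, [4, 2,
  0, 1, 0, 1]), (18561326784000, [4, 1, 3, 1]), (464033169600, [4, 1, 1, 0, 2]), (-6091922636800,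
  [4, 1, 0, 3]), (2284470988800, [4, 1, 0, 0, 0, 2]), (690100611200, [4, 0, 3, 0, 0, 1]),
  (3640875638400, [4, 0, 2, 1, 1]), (178474296000, [4, 0, 1, 0, 1, 0, 1]), (3997824230400, [4, 0, 0,
  2, 0, 1]), (-5949143200, [4, 0, 0, 0, 3]), (1015828099686400, [3, 6, 1]), (-129072610867200, [3,
  5, 0, 0, 1]), (-542561859840000, [3, 4, 1, 1]), (62822952192000, [3, 4, 0, 0, 0, 0, 1]),
  (46260537523200, [3, 3, 1, 0, 0, 1]), (56540656972800, [3, 3, 0, 1, 1]), (6603548952000, [3, 2,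
  4]), (54256185984000, [3, 2, 1, 2]), (-12279031564800, [3, 2, 0, 1, 0, 0, 1]), (-4283383104000,
  [3, 2, 0, 0, 1, 1]), (975659484800, [3, 1, 3, 0, 1]), (5140059724800, [3, 1, 1, 1, 0, 1]),
  (9709001702400, [3, 1, 0, 2, 1]), (285558873600, [3, 1, 0, 0, 0, 1, 1]), (2278521845600, [3, 0, 4,
  1]), (-23796572800, [3, 0, 3, 0, 0, 0, 1]), (285558873600, [3, 0, 2, 0, 2]), (8186021043200, [3,
  0, 1, 3]), (999456057600, [3, 0, 1, 0, 0, 2]), (1856132678400, [3, 0, 0, 2, 0, 0, 1]),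
  (1142235494400, [3, 0, 0, 1, 1, 1]), (-140494965811200, [2, 5, 2]), (35409300326400, [2, 4, 1, 0,
  1]), (86238779827200, [2, 3, 2, 1]), (-19703562278400, [2, 3, 1, 0, 0, 0, 1]), (-2570029862400,
  [2, 3, 0, 0, 2]), (-4283383104000, [2, 2, 2, 0, 0, 1]), (-856676620800, [2, 2, 1, 1, 1]),
  (2141691552000, [2, 2, 0, 0, 1, 0, 1]), (446185740000, [2, 1, 5]), (10280119449600, [2, 1, 2, 2]),
  (2570029862400, [2, 1, 1, 1, 0, 0, 1]), (2570029862400, [2, 1, 1, 0, 1, 1]), (-285558873600, [2,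
  1, 0, 0, 0, 0, 2]), (223092870000, [2, 0, 4, 0, 1]), (2998368172800, [2, 0, 2, 1, 0, 1]),
  (3855044793600, [2, 0, 1, 2, 1]), (285558873600, [2, 0, 1, 0, 0, 1, 1]), (-142779436800, [2, 0, 0,
  1, 1, 0, 1]), (142779436800, [2, 0, 0, 0, 2, 1]), (354093003264000, [1, 8]), (-304596131840000,
  [1, 6, 0, 1]), (27413651865600, [1, 5, 0, 0, 0, 1]), (7234158131200, [1, 4, 3]), (102801194496000,
  [1, 4, 0, 2]), (-1998912115200, [1, 3, 2, 0, 1]), (-22844709888000, [1, 3, 0, 1, 0, 1]),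
  (-1427794368000, [1, 2, 3, 1]), (2141691552000, [1, 2, 2, 0, 0, 0, 1]), (428338310400, [1, 2, 1,
  0, 2]), (5711177472000, [1, 2, 0, 3]), (2855588736000, [1, 2, 0, 0, 0, 2]), (713897184000, [1, 1,
  3, 0, 0, 1]), (2998368172800, [1, 1, 2, 1, 1]), (-428338310400, [1, 1, 1, 0, 1, 0, 1]),
  (5711177472000, [1, 1, 0, 2, 0, 1]), (47593145600, [1, 1, 0, 0, 3]), (32720287600, [1, 0, 6]),
  (2284470988800, [1, 0, 3, 2]), (214169155200, [1, 0, 2, 1, 0, 0, 1]), (356948592000, [1, 0, 2, 0,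
  1, 1]), (285558873600, [1, 0, 1, 1, 2]), (35694859200, [1, 0, 1, 0, 0, 0, 2]), (3331520192000, [1,
  0, 0, 4]), (1427794368000, [1, 0, 0, 1, 0, 2]), (35694859200, [1, 0, 0, 0, 2, 0, 1]),
  (-67011149004800, [0, 7, 1]), (15229806592000, [0, 6, 0, 0, 1]), (50258361753600, [0, 5, 1, 1]),
  (-9594778152960, [0, 5, 0, 0, 0, 0, 1]), (-2284470988800, [0, 4, 1, 0, 0, 1]), (-9137883955200,
  [0, 4, 0, 1, 1]), (95186291200, [0, 3, 4]), (-12564590438400, [0, 3, 1, 2]), (6853412966400, [0,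
  3, 0, 1, 0, 0, 1]), (1142235494400, [0, 3, 0, 0, 1, 1]), (142779436800, [0, 2, 3, 0, 1]),
  (3426706483200, [0, 2, 1, 1, 0, 1]), (571117747200, [0, 2, 0, 2, 1]), (-1142235494400, [0, 2, 0,
  0, 0, 1, 1]), (499728028800, [0, 1, 4, 1]), (-71389718400, [0, 1, 3, 0, 0, 0, 1]), (71389718400,
  [0, 1, 2, 0, 2]), (4188196812800, [0, 1, 1, 3]), (285558873600, [0, 1, 1, 0, 0, 2]),
  (-1142235494400, [0, 1, 0, 2, 0, 0, 1]), (571117747200, [0, 1, 0, 1, 1, 1]), (35694859200, [0, 0,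
  4, 0, 0, 1]), (214169155200, [0, 0, 3, 1, 1]), (35694859200, [0, 0, 2, 0, 1, 0, 1]),
  (1713353241600, [0, 0, 1, 2, 0, 1]), (11898286400, [0, 0, 1, 0, 3]), (190372582400, [0, 0, 0, 3,
  1]), (285558873600, [0, 0, 0, 1, 0, 1, 1]), (142779436800, [0, 0, 0, 0, 1, 2])]

/-- The potential of type E8. -/
def dataE8 : Data 6 where
  wt := [1, 3, 4, 6, 7, 9, 10, 12]
  wtY := [1, 3, 4, 6, 7, 9, 5, 12]
  den := 12
  W := 25
  V := 10
  G := freeTermsE8 ++ evenTermsE8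
  q := [(4, [10]), (-20, [7, 1]), (-2, [6, 0, 1]), (312, [4, 2]), (-8, [4, 0, 0, 1]), (-80, [3,
    1, 1]), (4, [3, 0, 0, 0, 1]), (6, [2, 0, 2]), (-352, [1, 3]), (96, [1, 1, 0, 1]), (-8,
    [1, 0, 0, 0, 0, 1]), (48, [0, 2, 1]), (-8, [0, 1, 0, 0, 1]), (-8, [0, 0, 1, 1]), (4,
    [0, 0, 0, 0, 0, 0, 1])]
  -- With ζ = 2z the term z⁵ / 15 is ζ⁵ / 480, and this is d / 480.
  γ := 594914320
  r := 0
  d := 285558873600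
  -- The terms x_1⁶ x_3 / 2 and -3 x_1² x_3² / 2 make v half-integral; x_3 = 2 y_3 removes the
  -- denominators.
  lam := [0, 0, 1, 0, 0, 0, 0, 0]
  v := [(-1, [10]), (5, [7, 1]), (1, [6, 0, 1]), (-78, [4, 2]), (2, [4, 0, 0, 1]), (40, [3, 1,
    1]), (-1, [3, 0, 0, 0, 1]), (-6, [2, 0, 2]), (88, [1, 3]), (-24, [1, 1, 0, 1]), (2,
    [1, 0, 0, 0, 0, 1]), (-24, [0, 2, 1]), (2, [0, 1, 0, 0, 1]), (4, [0, 0, 1, 1])]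
  s := 1
  -- q = 4 (x_7 - v) is integral in x, and its root is ζ = 2z.
  t := 2
  steps := [(7, 119), (6, 119), (1, 805), (4, 8161), (2, 32731), (5, 198096), (3, 594496)]

theorem isSound_dataE8 : dataE8.IsSound := by
  constructor <;> decide +kernel

theorem isLinear_dataE8 : dataE8.IsLinear := by
  unfold Data.IsLinear
  decide +kernel

theorem isPresented_dataE8 :
    dataE8.IsPresented ![1/12, 1/4, 1/3, 1/2, 7/12, 3/4, 5/6, 1] 2 freeTermsE8 evenTermsE8 where
  sound := isSound_dataE8
  weight_pos := by norm_num
  weight_mono := by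
    rw [Fin.monotone_iff_le_succ]
    intro i
    fin_cases i <;> simp <;> norm_num
  weight_last := rfl
  weight_eq i := by fin_cases i <;> simp [dataE8] <;> norm_num
  den_ne_zero := by decide
  d_ne_zero := by decide
  weight_F := by decide
  G_eq := rfl
  free_G := by decide +kernel
  free_q := by decide +kernel
  free_v := by decide +kernel
  F0_eq x := by
    have : ({0, idxLast 6} : Finset (Fin (6 + 2)))ᶜ = {1, 2, 3, 4, 5, 6} := by decide
    rw [F0, this]
    simp [freeTermsE8, dataE8, MonoList.eval, mono, extend, Fin.rev, Fin.last]
    ring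
  κ_sq := by norm_num [dataE8]
  t_ne_zero := by decide
  q_eq y := by
    simp [dataE8, Data.param, MonoList.eval, mono]
    ring

/-- The rows of a matrix that is invertible modulo 29. -/
def cyclicRowsE8 : List (List ℤ) :=
  [[0, 0, 0, 0, 0, 0, 0, 1], [0, 0, 0, 0, 0, 0, 15, 0], [0, 10, 9, 19, 6, 4, 25, 11], [5, 5, 2, 18,
    5, 15, 5, 10], [17, 21, 5, 2, 14, 20, 7, 21], [25, 26, 7, 2, 23, 11, 19, 7], [13, 18, 24, 24,
    12, 24, 19, 0], [9, 5, 12, 9, 26, 8, 8, 28]]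

/-- The inverse of `cyclicRowsE8` modulo 29. -/
def cyclicInverseE8 : List (List ℤ) :=
  [[16, 15, 5, 18, 7, 12, 2, 18], [16, 11, 17, 15, 24, 0, 12, 16], [22, 1, 8, 16, 7, 12, 23, 8], [4,
    13, 22, 19, 12, 23, 12, 8], [20, 21, 10, 1, 18, 14, 9, 7], [11, 24, 16, 16, 7, 24, 0, 24], [0,
    2, 0, 0, 0, 0, 0, 0], [1, 0, 0, 0, 0, 0, 0, 0]]

/-- The indices are treated one at a time to split the largest computation. The index 6 is missing
because this matrix would be compared with itself. -/
theorem checkZero_dataE8_0 : dataE8.checkZero 0 = true := by decide +kernel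

theorem checkBounds_dataE8_0 : dataE8.checkBounds 0 = true := by decide +kernel

theorem checkZero_dataE8_1 : dataE8.checkZero 1 = true := by decide +kernel

theorem checkBounds_dataE8_1 : dataE8.checkBounds 1 = true := by decide +kernel

theorem checkZero_dataE8_2 : dataE8.checkZero 2 = true := by decide +kernel

theorem checkBounds_dataE8_2 : dataE8.checkBounds 2 = true := by decide +kernel

theorem checkZero_dataE8_3 : dataE8.checkZero 3 = true := by decide +kernel

theorem checkBounds_dataE8_3 : dataE8.checkBounds 3 = true := by decide +kernel

theorem checkZero_dataE8_4 : dataE8.checkZero 4 = true := by decide +kernel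

theorem checkBounds_dataE8_4 : dataE8.checkBounds 4 = true := by decide +kernel

theorem checkZero_dataE8_5 : dataE8.checkZero 5 = true := by decide +kernel

theorem checkBounds_dataE8_5 : dataE8.checkBounds 5 = true := by decide +kernel

theorem checkZero_dataE8_7 : dataE8.checkZero 7 = true := by decide +kernel

theorem checkBounds_dataE8_7 : dataE8.checkBounds 7 = true := by decide +kernel

theorem isCommuting_dataE8 :
    dataE8.IsCommuting [0, 0, 0, 0, 0, 0, 0, 0] 29 cyclicRowsE8 cyclicInverseE8 where
  sound := isSound_dataE8
  length_eq := rfl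
  one_lt := by decide
  cyclic := by decide +kernel
  zero := fun j hj => by
    fin_cases j
    · exact checkZero_dataE8_0
    · exact checkZero_dataE8_1
    · exact checkZero_dataE8_2
    · exact checkZero_dataE8_3
    · exact checkZero_dataE8_4
    · exact checkZero_dataE8_5
    · exact absurd rfl hj
    · exact checkZero_dataE8_7
  bounds := fun j hj => by
    fin_cases j
    · exact checkBounds_dataE8_0
    · exact checkBounds_dataE8_1
    · exact checkBounds_dataE8_2
    · exact checkBounds_dataE8_3
    · exact checkBounds_dataE8_4
    · exact checkBounds_dataE8_5
    · exact absurd rfl hj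
    · exact checkBounds_dataE8_7

/-- The rows of the matrix `T` at a special point up to a factor. -/
def specialRowsE8 : List (List ℤ) :=
  [[0, 1, 0, 0, 0, 0, 2, 0], [0, 0, 0, 0, 0, 0, 0, 2], [0, 0, 0, 1, 0, 0, 0, 0], [4, 0, 0, 0, 0, 0,
    0, 0], [0, 0, 0, 0, 0, 1, 0, 0], [0, 0, 4, 0, 0, 0, 0, 0], [0, 0, 0, 0, 0, 0, 0, 1], [0, 0, 0,
    0, 4, 0, 0, 0]]

/-- The images of a vector under the powers of the matrix `specialRowsE8`. -/
def krylovRowsE8 : List (List ℤ) :=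
  [[0, 0, 0, 0, 0, 0, 1, 0], [0, 0, 0, 0, 0, 0, 0, 1], [0, 0, 0, 0, 4, 0, 0, 0], [0, 0, 0, 0, 0, 4,
    0, 0], [0, 0, 16, 0, 0, 0, 0, 0], [0, 0, 0, 16, 0, 0, 0, 0], [64, 0, 0, 0, 0, 0, 0, 0], [0, 64,
    0, 0, 0, 0, 128, 0]]

/-- The inverse of `krylovRowsE8` modulo 5. -/
def krylovInverseE8 : List (List ℤ) :=
  [[0, 0, 0, 0, 0, 0, 4, 0], [3, 0, 0, 0, 0, 0, 0, 4], [0, 0, 0, 0, 1, 0, 0, 0], [0, 0, 0, 0, 0, 1,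
    0, 0], [0, 0, 4, 0, 0, 0, 0, 0], [0, 0, 0, 4, 0, 0, 0, 0], [1, 0, 0, 0, 0, 0, 0, 0], [0, 1, 0,
    0, 0, 0, 0, 0]]

/-- Only x_5 = 1 is nonzero, again a point with z = 0; the characteristic polynomial is X⁸ - 256X.
-/
theorem checkSpectrum_dataE8 :
    dataE8.checkSpectrum [0, 0, 0, 0, 1, 0, 0, 0] 1998912115200 specialRowsE8 krylovRowsE8
      [0, -256, 0, 0, 0, 0, 0, 0] 5 krylovInverseE8 = true := by
  decide +kernel

theorem squarefree_specialE8 : Squarefree (Polynomial.X ^ 8 + ∑ k : Fin 8,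
    Polynomial.C ((([0, -256, 0, 0, 0, 0, 0, 0] : List ℤ).getD k 0 : ℤ) : ℂ) * Polynomial.X ^ (k : ℕ)) := by
  refine squarefree_of_bezout ((8) * X ^ 7 + (-256)) ((-8) * X ^ 6)
    (X ^ 7 + (-224)) (D := 57344) (by norm_num) ?_ ?_
  · simp [Fin.sum_univ_succ, map_ofNat]
    try ring
  · simp [Fin.sum_univ_succ]
    ring

theorem eval_vPoly_dataE8 (x : Fin 6 → ℂ) : MvPolynomial.eval x dataE8.vPoly = vE8 (x 0) (x 1) (x 2) (x 3) (x 4) (x 5) := by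
  rw [isPresented_dataE8.eval_vPoly]
  simp [dataE8, MonoList.eval, mono, vE8]
  ring

set_option maxRecDepth 10000 in
theorem candidate_dataE8 (x : Fin 8 → ℂ) {z : ℂ}
    (hz : z ^ 2 + vE8 (x 0) (x 1) (x 2) (x 3) (x 4) (x 5) - x 6 = 0) :
    candidate (dataE8.uPoly 2 evenTermsE8) x z
      = potentialE8 (x 0) (x 1) (x 2) (x 3) (x 4) (x 5) (x 6) (x 7) z := by
  have hz' : z ^ 2 + MvPolynomial.eval (initial (m := 6) x) dataE8.vPoly - x (idxPen 6) = 0 := by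
    rw [eval_vPoly_dataE8]; exact hz
  rw [isPresented_dataE8.candidate_eq hz']
  simp [dataE8, freeTermsE8, evenTermsE8, MonoList.eval, mono, extend, potentialE8, partE8a, partE8b, partE8c, partE8d, partE8e, partE8f]
  ring

end WDVV

/-! ### Basic invariants of the group of signed permutations -/

namespace WDVV

open MvPolynomial

variable {n : ℕ}

theorem signedPerm_X (σ : Equiv.Perm (Fin n)) (ε : Fin n → ℤˣ) (i : Fin n) :
    signedPerm σ ε (X i) = C ((ε i : ℤ) : ℂ) * X (σ i) := by
  simp [signedPerm]

theorem signedPerm_X_pow (σ : Equiv.Perm (Fin n)) (ε : Fin n → ℤˣ) (i : Fin n) (k : ℕ) :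
    signedPerm σ ε (X i ^ (2 * k)) = X (σ i) ^ (2 * k) := by
  have h : C ((ε i : ℤ) : ℂ) ^ 2 = (1 : MvPolynomial (Fin n) ℂ) := by
    rcases Int.units_eq_one_or (ε i) with h | h <;> simp [h]
  rw [map_pow, signedPerm_X, mul_pow, pow_mul, h, one_pow, one_mul]

theorem signedPerm_one_right (σ : Equiv.Perm (Fin n)) (q : MvPolynomial (Fin n) ℂ) :
    signedPerm σ 1 q = rename σ q := by
  have : signedPerm σ 1 = rename (R := ℂ) σ := by
    ext i
    simp [signedPerm_X]
  rw [this]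

theorem coeff_signedPerm_one (ε : Fin n → ℤˣ) (q : MvPolynomial (Fin n) ℂ) (d : Fin n →₀ ℕ) :
    coeff d (signedPerm 1 ε q) = (∏ i, ((ε i : ℤ) : ℂ) ^ d i) * coeff d q := by
  induction q using MvPolynomial.induction_on' with
  | monomial e c =>
    have : signedPerm 1 ε (monomial e c) = monomial e ((∏ i, ((ε i : ℤ) : ℂ) ^ e i) * c) := by
      rw [signedPerm, aeval_monomial, Finsupp.prod_fintype _ _ (by simp)]
      simp only [mul_pow, Finset.prod_mul_distrib, Equiv.Perm.coe_one, id_eq]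
      rw [monomial_eq (s := e), Finsupp.prod_fintype _ _ (by simp), algebraMap_eq, C_mul, map_prod]
      simp only [map_pow]
      ring
    rw [this, coeff_monomial, coeff_monomial]
    split_ifs with h
    · rw [h]
    · rw [mul_zero]
  | add p q hp hq => rw [map_add, coeff_add, coeff_add, hp, hq, mul_add]

/-- A polynomial which is invariant under sign changes is a polynomial in the squares. -/
theorem exists_expand_two_eq {q : MvPolynomial (Fin n) ℂ} (hq : ∀ ε, signedPerm 1 ε q = q) :
    ∃ q', expand 2 q' = q := by
  have heven : ∀ d ∈ q.support, ∀ i, 2 * (d i / 2) = d i := by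
    intro d hd i
    by_contra hi
    -- Changing the sign of the variable i multiplies the coefficient of a monomial by -1 when its
    -- exponent of this variable is odd.
    have h1 := coeff_signedPerm_one (Function.update 1 i (-1)) q d
    rw [hq, Finset.prod_eq_single i] at h1
    · have ho : Odd (d i) := by
        rw [← Nat.not_even_iff_odd]
        rintro ⟨k, hk⟩
        omega
      simp [ho.neg_one_pow] at h1
      exact (mem_support_iff.mp hd) (by linear_combination h1 / 2)
    · intro j _ hj
      simp [Function.update_of_ne hj]
    · simp
  refine ⟨∑ d ∈ q.support, monomial (d.mapRange (· / 2) rfl) (coeff d q), ?_⟩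
  conv_rhs => rw [q.as_sum]
  rw [map_sum]
  refine Finset.sum_congr rfl fun d hd => ?_
  rw [expand_monomial]
  refine congrArg (monomial · (coeff d q)) (Finsupp.ext fun i => ?_)
  simpa using heven d hd i

/-- The power sums of the squares of the variables. -/
noncomputable def sqSum (n k : ℕ) : MvPolynomial (Fin n) ℂ := ∑ i, X i ^ (2 * k)

theorem expand_psum (k : ℕ) : expand 2 (psum (Fin n) ℂ k) = sqSum n k := by
  simp [psum, sqSum, pow_mul]

theorem signedPerm_sqSum (σ : Equiv.Perm (Fin n)) (ε : Fin n → ℤˣ) (k : ℕ) :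
    signedPerm σ ε (sqSum n k) = sqSum n k := by
  rw [sqSum, map_sum]
  simp only [signedPerm_X_pow]
  exact Equiv.sum_comp σ fun i => X i ^ (2 * k)

/-- Newton's identities express k e_k by the power sums and the e_j with j < k, and k is invertible
in ℂ. -/
theorem expand_esymm_mem {S : Subalgebra ℂ (MvPolynomial (Fin n) ℂ)}
    (hS : ∀ k, 1 ≤ k → k ≤ n → sqSum n k ∈ S) (k : ℕ) (hk : k ≤ n) :
    expand 2 (esymm (Fin n) ℂ k) ∈ S := by
  induction k using Nat.strong_induction_on with
  | _ k ih =>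
    rcases Nat.eq_zero_or_pos k with rfl | hpos
    · simp [S.one_mem]
    have h := congrArg (expand 2) (mul_esymm_eq_sum (Fin n) ℂ k)
    rw [map_mul, map_mul, map_natCast, map_sum] at h
    have hmem : (k : MvPolynomial (Fin n) ℂ) * expand 2 (esymm (Fin n) ℂ k) ∈ S := by
      rw [h]
      refine S.mul_mem (by simpa using S.pow_mem (S.neg_mem S.one_mem) _) (S.sum_mem ?_)
      intro a ha
      rw [Finset.mem_filter, Finset.HasAntidiagonal.mem_antidiagonal] at ha
      rw [map_mul, map_mul, expand_psum]
      exact S.mul_mem (S.mul_mem (by simpa using S.pow_mem (S.neg_mem S.one_mem) _)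
        (ih _ ha.2 (by omega))) (hS _ (by omega) (by omega))
    have hk0 : (k : ℂ) ≠ 0 := by exact_mod_cast hpos.ne'
    have := S.smul_mem hmem (k : ℂ)⁻¹
    rwa [smul_eq_C_mul, ← mul_assoc, ← C_eq_coe_nat, ← C_mul, inv_mul_cancel₀ hk0, C_1,
      one_mul] at this

/-- Sign changes force a polynomial in the squares, permutations force it to be symmetric in them,
and symmetric polynomials are generated by the elementary ones. -/
theorem mem_of_invariant {S : Subalgebra ℂ (MvPolynomial (Fin n) ℂ)}
    (hS : ∀ k, 1 ≤ k → k ≤ n → sqSum n k ∈ S) {q : MvPolynomial (Fin n) ℂ}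
    (hq : ∀ σ ε, signedPerm σ ε q = q) : q ∈ S := by
  obtain ⟨q', rfl⟩ := exists_expand_two_eq fun ε => hq 1 ε
  have hsymm : q'.IsSymmetric := fun σ => by
    have := hq σ 1
    rw [signedPerm_one_right, rename_expand] at this
    exact expand_injective two_pos this
  obtain ⟨p, hp⟩ := esymmAlgHom_fin_surjective ℂ (le_refl n) ⟨q', hsymm⟩
  have hp' := congrArg Subtype.val hp
  rw [esymmAlgHom_apply] at hp'
  simp only at hp'
  rw [← hp', ← AlgHom.comp_apply, comp_aeval]
  refine Algebra.adjoin_le (S := S) (s := Set.range fun i : Fin n =>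
    expand 2 (esymm (Fin n) ℂ (i + 1))) ?_ ?_
  · rintro _ ⟨i, rfl⟩
    exact expand_esymm_mem hS _ i.2
  · rw [Algebra.adjoin_range_eq_range_aeval]
    exact ⟨p, rfl⟩

theorem signedPerm_eq_of_mem_adjoin {P : Fin n → MvPolynomial (Fin n) ℂ}
    (hP : ∀ i σ ε, signedPerm σ ε (P i) = P i) {q : MvPolynomial (Fin n) ℂ}
    (hq : q ∈ Algebra.adjoin ℂ (Set.range P)) (σ : Equiv.Perm (Fin n)) (ε : Fin n → ℤˣ) :
    signedPerm σ ε q = q := by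
  have : Algebra.adjoin ℂ (Set.range P)
      ≤ AlgHom.equalizer (signedPerm σ ε) (AlgHom.id ℂ _) := by
    refine Algebra.adjoin_le ?_
    rintro _ ⟨i, rfl⟩
    exact hP i σ ε
  exact this hq

/-- The variables are integral over a subalgebra that contains all invariants. -/
theorem isIntegral_X {S : Subalgebra ℂ (MvPolynomial (Fin n) ℂ)}
    (hS : ∀ q, (∀ σ ε, signedPerm σ ε q = q) → q ∈ S) (i : Fin n) :
    IsIntegral S (X i : MvPolynomial (Fin n) ℂ) := by
  -- Each variable is a root of ∏ (T² - X_j²), whose coefficients are invariant.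
  set f : Polynomial (MvPolynomial (Fin n) ℂ) :=
    ∏ j, (Polynomial.X ^ 2 - Polynomial.C (X j ^ 2)) with hf
  have hmonic : f.Monic := Polynomial.monic_prod_of_monic _ _ fun j _ =>
    Polynomial.monic_X_pow_sub_C _ two_ne_zero
  have hlift : f ∈ Polynomial.lifts (algebraMap S (MvPolynomial (Fin n) ℂ)) := by
    rw [Polynomial.lifts_iff_coeff_lifts]
    intro k
    refine ⟨⟨f.coeff k, hS _ fun σ ε => ?_⟩, rfl⟩
    have hmap : f.map (signedPerm σ ε).toRingHom = f := by
      rw [hf, Polynomial.map_prod]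
      simp only [Polynomial.map_sub, Polynomial.map_pow, Polynomial.map_X, Polynomial.map_C,
        AlgHom.toRingHom_eq_coe, RingHom.coe_coe]
      simp only [fun j => show signedPerm σ ε (X j ^ 2) = X (σ j) ^ 2 by
        simpa using signedPerm_X_pow σ ε j 1]
      exact Equiv.prod_comp σ fun j => Polynomial.X ^ 2 - Polynomial.C (X j ^ 2)
    have := congrArg (Polynomial.coeff · k) hmap
    simpa using this
  obtain ⟨g, hg, -, hgm⟩ := Polynomial.lifts_and_natDegree_eq_and_monic hlift hmonic
  refine ⟨g, hgm, ?_⟩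
  rw [← Polynomial.eval_map, hg, hf, Polynomial.eval_prod]
  exact Finset.prod_eq_zero (Finset.mem_univ i) (by simp)

/-- The polynomial ring has transcendence degree n and is integral over the algebra generated by the
n elements, which must therefore form a transcendence basis. -/
theorem algebraicIndependent_of_mem {P : Fin n → MvPolynomial (Fin n) ℂ}
    (hS : ∀ q, (∀ σ ε, signedPerm σ ε q = q) → q ∈ Algebra.adjoin ℂ (Set.range P)) :
    AlgebraicIndependent ℂ P := by
  have hint : ∀ q : MvPolynomial (Fin n) ℂ, IsIntegral (Algebra.adjoin ℂ (Set.range P)) q := by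
    intro q
    induction q using MvPolynomial.induction_on with
    | C a =>
      exact isIntegral_algebraMap
        (x := algebraMap ℂ (Algebra.adjoin ℂ (Set.range P)) a)
    | add p q hp hq => exact hp.add hq
    | mul_X p i hp => exact hp.mul (isIntegral_X hS i)
  have : Algebra.IsAlgebraic (Algebra.adjoin ℂ (Set.range P)) (MvPolynomial (Fin n) ℂ) :=
    ⟨fun q => (hint q).isAlgebraic⟩
  refine (Algebra.IsAlgebraic.isTranscendenceBasis_of_lift_le_trdeg_of_finite ℂ P ?_).1
  rw [MvPolynomial.trdeg_of_isDomain]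
  simp

theorem isBasicInvariantsB_of_mem {P : Fin n → MvPolynomial (Fin n) ℂ}
    (hP : ∀ i, (P i).IsHomogeneous (2 * (i + 1)))
    (hinv : ∀ i σ ε, signedPerm σ ε (P i) = P i)
    (hmem : ∀ k, 1 ≤ k → k ≤ n → sqSum n k ∈ Algebra.adjoin ℂ (Set.range P)) :
    IsBasicInvariantsB P where
  homogeneous := hP
  independent := algebraicIndependent_of_mem fun _ => mem_of_invariant hmem
  generate _ := ⟨signedPerm_eq_of_mem_adjoin hinv, mem_of_invariant hmem⟩

end WDVV

/-! ### The polynomial potential of B₄ on all of ℂ⁴ -/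

namespace WDVV

open MonoList

/-- The matrices of third derivatives commute when there is no odd part. -/
theorem Data.commute_deriv {m : ℕ} {D : Data m} (hγ : D.γ = 0) (ht : D.t ≠ 0)
    (hc : ∀ j k : Fin (m + 2), Commute (D.matrix (Data.var m) j) (D.matrix (Data.var m) k))
    {x y : ℕ → ℂ} (hyx : ∀ i, D.param y i = x i) (hy : ∀ i ≥ m + 2, y i = 0) (j k : Fin (m + 2)) :
    Commute
      (Matrix.of fun i l : Fin (m + 2) => eval x (deriv j (deriv i (deriv l.rev D.G))))
      (Matrix.of fun i l : Fin (m + 2) => eval x (deriv k (deriv i (deriv l.rev D.G)))) := by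
  set M : Fin (m + 2) → Matrix (Fin (m + 2)) (Fin (m + 2)) (MvPolynomial (Fin (m + 2)) ℤ) :=
    fun j => Matrix.of fun i l => eval (D.param (Data.var m)) (deriv j (deriv i (deriv l.rev D.G)))
    with hM
  -- Without odd part `third` is 8 t y_m times a third derivative of G. Cancelling this factor in
  -- the polynomial ring yields commutation also where y_m vanishes.
  set a : MvPolynomial (Fin (m + 2)) ℤ := 8 * (D.t * Data.var m m) with ha
  have ha0 : a ≠ 0 := by
    have h8 : (8 : MvPolynomial (Fin (m + 2)) ℤ) ≠ 0 := by
      have : (8 : MvPolynomial (Fin (m + 2)) ℤ) = MvPolynomial.C 8 := by simp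
      rw [this, Ne, MvPolynomial.C_eq_zero]
      norm_num
    have h1 : (D.t : MvPolynomial (Fin (m + 2)) ℤ) ≠ 0 := by
      have : (D.t : MvPolynomial (Fin (m + 2)) ℤ) = MvPolynomial.C D.t := by simp
      rw [this, Ne, MvPolynomial.C_eq_zero]
      exact ht
    refine mul_ne_zero h8 (mul_ne_zero h1 ?_)
    rw [Data.var, dif_pos (by omega)]
    exact MvPolynomial.X_ne_zero _
  have hDM : ∀ j : Fin (m + 2), D.matrix (Data.var m) j = a • M j := by
    intro j
    ext1 i l
    simp [Data.matrix, Data.thirdParam, third, hγ, hM, ha]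
  have hMc : Commute (M j) (M k) := by
    have h := hc j k
    rw [hDM, hDM, Commute, SemiconjBy, smul_mul_smul_comm, smul_mul_smul_comm] at h
    exact smul_right_injective _ (mul_ne_zero ha0 ha0) h
  have hv : (fun i => MvPolynomial.eval₂Hom (Int.castRingHom ℂ) (fun i : Fin (m + 2) => y i)
      (D.param (Data.var m) i)) = x := by
    funext i
    rw [Data.map_param, ← hyx]
    congr 1
    funext i
    unfold Data.var
    split_ifs with h
    · simp
    · rw [map_zero, hy i (by omega)]
  have hmap : ∀ j : Fin (m + 2),
      (MvPolynomial.eval₂Hom (Int.castRingHom ℂ) fun i : Fin (m + 2) => y i).mapMatrix (M j)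
        = Matrix.of fun i l : Fin (m + 2) => eval x (deriv j (deriv i (deriv l.rev D.G))) := by
    intro j
    ext1 i l
    refine (map_eval (MvPolynomial.eval₂Hom (Int.castRingHom ℂ) fun i : Fin (m + 2) => y i) _
      _).trans ?_
    rw [hv]
    rfl
  rw [← hmap, ← hmap]
  exact hMc.map _

theorem potentialB4_eq (x : Fin 4 → ℂ) : potentialB4 (x 0) (x 1) (x 2) (x 3)
    = (dataB4.d : ℂ)⁻¹ * eval (extend x) dataB4.G := by
  simp [dataB4, freeTermsB4, evenTermsB4, eval, mono, extend, potentialB4]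
  ring

/-- Since γ = 0 the choice of q is free. The constant q = 1, with root 1, makes the general results
available on all of ℂ⁴, including x_3 = 0, where z has no branch. -/
theorem isModel_potentialB4 : IsModel (m := 2) ![1/4, 1/2, 3/4, 1] dataB4.wt dataB4.den dataB4.W 0
    dataB4.G [(1, [])] 0 0 :=
  { isPresented_dataB4.isModel with
    homog_q := rfl
    exponent := Or.inl rfl }

theorem isRoot_one {n : ℕ} : IsRoot (n := n) [(1, [])] Set.univ fun _ => 1 where
  isOpen := isOpen_univ
  analytic _ _ := analyticAt_const
  ne_zero _ _ := one_ne_zero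
  sq_eq _ _ := by simp [eval, mono]

theorem isPotential_potentialB4 : IsPotential (m := 2) ![1/4, 1/2, 3/4, 1] Set.univ
    (fun x : Fin 4 → ℂ => potentialB4 (x 0) (x 1) (x 2) (x 3)) := by
  refine isModel_potentialB4.isPotential isRoot_one (d := dataB4.d)
    (fun x _ => by rw [potentialB4_eq]; simp) (fun x _ => ?_) (fun x _ j k => ?_)
  · refine (((hasPd_eval (idxLast 2) evenTermsB4 x).const_mul (dataB4.d : ℂ)⁻¹).congr
      (Filter.Eventually.of_forall fun y => ?_)).congr_right ?_
    · have h1 := isPresented_dataB4.F0_eq y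
      have h2 : (dataB4.d : ℂ) ≠ 0 := by exact_mod_cast isPresented_dataB4.d_ne_zero
      have h3 := potentialB4_eq y
      simp only
      rw [h3, isPresented_dataB4.G_eq, eval_append, h1]
      field_simp
      ring
    · rw [Fin.val_last, isPresented_dataB4.free_G, eval, mul_zero]
  -- The commutation was proved in terms of parameters with x_3 = y_3², so a square root of x_3 is
  -- chosen; any one will do.
  · obtain ⟨a, ha⟩ := IsAlgClosed.exists_pow_nat_eq (x 2) two_pos
    have hc := Data.commute_deriv (D := dataB4) rfl (by decide) isCommuting_dataB4.commute
      (x := extend x) (y := fun i => if i = 2 then a else extend x i) (fun i => ?_) (fun i hi => ?_)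
      j k
    · have e : ∀ j : Fin (2 + 2), (Matrix.of fun i l : Fin (2 + 2) =>
          third dataB4.G [(1, [])] 0 0 (extend x) 1 j i l.rev)
          = (8 : ℂ) • Matrix.of fun i l : Fin (2 + 2) =>
            eval (extend x) (deriv j (deriv i (deriv l.rev dataB4.G))) := by
        intro j
        ext1 i l
        simp [third]
      rw [e, e]
      exact (hc.smul_left _).smul_right _
    · by_cases hi : i = 2
      · subst hi
        simp [Data.param, dataB4, eval, ha, extend]
      · have : dataB4.lam.getD i 0 = 0 := by
          rcases i with _ | _ | _ | _ | i <;> simp [dataB4]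
        simp only [Data.param, hi, if_false, this]
        simp
    · rw [if_neg (by omega), extend, dif_neg (by omega)]

end WDVV

/-! ### Flat coordinates of B₄, their gradients and the matrix T -/

namespace WDVV

open MvPolynomial

/-- The flat coordinates of type `B₄`, in terms of the power sums of the squares. -/
noncomputable def flatB4 : Fin 4 → MvPolynomial (Fin 4) ℂ :=
  ![sqSum 4 1,
    C 4 * sqSum 4 2 - C (3 / 2) * sqSum 4 1 ^ 2,
    C (64 / 3) * sqSum 4 3 - C 20 * (sqSum 4 1 * sqSum 4 2) + C (25 / 6) * sqSum 4 1 ^ 3,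
    C 128 * sqSum 4 4 - C (448 / 3) * (sqSum 4 1 * sqSum 4 3) - C 56 * sqSum 4 2 ^ 2
      + C 98 * (sqSum 4 1 ^ 2 * sqSum 4 2) - C (343 / 24) * sqSum 4 1 ^ 4]

theorem isHomogeneous_sqSum (n k : ℕ) : (sqSum n k).IsHomogeneous (2 * k) :=
  IsHomogeneous.sum _ _ _ fun i _ => isHomogeneous_X_pow i (2 * k)

theorem isHomogeneous_flatB4 (i : Fin 4) : (flatB4 i).IsHomogeneous (2 * (i + 1)) := by
  have h1 := isHomogeneous_sqSum 4 1
  have h2 := isHomogeneous_sqSum 4 2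
  have h3 := isHomogeneous_sqSum 4 3
  have h4 := isHomogeneous_sqSum 4 4
  fin_cases i
  · exact h1
  · exact (h2.C_mul _).sub ((h1.pow 2).C_mul _)
  · exact ((h3.C_mul _).sub ((h1.mul h2).C_mul _)).add ((h1.pow 3).C_mul _)
  · exact ((((h4.C_mul _).sub ((h1.mul h3).C_mul _)).sub ((h2.pow 2).C_mul _)).add
      (((h1.pow 2).mul h2).C_mul _)).sub ((h1.pow 4).C_mul _)

theorem signedPerm_flatB4 (i : Fin 4) (σ : Equiv.Perm (Fin 4)) (ε : Fin 4 → ℤˣ) :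
    signedPerm σ ε (flatB4 i) = flatB4 i := by
  have hC : ∀ a : ℂ, signedPerm σ ε (C a) = C a := fun a => (signedPerm σ ε).commutes a
  fin_cases i <;> simp [flatB4, signedPerm_sqSum, hC]

/-- The flat coordinates are triangular in the power sums, with the nonzero leading coefficients 1,
4, 64/3 and 128, so the system can be solved successively. -/
theorem sqSum_mem_of_flatB4_mem {S : Subalgebra ℂ (MvPolynomial (Fin 4) ℂ)}
    (hP : ∀ i, flatB4 i ∈ S) : sqSum 4 1 ∈ S ∧ sqSum 4 2 ∈ S ∧ sqSum 4 3 ∈ S ∧ sqSum 4 4 ∈ S := by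
  have hC : ∀ a : ℂ, C a ∈ S := fun a => S.algebraMap_mem a
  have CC : ∀ {a b : ℂ}, a * b = 1 → (C a * C b : MvPolynomial (Fin 4) ℂ) = 1 := fun h => by
    rw [← C_mul, h, C_1]
  have m1 : sqSum 4 1 ∈ S := hP 0
  have m2 : sqSum 4 2 ∈ S := by
    have h : C 4 * sqSum 4 2 - C (3 / 2) * sqSum 4 1 ^ 2 ∈ S := hP 1
    have e : sqSum 4 2 = C (1 / 4) * (C 4 * sqSum 4 2 - C (3 / 2) * sqSum 4 1 ^ 2
        + C (3 / 2) * sqSum 4 1 ^ 2) := by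
      linear_combination -sqSum 4 2 * CC (show (1 / 4 : ℂ) * 4 = 1 by norm_num)
    rw [e]
    exact S.mul_mem (hC _) (S.add_mem h (S.mul_mem (hC _) (S.pow_mem m1 2)))
  have m3 : sqSum 4 3 ∈ S := by
    have h : C (64 / 3) * sqSum 4 3 - C 20 * (sqSum 4 1 * sqSum 4 2)
      + C (25 / 6) * sqSum 4 1 ^ 3 ∈ S := hP 2
    have e : sqSum 4 3 = C (3 / 64) * (C (64 / 3) * sqSum 4 3 - C 20 * (sqSum 4 1 * sqSum 4 2)
        + C (25 / 6) * sqSum 4 1 ^ 3 + C 20 * (sqSum 4 1 * sqSum 4 2)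
        - C (25 / 6) * sqSum 4 1 ^ 3) := by
      linear_combination -sqSum 4 3 * CC (show (3 / 64 : ℂ) * (64 / 3) = 1 by norm_num)
    rw [e]
    exact S.mul_mem (hC _) (S.sub_mem (S.add_mem h (S.mul_mem (hC _) (S.mul_mem m1 m2)))
      (S.mul_mem (hC _) (S.pow_mem m1 3)))
  have m4 : sqSum 4 4 ∈ S := by
    have h : C 128 * sqSum 4 4 - C (448 / 3) * (sqSum 4 1 * sqSum 4 3) - C 56 * sqSum 4 2 ^ 2
      + C 98 * (sqSum 4 1 ^ 2 * sqSum 4 2) - C (343 / 24) * sqSum 4 1 ^ 4 ∈ S := hP 3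
    have e : sqSum 4 4 = C (1 / 128) * (C 128 * sqSum 4 4 - C (448 / 3) * (sqSum 4 1 * sqSum 4 3)
        - C 56 * sqSum 4 2 ^ 2 + C 98 * (sqSum 4 1 ^ 2 * sqSum 4 2)
        - C (343 / 24) * sqSum 4 1 ^ 4 + C (448 / 3) * (sqSum 4 1 * sqSum 4 3)
        + C 56 * sqSum 4 2 ^ 2 - C 98 * (sqSum 4 1 ^ 2 * sqSum 4 2)
        + C (343 / 24) * sqSum 4 1 ^ 4) := by
      linear_combination -sqSum 4 4 * CC (show (1 / 128 : ℂ) * 128 = 1 by norm_num)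
    rw [e]
    exact S.mul_mem (hC _) (S.add_mem (S.sub_mem (S.add_mem (S.add_mem h
      (S.mul_mem (hC _) (S.mul_mem m1 m3))) (S.mul_mem (hC _) (S.pow_mem m2 2)))
      (S.mul_mem (hC _) (S.mul_mem (S.pow_mem m1 2) m2))) (S.mul_mem (hC _) (S.pow_mem m1 4)))
  exact ⟨m1, m2, m3, m4⟩

theorem sqSum_mem_adjoin_flatB4 (k : ℕ) (h1 : 1 ≤ k) (h4 : k ≤ 4) :
    sqSum 4 k ∈ Algebra.adjoin ℂ (Set.range flatB4) := by
  obtain ⟨m1, m2, m3, m4⟩ := sqSum_mem_of_flatB4_mem (S := Algebra.adjoin ℂ (Set.range flatB4))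
    fun i => Algebra.subset_adjoin ⟨i, rfl⟩
  interval_cases k
  · exact m1
  · exact m2
  · exact m3
  · exact m4

theorem isBasicInvariantsB_flatB4 : IsBasicInvariantsB flatB4 :=
  isBasicInvariantsB_of_mem isHomogeneous_flatB4 signedPerm_flatB4 sqSum_mem_adjoin_flatB4

/-- The values of the power sums. -/
noncomputable def powerSum (y : Fin 4 → ℂ) (k : ℕ) : ℂ := ∑ i, y i ^ (2 * k)

theorem eval_sqSum (y : Fin 4 → ℂ) (k : ℕ) : eval y (sqSum 4 k) = powerSum y k := by
  simp [sqSum, powerSum]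

theorem eval_flatB4 (y : Fin 4 → ℂ) (i : Fin 4) : eval y (flatB4 i) =
    ![powerSum y 1,
      4 * powerSum y 2 - 3 / 2 * powerSum y 1 ^ 2,
      64 / 3 * powerSum y 3 - 20 * (powerSum y 1 * powerSum y 2) + 25 / 6 * powerSum y 1 ^ 3,
      128 * powerSum y 4 - 448 / 3 * (powerSum y 1 * powerSum y 3) - 56 * powerSum y 2 ^ 2
        + 98 * (powerSum y 1 ^ 2 * powerSum y 2) - 343 / 24 * powerSum y 1 ^ 4] i := by
  fin_cases i <;> simp [flatB4, eval_sqSum]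

/-- The coefficients of the gradients of the flat coordinates, as combinations of the vectors
`(y_k ^ (2 l + 1))_k`. -/
noncomputable def gradCoeff (y : Fin 4 → ℂ) : Matrix (Fin 4) (Fin 4) ℂ :=
  !![2, 0, 0, 0;
    -6 * powerSum y 1, 16, 0, 0;
    -40 * powerSum y 2 + 25 * powerSum y 1 ^ 2, -80 * powerSum y 1, 128, 0;
    -(896 / 3) * powerSum y 3 + 392 * powerSum y 1 * powerSum y 2
      - 343 / 3 * powerSum y 1 ^ 3, -448 * powerSum y 2 + 392 * powerSum y 1 ^ 2,
      -896 * powerSum y 1, 1024]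

theorem eval_pderiv_sqSum (y : Fin 4 → ℂ) (k : Fin 4) (j : ℕ) :
    eval y (pderiv k (sqSum 4 j)) = 2 * j * y k ^ (2 * j - 1) := by
  rw [sqSum, map_sum, Finset.sum_eq_single k]
  · simp
  · intro i _ hi
    rw [pderiv_pow, pderiv_X_of_ne hi, mul_zero]
  · simp

/-- Chain rule: the gradient of the power sum with exponent 2j is 2j (y_k^(2j-1))_k, and these
factors are included in `gradCoeff`. -/
theorem eval_pderiv_flatB4 (y : Fin 4 → ℂ) :
    (Matrix.of fun i k : Fin 4 => eval y (pderiv k (flatB4 i)))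
      = gradCoeff y * Matrix.of fun l k : Fin 4 => y k ^ (2 * (l : ℕ) + 1) := by
  ext i k
  rw [Matrix.mul_apply, Fin.sum_univ_four]
  fin_cases i <;>
    simp [flatB4, gradCoeff, eval_pderiv_sqSum, eval_sqSum] <;> ring

/-- The triangular factor has determinant 2 · 16 · 128 · 1024 = 2²², and the matrix of odd powers is
a transposed Vandermonde matrix in the y_k² times the diagonal matrix of the y_k. -/
theorem det_gradB4 (y : Fin 4 → ℂ) :
    (Matrix.of fun i k : Fin 4 => eval y (pderiv k (flatB4 i))).det ^ 2
      = 2 ^ 44 * discB y := by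
  have h1 : (gradCoeff y).det = 2 ^ 22 := by
    rw [Matrix.det_of_isLowerTriangular, Fin.prod_univ_four]
    · simp [gradCoeff]; norm_num
    · intro i j hij
      fin_cases i <;> fin_cases j <;> first | rfl | (exact absurd hij (by decide))
  have h2 : (Matrix.of fun l k : Fin 4 => y k ^ (2 * (l : ℕ) + 1))
      = (Matrix.vandermonde fun k => y k ^ 2).transpose * Matrix.diagonal y := by
    ext l k
    rw [Matrix.mul_diagonal, Matrix.transpose_apply, Matrix.vandermonde_apply, Matrix.of_apply]
    ring
  rw [eval_pderiv_flatB4, Matrix.det_mul, h1, h2, Matrix.det_mul, Matrix.det_transpose,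
    Matrix.det_vandermonde, Matrix.det_diagonal, discB, mul_pow, mul_pow, Finset.prod_pow]
  have h3 : (∏ i : Fin 4, ∏ j ∈ Finset.Ioi i, (y j ^ 2 - y i ^ 2)) ^ 2
      = ∏ i, ∏ j ∈ Finset.Ioi i, ((y i - y j) * (y i + y j)) ^ 2 := by
    rw [← Finset.prod_pow]
    refine Finset.prod_congr rfl fun i _ => ?_
    rw [← Finset.prod_pow]
    exact Finset.prod_congr rfl fun j _ => by ring
  rw [h3]
  ring

/-- Each entry is a second derivative of the potential multiplied by its weight, which accounts for
the quarters in front. -/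
theorem matT_potentialB4 (x : Fin 4 → ℂ) :
    matT (m := 2) ![1/4, 1/2, 3/4, 1] (fun x => potentialB4 (x 0) (x 1) (x 2) (x 3)) x
      = !![x 3, 5 / 4 * (x 1 * x 2 + x 0 ^ 2 * x 2 + x 0 * x 1 ^ 2),
          3 / 2 * (x 2 ^ 2 / 2 + 2 * x 0 * x 1 * x 2 + x 1 ^ 3 + 3 / 2 * x 0 ^ 2 * x 1 ^ 2
            + x 0 ^ 4 * x 1),
          7 / 4 * (x 0 * x 2 ^ 2 + x 1 ^ 2 * x 2 + x 0 * x 1 ^ 3 + 2 * x 0 ^ 3 * x 1 ^ 2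
            + x 0 ^ 7 / 7);
        3 / 4 * x 2, x 3 + x 0 * x 2 + x 1 ^ 2 + x 0 ^ 2 * x 1,
          5 / 4 * (2 * x 1 * x 2 + x 0 ^ 2 * x 2 + 3 * x 0 * x 1 ^ 2 + x 0 ^ 3 * x 1
            + x 0 ^ 5 / 5),
          3 / 2 * (x 2 ^ 2 / 2 + 2 * x 0 * x 1 * x 2 + x 1 ^ 3 + 3 / 2 * x 0 ^ 2 * x 1 ^ 2
            + x 0 ^ 4 * x 1);
        1 / 2 * x 1, 3 / 4 * (x 2 + x 0 * x 1 + x 0 ^ 3 / 3),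
          x 3 + x 0 * x 2 + x 1 ^ 2 + x 0 ^ 2 * x 1,
          5 / 4 * (x 1 * x 2 + x 0 ^ 2 * x 2 + x 0 * x 1 ^ 2);
        1 / 4 * x 0, 1 / 2 * x 1, 3 / 4 * x 2, x 3] := by
  ext i j
  rw [isModel_potentialB4.matT_eq isRoot_one (d := dataB4.d)
    (fun x _ => by rw [potentialB4_eq]; simp) (Set.mem_univ x)]
  fin_cases i <;> fin_cases j <;>
    simp [dataB4, freeTermsB4, evenTermsB4, MonoList.second, MonoList.deriv, cond_eq_ite,
      Nat.beq_eq, MonoList.expo, MonoList.lower, MonoList.eval, MonoList.mono, extend, Fin.rev] <;> ring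

end WDVV

/-! ### The Gram matrix of the gradients and the discriminant of B₄ -/

namespace WDVV

open MvPolynomial

/-- In four variables e_5, e_6, … vanish, so Newton's identities reduce higher power sums to the
first four. The Gram matrix involves the power sums up to the seventh. -/
theorem powerSum_five (y : Fin 4 → ℂ) : powerSum y 5 = 5 / 4 * powerSum y 1 * powerSum y 4
    - 5 / 6 * powerSum y 1 ^ 2 * powerSum y 3 + 5 / 6 * powerSum y 2 * powerSum y 3
    + 5 / 12 * powerSum y 1 ^ 3 * powerSum y 2 - 5 / 8 * powerSum y 1 * powerSum y 2 ^ 2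
    - 1 / 24 * powerSum y 1 ^ 5 := by
  simp only [powerSum, Fin.sum_univ_four]
  ring

theorem powerSum_six (y : Fin 4 → ℂ) : powerSum y 6 = 3 / 4 * powerSum y 1 ^ 2 * powerSum y 4
    - 2 / 3 * powerSum y 1 ^ 3 * powerSum y 3 + 3 / 8 * powerSum y 1 ^ 4 * powerSum y 2
    - 3 / 8 * powerSum y 1 ^ 2 * powerSum y 2 ^ 2 - 1 / 24 * powerSum y 1 ^ 6
    + 3 / 4 * powerSum y 2 * powerSum y 4 + 1 / 3 * powerSum y 3 ^ 2
    - 1 / 8 * powerSum y 2 ^ 3 := by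
  simp only [powerSum, Fin.sum_univ_four]
  ring

theorem powerSum_seven (y : Fin 4 → ℂ) : powerSum y 7 = 7 / 24 * powerSum y 1 ^ 3 * powerSum y 4
    - 7 / 24 * powerSum y 1 ^ 4 * powerSum y 3 + 7 / 48 * powerSum y 1 ^ 5 * powerSum y 2
    + 7 / 48 * powerSum y 1 ^ 3 * powerSum y 2 ^ 2 - 1 / 48 * powerSum y 1 ^ 7
    + 7 / 8 * powerSum y 1 * powerSum y 2 * powerSum y 4
    - 7 / 16 * powerSum y 1 * powerSum y 2 ^ 3
    - 7 / 12 * powerSum y 1 ^ 2 * powerSum y 2 * powerSum y 3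
    + 7 / 24 * powerSum y 2 ^ 2 * powerSum y 3 + 7 / 12 * powerSum y 3 * powerSum y 4 := by
  simp only [powerSum, Fin.sum_univ_four]
  ring

/-- A product of two odd powers is an even power, y^(2(l+k+1)), so the Gram matrix is a Hankel
matrix of power sums. -/
theorem odd_powers_mul_transpose (y : Fin 4 → ℂ) :
    (Matrix.of fun l k : Fin 4 => y k ^ (2 * (l : ℕ) + 1))
        * (Matrix.of fun l k : Fin 4 => y k ^ (2 * (l : ℕ) + 1)).transpose
      = Matrix.of fun l k : Fin 4 => powerSum y (l + k + 1) := by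
  ext l k
  simp only [Matrix.mul_apply, Matrix.transpose_apply, Matrix.of_apply, powerSum]
  exact Finset.sum_congr rfl fun i _ => by ring

/-- The constant can be seen in the entry of lowest degree: the squared gradient of the first power
sum is 4 x_1, while the corresponding entry of T is x_1 / 4. -/
theorem gram_flatB4 (y : Fin 4 → ℂ) :
    (Matrix.of fun i k : Fin 4 => eval y (pderiv k (flatB4 i)))
        * (Matrix.of fun i k : Fin 4 => eval y (pderiv k (flatB4 i))).transpose
      = (16 : ℂ) • (matT (m := 2) ![1/4, 1/2, 3/4, 1]
          (fun x => potentialB4 (x 0) (x 1) (x 2) (x 3))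
          fun l => eval y (flatB4 l)).submatrix Fin.revPerm id := by
  rw [eval_pderiv_flatB4, Matrix.transpose_mul, Matrix.mul_assoc,
    ← Matrix.mul_assoc _ _ (gradCoeff y).transpose, odd_powers_mul_transpose, matT_potentialB4]
  ext i j
  simp only [Matrix.mul_apply, Matrix.transpose_apply, Matrix.of_apply, Fin.sum_univ_four,
    Matrix.smul_apply, Matrix.submatrix_apply, eval_flatB4, id]
  fin_cases i <;> fin_cases j <;>
    simp [gradCoeff, Fin.rev, powerSum_five, powerSum_six, powerSum_seven] <;> ring

theorem isPotentialOfTypeB : IsPotentialOfTypeB (m := 2) ![1/4, 1/2, 3/4, 1]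
    (fun x : Fin 4 → ℂ => potentialB4 (x 0) (x 1) (x 2) (x 3)) := by
  refine ⟨⟨C (dataB4.d : ℂ)⁻¹ * MonoList.eval (fun i => if h : i < 4 then X ⟨i, h⟩ else 0) dataB4.G,
      fun x => ?_⟩,
    isPotential_potentialB4, flatB4, isBasicInvariantsB_flatB4, ⟨16, by norm_num, fun y i j => ?_⟩,
    ⟨2 ^ 28, by norm_num, fun y => ?_⟩⟩
  · refine (potentialB4_eq x).trans ?_
    rw [map_mul, eval_C, MonoList.map_eval]
    refine congrArg _ (congrArg (MonoList.eval · dataB4.G) (funext fun i => ?_))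
    rw [extend]
    split_ifs <;> simp
  · have h := congrFun (congrFun (gram_flatB4 y) i) j
    rwa [Matrix.mul_apply] at h
  -- Reversing four rows is an even permutation, so 2⁴⁴ times the discriminant equals 16⁴ det T,
  -- which gives the constant 2²⁸.
  · have h := congrArg Matrix.det (gram_flatB4 y)
    rw [Matrix.det_mul, Matrix.det_transpose, ← sq, det_gradB4, Matrix.det_smul,
      Matrix.det_permute, show Equiv.Perm.sign (Fin.revPerm : Equiv.Perm (Fin 4)) = 1 by decide] at h
    simp only [Fintype.card_fin, Units.val_one, Int.cast_one, one_mul] at h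
    linear_combination -h / 16 ^ 4

end WDVV

/-! ### The seven types together -/

theorem mainTheorem1 :
    -- type H₃: the known algebraic potential with `z² - x₁² - x₂ = 0`
    (∃ v u, WDVV.IsAlgebraicPotential (m := 1) ![1/3, 2/3, 1] v u ∧
      (∀ x : Fin 1 → ℂ, MvPolynomial.eval x v = -(x 0) ^ 2) ∧
      ∀ (x : Fin 3 → ℂ) (z : ℂ), z ^ 2 + -(x 0) ^ 2 - x 1 = 0 →
        WDVV.candidate u x z = WDVV.potentialH3 (x 0) (x 1) (x 2) z) ∧
    -- type D₄: the known algebraic potential with `-x₁² + x₂² + x₃ + ζ² = 0`, where `ζ = i z`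
    (∃ v u, WDVV.IsAlgebraicPotential (m := 2) ![1/2, 1/2, 1, 1] v u ∧
      (∀ x : Fin 2 → ℂ, MvPolynomial.eval x v = (x 0) ^ 2 - (x 1) ^ 2) ∧
      ∀ (x : Fin 4 → ℂ) (z ζ : ℂ), ζ = Complex.I * z →
        -(x 0) ^ 2 + (x 1) ^ 2 + x 2 + ζ ^ 2 = 0 →
        WDVV.candidate u x z = WDVV.potentialD4 (x 0) (x 1) (x 2) (x 3) ζ) ∧
    -- type F₄: the polynomial potential of the reflection group of type B₄
    (∃ v u, WDVV.IsAlgebraicPotential (m := 2) ![1/4, 1/2, 3/4, 1] v u ∧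
      (∀ (x : Fin 4 → ℂ) (z : ℂ), z ^ 2 + MvPolynomial.eval (WDVV.initial (m := 2) x) v - x 2 = 0 →
        WDVV.candidate u x z = WDVV.potentialB4 (x 0) (x 1) (x 2) (x 3)) ∧
      WDVV.IsPotentialOfTypeB (m := 2) ![1/4, 1/2, 3/4, 1]
        (fun x : Fin 4 → ℂ => WDVV.potentialB4 (x 0) (x 1) (x 2) (x 3))) ∧
    -- type H₄
    (∃ v u, WDVV.IsAlgebraicPotential (m := 2) ![1/10, 1/2, 3/5, 1] v u ∧
      (∀ x : Fin 2 → ℂ, MvPolynomial.eval x v = WDVV.vH4 (x 0) (x 1)) ∧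
      ∀ (x : Fin 4 → ℂ) (z : ℂ), z ^ 2 + WDVV.vH4 (x 0) (x 1) - x 2 = 0 →
        WDVV.candidate u x z = WDVV.potentialH4 (x 0) (x 1) (x 2) (x 3) z) ∧
    -- type E₆
    (∃ v u, WDVV.IsAlgebraicPotential (m := 4) ![2/9, 1/3, 5/9, 2/3, 8/9, 1] v u ∧
      (∀ x : Fin 4 → ℂ, MvPolynomial.eval x v = WDVV.vE6 (x 0) (x 1) (x 2) (x 3)) ∧
      ∀ (x : Fin 6 → ℂ) (z : ℂ), z ^ 2 + WDVV.vE6 (x 0) (x 1) (x 2) (x 3) - x 4 = 0 →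
        WDVV.candidate u x z
          = WDVV.potentialE6 (x 0) (x 1) (x 2) (x 3) (x 4) (x 5) z) ∧
    -- type E₇
    (∃ v u, WDVV.IsAlgebraicPotential (m := 5) ![1/7, 2/7, 3/7, 4/7, 5/7, 6/7, 1] v u ∧
      (∀ x : Fin 5 → ℂ, MvPolynomial.eval x v = WDVV.vE7 (x 0) (x 1) (x 2) (x 3) (x 4)) ∧
      ∀ (x : Fin 7 → ℂ) (z : ℂ), z ^ 2 + WDVV.vE7 (x 0) (x 1) (x 2) (x 3) (x 4) - x 5 = 0 →
        WDVV.candidate u x z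
          = WDVV.potentialE7 (x 0) (x 1) (x 2) (x 3) (x 4) (x 5) (x 6) z) ∧
    -- type E₈
    (∃ v u, WDVV.IsAlgebraicPotential (m := 6)
        ![1/12, 1/4, 1/3, 1/2, 7/12, 3/4, 5/6, 1] v u ∧
      (∀ x : Fin 6 → ℂ, MvPolynomial.eval x v
        = WDVV.vE8 (x 0) (x 1) (x 2) (x 3) (x 4) (x 5)) ∧
      ∀ (x : Fin 8 → ℂ) (z : ℂ),
        z ^ 2 + WDVV.vE8 (x 0) (x 1) (x 2) (x 3) (x 4) (x 5) - x 6 = 0 →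
        WDVV.candidate u x z
          = WDVV.potentialE8 (x 0) (x 1) (x 2) (x 3) (x 4) (x 5) (x 6) (x 7) z) := by
  exact ⟨⟨WDVV.dataH3.vPoly, WDVV.dataH3.uPoly 1 WDVV.evenTermsH3,
      WDVV.Data.isAlgebraicPotential WDVV.isPresented_dataH3 WDVV.isCommuting_dataH3
        WDVV.isLinear_dataH3 (by decide) (by decide) WDVV.checkSpectrum_dataH3
        WDVV.squarefree_specialH3, WDVV.eval_vPoly_dataH3,
      fun x _ => WDVV.candidate_dataH3 x⟩,
    ⟨WDVV.dataD4.vPoly, WDVV.dataD4.uPoly Complex.I WDVV.evenTermsD4,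
      WDVV.Data.isAlgebraicPotential WDVV.isPresented_dataD4 WDVV.isCommuting_dataD4
        WDVV.isLinear_dataD4 (by decide) (by decide) WDVV.checkSpectrum_dataD4
        WDVV.squarefree_specialD4, WDVV.eval_vPoly_dataD4,
      fun x _ _ => WDVV.candidate_dataD4 x⟩,
    ⟨WDVV.dataB4.vPoly, WDVV.dataB4.uPoly 1 WDVV.evenTermsB4,
      WDVV.Data.isAlgebraicPotential WDVV.isPresented_dataB4 WDVV.isCommuting_dataB4
        WDVV.isLinear_dataB4 (by decide) (by decide) WDVV.checkSpectrum_dataB4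
        WDVV.squarefree_specialB4, fun x _ => WDVV.candidate_dataB4 x, WDVV.isPotentialOfTypeB⟩,
    ⟨WDVV.dataH4.vPoly, WDVV.dataH4.uPoly 1 WDVV.evenTermsH4,
      WDVV.Data.isAlgebraicPotential WDVV.isPresented_dataH4 WDVV.isCommuting_dataH4
        WDVV.isLinear_dataH4 (by decide) (by decide) WDVV.checkSpectrum_dataH4
        WDVV.squarefree_specialH4, WDVV.eval_vPoly_dataH4,
      fun x _ => WDVV.candidate_dataH4 x⟩,
    ⟨WDVV.dataE6.vPoly, WDVV.dataE6.uPoly 1 WDVV.evenTermsE6,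
      WDVV.Data.isAlgebraicPotential WDVV.isPresented_dataE6 WDVV.isCommuting_dataE6
        WDVV.isLinear_dataE6 (by decide) (by decide) WDVV.checkSpectrum_dataE6
        WDVV.squarefree_specialE6, WDVV.eval_vPoly_dataE6,
      fun x _ => WDVV.candidate_dataE6 x⟩,
    ⟨WDVV.dataE7.vPoly, WDVV.dataE7.uPoly 1 WDVV.evenTermsE7,
      WDVV.Data.isAlgebraicPotential WDVV.isPresented_dataE7 WDVV.isCommuting_dataE7
        WDVV.isLinear_dataE7 (by decide) (by decide) WDVV.checkSpectrum_dataE7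
        WDVV.squarefree_specialE7, WDVV.eval_vPoly_dataE7,
      fun x _ => WDVV.candidate_dataE7 x⟩,
    ⟨WDVV.dataE8.vPoly, WDVV.dataE8.uPoly 2 WDVV.evenTermsE8,
      WDVV.Data.isAlgebraicPotential WDVV.isPresented_dataE8 WDVV.isCommuting_dataE8
        WDVV.isLinear_dataE8 (by decide) (by decide) WDVV.checkSpectrum_dataE8
        WDVV.squarefree_specialE8, WDVV.eval_vPoly_dataE8,
      fun x _ => WDVV.candidate_dataE8 x⟩⟩
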